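/- Let $n\ge 3$, let $\Omega\subset\mathbb{R}^n$ be a bounded open set with $C^\infty$ boundary, and let $\gamma_0\in C^\infty(\overline{\Omega})$ be real-valued with $\gamma_0>0$ on $\overline{\Omega}$. Let $m\ge 1$ be an integer and let $T=(T^{j_1\dots j_m})_{j_1,\dots,j_m=0}^n$ be a continuous function on $\overline{\Omega}$ with values in the space of complex symmetric tensors of rank $m$ (with indices running from $0$ to $n$). For a function $u$ let $(u,\nabla u)_j$, $j=0,1,\dots,n$, denote the $j$th component of the vector $(u,\partial_{x_1}u,\dots,\partial_{x_n}u)$, so that $(u,\nabla u)_0=u$; for $v,w\in\mathbb{C}^n$ write $v\cdot w=\sum_{j=1}^n v_jw_j$; and let $\pi(m+1)$ be the set of all permutations of $\{1,\dots,m+1\}$. Suppose that $$ \sum_{(l_1,\dots,l_{m+1})\in\pi(m+1)}\ \sum_{j_1,\dots,j_m=0}^n\int_\Omega T^{j_1\dots j_m}(x)\,(u_{l_1},\nabla u_{l_1})_{j_1}\cdots(u_{l_m},\nabla u_{l_m})_{j_m}\,\nabla u_{l_{m+1}}\cdot\nabla u_{m+2}\,dx=0 $$ for all complex-valued $u_1,\dots,u_{m+2}\in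 C^\infty(\overline{\Omega})$ solving $\nabla\cdot(\gamma_0\nabla u_l)=0$ in $\Omega$, $l=1,\dots,m+2$. Then $T$ vanishes identically on $\Omega$. -/

import Mathlib

open scoped ContDiff

noncomputable section

namespace Conductivity

/-- `Ω` has `C^∞` boundary: near every boundary point, `Ω` is the sublevel set `{ρ < 0}` of a
smooth function `ρ` with non-vanishing differential. -/
def HasSmoothBoundary {n : ℕ} (Ω : Set (EuclideanSpace ℝ (Fin n))) : Prop :=
  ∀ p ∈ frontier Ω, ∃ (U : Set (EuclideanSpace ℝ (Fin n))) (ρ : EuclideanSpace ℝ (Fin n) → ℝ),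
    IsOpen U ∧ p ∈ U ∧ ContDiffOn ℝ ∞ ρ U ∧ (∀ x ∈ U, fderiv ℝ ρ x ≠ 0) ∧
      Ω ∩ U = {x ∈ U | ρ x < 0}

/-- `u ∈ C^∞(Ω̄)`: on the closure of `Ω`, `u` is the restriction of a smooth function on `ℝⁿ`. -/
def SmoothUpToBoundary {n : ℕ} {F : Type*} [NormedAddCommGroup F] [NormedSpace ℝ F]
    (Ω : Set (EuclideanSpace ℝ (Fin n))) (u : EuclideanSpace ℝ (Fin n) → F) : Prop :=
  ∃ v : EuclideanSpace ℝ (Fin n) → F, ContDiff ℝ ∞ v ∧ Set.EqOn u v (closure Ω)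

/-- The partial derivative `∂_{x_i} u`. -/
def partialDeriv {n : ℕ} (i : Fin n) (u : EuclideanSpace ℝ (Fin n) → ℂ)
    (x : EuclideanSpace ℝ (Fin n)) : ℂ :=
  fderiv ℝ u x (EuclideanSpace.single i 1)

/-- `u` solves `∇ · (γ₀ ∇u) = 0` in `Ω`. -/
def IsSolution {n : ℕ} (Ω : Set (EuclideanSpace ℝ (Fin n))) (γ₀ : EuclideanSpace ℝ (Fin n) → ℝ)
    (u : EuclideanSpace ℝ (Fin n) → ℂ) : Prop :=
  ∀ x ∈ Ω, ∑ i : Fin n, partialDeriv i (fun y => (γ₀ y : ℂ) * partialDeriv i u y) x = 0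

/-- The vector `(u, ∇u) = (u, ∂_{x_1} u, …, ∂_{x_n} u)` at `x`, with components `0, …, n`. -/
def jet {n : ℕ} (u : EuclideanSpace ℝ (Fin n) → ℂ) (x : EuclideanSpace ℝ (Fin n)) :
    Fin (n + 1) → ℂ :=
  Fin.cons (u x) (fun i => partialDeriv i u x)

/-- The bilinear (not sesquilinear) product `∇u · ∇v` at `x`. -/
def gradDot {n : ℕ} (u v : EuclideanSpace ℝ (Fin n) → ℂ) (x : EuclideanSpace ℝ (Fin n)) : ℂ :=
  ∑ i : Fin n, partialDeriv i u x * partialDeriv i v x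

/-- The components `t^{j_1 … j_m}` form a symmetric tensor of rank `m`. -/
def IsSymmTensor {ι : Type*} {m : ℕ} (t : (Fin m → ι) → ℂ) : Prop :=
  ∀ (σ : Equiv.Perm (Fin m)) (j : Fin m → ι), t (j ∘ σ) = t j

end Conductivity

end

namespace Conductivity

open Complex

/-! Write γ₀ = ρ² on Ω, with ρ smooth and nowhere zero on ℝⁿ. Since T is symmetric, a permutation
matters only through the index it puts in the gradient slot, so the hypothesis is m! times the
statement that Σ_l ∫ (∇u_l · ∇w) T(jets of the other u's) vanishes. The integrand is `gradForm`, and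
its uniqueness theorem `eq_zero_of_integral_gradForm` is proved by induction on the rank, starting
from rank 0.

The test functions are complex geometric optics solutions ρ⁻¹ e^{ζ·x}(a + r) with ζ·ζ = 0, ζ·∇a = 0
and r = O(1/|Re ζ|) together with its first and second derivatives. They come from
`exists_conjugated_solution`, which inverts Δ + 2ζ·∇ - q on a ball by Fourier series. The frequency
lattice is rotated and shifted by half a step in the direction of Re ζ, so the symbol is bounded
below by a multiple of |Re ζ|. The potential then acts as a small convolution operator on ℓ¹, and
the equation is solved by contraction.

Rank 0 (`eq_zero_of_integral_gradDot`) is the linearized Calderón problem. For two solutions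
2γ₀∇u·∇w = ∇·(γ₀∇(uw)). With opposite phases Nν and -Nν the exponentials cancel, and as N grows uw
tends to ρ⁻² e^{iθ·x} in C², where ν is chosen orthogonal to θ (this uses n ≥ 3). The limit is an
identity for plane waves, hence for all smooth functions; solving a Schrödinger equation then makes
the test function arbitrary.

Inductive step. Taking one u equal to 1, whose jet is e_0, gives the identity for the contraction of
T with e_0, so all components with an index 0 vanish. Next let one u and w have phases Nν and -Nν
with ν = e_a + i e_b, and divide by N². As ν·ν = 0, only the contraction T(ν, …) survives, weighted
by an amplitude A with (∂_a + i∂_b)A = 0. Viewed as a function of one remaining solution this is an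
identity ∫ A G·∇u = 0, and `eq_zero_of_integral_first_order` forces G = 0 by a second choice of
phases, with entries of three different orders in N. The result is pointwise. Since jets of
solutions take every value (`exists_solution_jet`), it reads (ν·q')T(ν, q, …, q) = 0 for every jet q
with gradient part q'. Density and polarization give T(ν, …) = 0, and the vectors e_a + i e_b span.
-/

/-- Euclidean `n`-space. -/
abbrev Euc (n : ℕ) := EuclideanSpace ℝ (Fin n)

variable {n : ℕ}

/-! ### Partial derivatives and complex exponentials -/

section Calculus

lemma contDiff_partialDeriv {u : Euc n → ℂ} (hu : ContDiff ℝ ∞ u) (i : Fin n) :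
    ContDiff ℝ ∞ (partialDeriv i u) :=
  (hu.fderiv_right (by simp)).clm_apply contDiff_const

lemma partialDeriv_congr {u v : Euc n → ℂ} {x : Euc n} (h : u =ᶠ[nhds x] v) (i : Fin n) :
    partialDeriv i u x = partialDeriv i v x := by
  unfold partialDeriv; rw [h.fderiv_eq]

lemma partialDeriv_add {u v : Euc n → ℂ} {x : Euc n} (hu : DifferentiableAt ℝ u x)
    (hv : DifferentiableAt ℝ v x) (i : Fin n) :
    partialDeriv i (fun y => u y + v y) x = partialDeriv i u x + partialDeriv i v x := by
  unfold partialDeriv; rw [fderiv_fun_add hu hv]; rfl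

lemma partialDeriv_sub {u v : Euc n → ℂ} {x : Euc n} (hu : DifferentiableAt ℝ u x)
    (hv : DifferentiableAt ℝ v x) (i : Fin n) :
    partialDeriv i (fun y => u y - v y) x = partialDeriv i u x - partialDeriv i v x := by
  unfold partialDeriv; rw [fderiv_fun_sub hu hv]; rfl

lemma partialDeriv_mul {u v : Euc n → ℂ} {x : Euc n} (hu : DifferentiableAt ℝ u x)
    (hv : DifferentiableAt ℝ v x) (i : Fin n) :
    partialDeriv i (fun y => u y * v y) x
      = partialDeriv i u x * v x + u x * partialDeriv i v x := by
  unfold partialDeriv; rw [fderiv_fun_mul hu hv]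
  simp [mul_comm]; ring

lemma partialDeriv_const (c : ℂ) (i : Fin n) (x : Euc n) :
    partialDeriv i (fun _ => c) x = 0 := by
  simp [partialDeriv]

lemma partialDeriv_const_mul {u : Euc n → ℂ} {x : Euc n} (hu : DifferentiableAt ℝ u x)
    (c : ℂ) (i : Fin n) :
    partialDeriv i (fun y => c * u y) x = c * partialDeriv i u x := by
  rw [partialDeriv_mul (by fun_prop) hu, partialDeriv_const]; ring

/-- The exponential `exp (z · x)` with complex frequency vector `z`. -/
noncomputable def wave (z : Fin n → ℂ) (x : Euc n) : ℂ := cexp (∑ i, z i * (x i : ℂ))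

lemma contDiff_wave (z : Fin n → ℂ) : ContDiff ℝ ∞ (wave z) := by
  unfold wave
  refine ContDiff.cexp (ContDiff.sum fun i _ => contDiff_const.mul ?_)
  exact Complex.ofRealCLM.contDiff.comp (EuclideanSpace.proj i : Euc n →L[ℝ] ℝ).contDiff

lemma wave_ne_zero (z : Fin n → ℂ) (x : Euc n) : wave z x ≠ 0 := Complex.exp_ne_zero _

lemma wave_add (z w : Fin n → ℂ) (x : Euc n) : wave (z + w) x = wave z x * wave w x := by
  simp [wave, ← Complex.exp_add, add_mul, Finset.sum_add_distrib]

lemma wave_zero (x : Euc n) : wave (0 : Fin n → ℂ) x = 1 := by simp [wave]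

lemma hasFDerivAt_wave (z : Fin n → ℂ) (x : Euc n) :
    HasFDerivAt (wave z) (∑ i, (Complex.ofRealCLM.comp
      (EuclideanSpace.proj i : Euc n →L[ℝ] ℝ)).smulRight (z i * wave z x)) x := by
  have h : HasFDerivAt (fun y : Euc n => ∑ i, z i * (y i : ℂ))
      (∑ i, z i • (Complex.ofRealCLM.comp (EuclideanSpace.proj i : Euc n →L[ℝ] ℝ))) x := by
    refine HasFDerivAt.fun_sum fun i _ => HasFDerivAt.const_mul ?_ _
    exact (Complex.ofRealCLM.comp (EuclideanSpace.proj i : Euc n →L[ℝ] ℝ)).hasFDerivAt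
  refine h.cexp.congr_fderiv ?_
  ext y
  simp only [wave, smul_apply, sum_apply,
    ContinuousLinearMap.smulRight_apply, ContinuousLinearMap.comp_apply, smul_eq_mul,
    Finset.mul_sum]
  exact Finset.sum_congr rfl fun i _ => by ring

lemma partialDeriv_wave (z : Fin n → ℂ) (i : Fin n) :
    partialDeriv i (wave z) = fun x => z i * wave z x := by
  ext x
  unfold partialDeriv
  rw [(hasFDerivAt_wave z x).fderiv]
  simp [PiLp.single_apply, apply_ite ofReal, ite_mul]

end Calculus

/-! ### Trigonometric series with rapidly decaying coefficients -/

section Series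

/-- The purely imaginary frequency vector `i ℓ`. -/
noncomputable def osc (ℓ : Euc n) : Fin n → ℂ := fun i => I * (ℓ i : ℂ)

lemma osc_add (ℓ m : Euc n) : osc (ℓ + m) = osc ℓ + osc m := by
  ext i; simp [osc, mul_add]

lemma norm_wave_osc (ℓ x : Euc n) : ‖wave (osc ℓ) x‖ = 1 := by
  unfold wave osc
  rw [show (∑ i, I * (ℓ i : ℂ) * (x i : ℂ)) = ((∑ i, ℓ i * x i : ℝ) : ℂ) * I by
    push_cast; rw [Finset.sum_mul]; exact Finset.sum_congr rfl fun i _ => by ring]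
  exact Complex.norm_exp_ofReal_mul_I _

variable {ι : Type*}

/-- All weighted `ℓ¹` norms of the coefficients `c` at the frequencies `ℓ` are finite. -/
def RapidDecay (ℓ : ι → Euc n) (c : ι → ℂ) : Prop :=
  ∀ s : ℕ, Summable fun k => (1 + ‖ℓ k‖) ^ s * ‖c k‖

/-- The trigonometric series with frequencies `ℓ` and coefficients `c`. -/
noncomputable def trigSeries (ℓ : ι → Euc n) (c : ι → ℂ) (x : Euc n) : ℂ :=
  ∑' k, c k * wave (osc (ℓ k)) x

lemma RapidDecay.summable_norm {ℓ : ι → Euc n} {c : ι → ℂ} (h : RapidDecay ℓ c) :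
    Summable fun k => ‖c k‖ := by simpa using h 0

lemma abs_coord_le (x : Euc n) (i : Fin n) : |x i| ≤ ‖x‖ := by
  simpa using EuclideanSpace.norm_eq x ▸ PiLp.norm_apply_le x i

lemma norm_osc_le (ℓ : Euc n) (i : Fin n) : ‖osc ℓ i‖ ≤ 1 + ‖ℓ‖ := by
  have := abs_coord_le ℓ i
  simp only [osc, norm_mul, norm_I, one_mul, norm_real, Real.norm_eq_abs]
  linarith

/-- Differentiation costs one power of the weight, and all powers are available; this closure makes
term-by-term differentiation repeatable. -/
lemma RapidDecay.mul_osc {ℓ : ι → Euc n} {c : ι → ℂ} (h : RapidDecay ℓ c) (i : Fin n) :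
    RapidDecay ℓ (fun k => osc (ℓ k) i * c k) := by
  intro s
  refine Summable.of_nonneg_of_le (fun k => by positivity) (fun k => ?_) (h (s + 1))
  rw [norm_mul, pow_succ, mul_assoc]
  gcongr
  exact norm_osc_le _ _

lemma summable_trigSeries {ℓ : ι → Euc n} {c : ι → ℂ} (h : Summable fun k => ‖c k‖) (x : Euc n) :
    Summable fun k => c k * wave (osc (ℓ k)) x :=
  Summable.of_norm (by simpa [norm_wave_osc] using h)

lemma norm_trigSeries_le {ℓ : ι → Euc n} {c : ι → ℂ} (h : Summable fun k => ‖c k‖) (x : Euc n) :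
    ‖trigSeries ℓ c x‖ ≤ ∑' k, ‖c k‖ := by
  refine (norm_tsum_le_tsum_norm ?_).trans_eq ?_ <;> simp [norm_wave_osc, h]

lemma hasFDerivAt_trigSeries {ℓ : ι → Euc n} {c : ι → ℂ} (h : RapidDecay ℓ c) (x : Euc n) :
    HasFDerivAt (trigSeries ℓ c) (∑ i, (Complex.ofRealCLM.comp
      (EuclideanSpace.proj i : Euc n →L[ℝ] ℝ)).smulRight
        (trigSeries ℓ (fun k => osc (ℓ k) i * c k) x)) x := by
  -- Packaging v ↦ dx_i ⊗ v as a continuous linear map lets it pass through the infinite sum over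
  -- frequencies.
  let D : Fin n → ℂ →L[ℝ] Euc n →L[ℝ] ℂ := fun i =>
    ContinuousLinearMap.smulRightL ℝ (Euc n) ℂ
      (EuclideanSpace.proj i : Euc n →L[ℝ] ℝ)
  have hD : ∀ i v, D i v = (Complex.ofRealCLM.comp
      (EuclideanSpace.proj i : Euc n →L[ℝ] ℝ)).smulRight v := by
    intro i v; ext y; simp [D]
  have hDn : ∀ i v, ‖D i v‖ ≤ ‖v‖ := by
    intro i v
    refine ContinuousLinearMap.opNorm_le_bound _ (norm_nonneg _) fun y => ?_
    rw [hD]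
    simp only [ContinuousLinearMap.smulRight_apply, ContinuousLinearMap.comp_apply,
      ofRealCLM_apply, smul_eq_mul, norm_mul, norm_real]
    rw [mul_comm]; gcongr
    exact abs_coord_le y i
  simp only [← hD]
  have key := hasFDerivAt_tsum (𝕜 := ℝ) (f := fun k y => c k * wave (osc (ℓ k)) y)
    (f' := fun k y => ∑ i, D i (osc (ℓ k) i * c k * wave (osc (ℓ k)) y))
    (u := fun k => ∑ i : Fin n, ‖osc (ℓ k) i * c k‖) (x₀ := x)
    (summable_sum fun i _ => (h.mul_osc i).summable_norm) ?_ ?_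
    (summable_trigSeries h.summable_norm x) x
  · convert! key using 1
    rw [Summable.tsum_finsetSum]
    · refine Finset.sum_congr rfl fun i _ => ?_
      rw [trigSeries, ContinuousLinearMap.map_tsum _
        (summable_trigSeries (h.mul_osc i).summable_norm x)]
    · intro i _
      exact (D i).summable (summable_trigSeries (h.mul_osc i).summable_norm x)
  · intro k y
    refine ((hasFDerivAt_wave (osc (ℓ k)) y).const_mul (c k)).congr_fderiv ?_
    ext v
    simp only [hD, smul_apply, sum_apply,
      ContinuousLinearMap.smulRight_apply, ContinuousLinearMap.comp_apply, smul_eq_mul,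
      Finset.mul_sum]
    exact Finset.sum_congr rfl fun i _ => by ring
  · intro k y
    refine (norm_sum_le _ _).trans (Finset.sum_le_sum fun i _ => (hDn _ _).trans ?_)
    simp [norm_wave_osc]

lemma partialDeriv_trigSeries {ℓ : ι → Euc n} {c : ι → ℂ} (h : RapidDecay ℓ c) (i : Fin n) :
    partialDeriv i (trigSeries ℓ c) = trigSeries ℓ (fun k => osc (ℓ k) i * c k) := by
  ext x
  unfold partialDeriv
  rw [(hasFDerivAt_trigSeries h x).fderiv]
  simp [PiLp.single_apply, apply_ite ofReal, ite_mul]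

lemma contDiff_trigSeries {ℓ : ι → Euc n} {c : ι → ℂ} (h : RapidDecay ℓ c) :
    ContDiff ℝ ∞ (trigSeries ℓ c) := by
  rw [contDiff_infty]
  intro N
  -- The derivative is again built from such series with other coefficients, so the induction must
  -- range over all rapidly decaying `c`.
  induction N generalizing c with
  | zero =>
    rw [Nat.cast_zero, contDiff_zero]
    exact (Differentiable.continuous (𝕜 := ℝ)
      fun x => (hasFDerivAt_trigSeries h x).differentiableAt)
  | succ N ih =>
    rw [Nat.cast_add, Nat.cast_one, contDiff_succ_iff_fderiv]
    refine ⟨fun x => (hasFDerivAt_trigSeries h x).differentiableAt, by simp, ?_⟩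
    have : fderiv ℝ (trigSeries ℓ c) = fun x => ∑ i, (Complex.ofRealCLM.comp
      (EuclideanSpace.proj i : Euc n →L[ℝ] ℝ)).smulRight
        (trigSeries ℓ (fun k => osc (ℓ k) i * c k) x) :=
      funext fun x => (hasFDerivAt_trigSeries h x).fderiv
    rw [this]
    exact ContDiff.sum fun i _ => contDiff_const.smulRight (ih (h.mul_osc i))

end Series

end Conductivity

namespace Conductivity

open Complex MeasureTheory
open scoped FourierTransform

variable {n : ℕ}

/-! ### Summability over the integer lattice -/

section Lattice

/-- The integer vector `k` as a point of Euclidean space. -/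
noncomputable def latticeVec (k : Fin n → ℤ) : Euc n := WithLp.toLp 2 fun i => (k i : ℝ)

@[simp] lemma latticeVec_apply (k : Fin n → ℤ) (i : Fin n) : latticeVec k i = k i := rfl

lemma latticeVec_add (j k : Fin n → ℤ) : latticeVec (j + k) = latticeVec j + latticeVec k := by
  ext i; simp

lemma summable_inv_one_add_abs_sq : Summable fun j : ℤ => ((1 + |(j : ℝ)|) ^ 2)⁻¹ := by
  have h : Summable fun j : ℕ => ((1 + (j : ℝ)) ^ 2)⁻¹ := by
    have := (summable_nat_add_iff 1).2 (Real.summable_nat_pow_inv.2 (one_lt_two))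
    simpa [add_comm] using this
  refine Summable.of_nat_of_neg ?_ ?_ <;> simpa using h

lemma summable_prod_pi {n : ℕ} {f : ℤ → ℝ} (hf : Summable f) (h0 : ∀ j, 0 ≤ f j) :
    Summable fun k : Fin n → ℤ => ∏ i, f (k i) := by
  induction n with
  | zero => exact .of_finite
  | succ n ih =>
    rw [← (Fin.consEquiv fun _ : Fin (n + 1) => ℤ).summable_iff]
    have := hf.mul_of_nonneg ih h0 (fun k => Finset.prod_nonneg fun i _ => h0 _)
    refine this.congr fun p => ?_
    simp [Fin.prod_univ_succ, Fin.consEquiv]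

/-- The exponent 2n leaves a factor (1 + |k_i|)⁻² for each coordinate, so a product of
one-dimensional convergent series dominates; the shift costs only a constant. -/
lemma summable_inv_one_add_norm_latticeVec (a : Euc n) :
    Summable fun k : Fin n → ℤ => ((1 + ‖latticeVec k + a‖) ^ (2 * n))⁻¹ := by
  have h := (summable_prod_pi (n := n) summable_inv_one_add_abs_sq
    fun j => by positivity).mul_left ((1 + ‖a‖) ^ (2 * n))
  refine Summable.of_nonneg_of_le (fun k => by positivity) (fun k => ?_) h
  have h1 : 1 + ‖latticeVec k‖ ≤ (1 + ‖a‖) * (1 + ‖latticeVec k + a‖) := by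
    have : ‖latticeVec k‖ ≤ ‖latticeVec k + a‖ + ‖a‖ := by
      simpa using norm_sub_le (latticeVec k + a) a
    nlinarith [norm_nonneg a, norm_nonneg (latticeVec k + a)]
  have h2 : ∏ i, (1 + |(k i : ℝ)|) ^ 2 ≤ (1 + ‖latticeVec k‖) ^ (2 * n) := by
    calc ∏ i, (1 + |(k i : ℝ)|) ^ 2 ≤ ∏ _i : Fin n, (1 + ‖latticeVec k‖) ^ 2 := by
          refine Finset.prod_le_prod (fun i _ => by positivity) fun i _ => ?_
          gcongr
          exact abs_coord_le (latticeVec k) i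
      _ = _ := by simp [pow_mul]
  rw [Finset.prod_inv_distrib, ← div_eq_mul_inv, inv_eq_one_div,
    div_le_div_iff₀ (by positivity) (Finset.prod_pos fun i _ => by positivity), one_mul]
  calc _ ≤ _ := h2
    _ ≤ ((1 + ‖a‖) * (1 + ‖latticeVec k + a‖)) ^ (2 * n) := by gcongr
    _ = _ := mul_pow _ _ _

end Lattice

/-! ### Fourier series on a ball from samples of one Fourier transform -/

section Fourier

lemma wave_osc_eq (ℓ x : Euc n) : wave (osc ℓ) x = cexp (I * (inner ℝ ℓ x : ℝ)) := by
  simp only [wave, osc, PiLp.inner_apply, RCLike.inner_apply, conj_trivial]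
  push_cast
  rw [Finset.mul_sum]
  congr 1
  exact Finset.sum_congr rfl fun i _ => by ring

lemma fourier_eq_wave (Q : Euc n → ℂ) (ξ : Euc n) :
    𝓕 Q ξ = ∫ x, wave (osc (-(2 * Real.pi) • ξ)) x * Q x := by
  rw [Real.fourier_eq']
  congr 1
  ext x
  rw [wave_osc_eq, smul_eq_mul, real_inner_smul_left, real_inner_comm x ξ]
  congr 2
  push_cast
  ring

lemma mFourier_coe (k : Fin n → ℤ) (x : Fin n → ℝ) :
    UnitAddTorus.mFourier k (fun i => (x i : UnitAddCircle))
      = wave (osc ((2 * Real.pi) • latticeVec k)) (WithLp.toLp 2 x) := by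
  simp only [UnitAddTorus.mFourier, ContinuousMap.coe_mk, fourier_coe_apply, wave, osc,
    ← Complex.exp_sum]
  congr 1
  refine Finset.sum_congr rfl fun i _ => ?_
  simp only [PiLp.smul_apply, latticeVec_apply, smul_eq_mul]
  push_cast
  ring

/-- A continuous function supported in a small ball, extended periodically to the torus. -/
noncomputable def periodize (Q : Euc n → ℂ) (t : UnitAddTorus (Fin n)) : ℂ :=
  Q (WithLp.toLp 2 fun i => (AddCircle.equivIoc 1 (-(1 / 2) : ℝ) (t i) : ℝ))

lemma equivIoc_coe {x : ℝ} (hx : x ∈ Set.Ioc (-(1 / 2) : ℝ) (-(1 / 2) + 1)) :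
    (AddCircle.equivIoc 1 (-(1 / 2) : ℝ) (x : AddCircle (1 : ℝ)) : ℝ) = x :=
  AddCircle.equivIoc_coe_of_mem hx

lemma norm_coe_addCircle {x : ℝ} (hx : |x| ≤ 1 / 2) : ‖(x : UnitAddCircle)‖ = |x| :=
  (AddCircle.norm_coe_eq_abs_iff 1 one_ne_zero).2 (by simpa using hx)

lemma continuous_periodize {Q : Euc n → ℂ} (hQ : Continuous Q)
    (hs : ∀ x, 1 / 4 < ‖x‖ → Q x = 0) : Continuous (periodize Q) := by
  rw [continuous_iff_continuousAt]
  intro t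
  -- The representative in (-1/2, 1/2] jumps only at the class of 1/2. Near a point with a
  -- coordinate of norm above 1/4 the function is zero; elsewhere every coordinate stays away from
  -- the jump.
  by_cases ht : ∃ i, 1 / 4 < ‖t i‖
  · obtain ⟨i, hi⟩ := ht
    have : periodize Q =ᶠ[nhds t] fun _ => 0 := by
      have ho : IsOpen {s : UnitAddTorus (Fin n) | 1 / 4 < ‖s i‖} :=
        isOpen_lt continuous_const (by fun_prop)
      filter_upwards [ho.mem_nhds hi] with s hs'
      refine hs _ (lt_of_lt_of_le ?_ (abs_coord_le _ i))
      have h1 := (AddCircle.equivIoc 1 (-(1 / 2) : ℝ) (s i)).2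
      have h2 := norm_coe_addCircle (abs_le.2 ⟨h1.1.le, by linarith [h1.2]⟩)
      rw [show ((AddCircle.equivIoc 1 (-(1 / 2) : ℝ) (s i) : ℝ) : UnitAddCircle) = s i from
        (AddCircle.equivIoc 1 (-(1 / 2) : ℝ)).symm_apply_apply (s i)] at h2
      simpa [h2] using hs'
    exact continuousAt_const.congr this.symm
  · push Not at ht
    refine hQ.continuousAt.comp ?_
    refine (PiLp.continuous_toLp 2 _).continuousAt.comp (continuousAt_pi.2 fun i => ?_)
    refine continuousAt_subtype_val.comp (ContinuousAt.comp
      (AddCircle.continuousAt_equivIoc 1 (-(1 / 2) : ℝ) ?_) (continuous_apply i).continuousAt)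
    intro h
    have h3 := ht i
    rw [h, norm_coe_addCircle (by norm_num [abs_of_pos])] at h3
    norm_num [abs_of_pos] at h3

/-- The support lies inside one period cell, so integrating over the cell is integrating over the
whole space. -/
lemma mFourierCoeff_periodize {Q : Euc n → ℂ} (hs : ∀ x, 1 / 4 < ‖x‖ → Q x = 0)
    (k : Fin n → ℤ) :
    UnitAddTorus.mFourierCoeff (periodize Q) k = 𝓕 Q (latticeVec k) := by
  have hI : ∫ x : Euc n, wave (osc (-(2 * Real.pi) • latticeVec k)) x * Q x =
      ∫ x in {x : Fin n → ℝ | ∀ i, x i ∈ Set.Ioc (-(1 / 2) : ℝ) (-(1 / 2) + 1)},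
        wave (osc (-(2 * Real.pi) • latticeVec k)) (WithLp.toLp 2 x) * Q (WithLp.toLp 2 x) := by
    rw [← (PiLp.volume_preserving_toLp (Fin n)).integral_comp
      (MeasurableEquiv.toLp 2 (Fin n → ℝ)).measurableEmbedding]
    refine (setIntegral_eq_integral_of_forall_compl_eq_zero fun x hx => ?_).symm
    rw [hs, mul_zero]
    simp only [Set.mem_ofPred_eq, not_forall] at hx
    obtain ⟨i, hi⟩ := hx
    refine lt_of_lt_of_le ?_ (abs_coord_le (WithLp.toLp 2 x) i)
    by_contra hc
    have := abs_le.1 (not_lt.1 hc)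
    exact hi ⟨by simp at this ⊢; linarith, by simp at this ⊢; linarith⟩
  rw [UnitAddTorus.mFourierCoeff_eq_integral _ _ (fun _ => -(1 / 2)), fourier_eq_wave, hI]
  refine setIntegral_congr_fun
    (MeasurableSet.univ_pi' fun i : Fin n => measurableSet_Ioc (α := ℝ)) fun x hx => ?_
  simp only [mFourier_coe, smul_eq_mul, periodize]
  congr 2
  · congr 1
    ext i; simp
  · ext i
    exact equivIoc_coe (hx i)

lemma hasSum_fourier_of_support {Q : Euc n → ℂ} (hQ : Continuous Q)
    (hs : ∀ x, 1 / 4 < ‖x‖ → Q x = 0)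
    (hsum : Summable fun k : Fin n → ℤ => 𝓕 Q (latticeVec k)) {x : Euc n} (hx : ‖x‖ < 1 / 2) :
    HasSum (fun k => 𝓕 Q (latticeVec k) * wave (osc ((2 * Real.pi) • latticeVec k)) x) (Q x) := by
  have h := UnitAddTorus.hasSum_mFourier_series_apply_of_summable
    (f := ⟨periodize Q, continuous_periodize hQ hs⟩)
    (hsum.congr fun k => (mFourierCoeff_periodize hs k).symm) (fun i => (x i : UnitAddCircle))
  simp only [ContinuousMap.coe_mk, mFourierCoeff_periodize hs, smul_eq_mul] at h
  have hxi : ∀ i, x i ∈ Set.Ioc (-(1 / 2) : ℝ) (-(1 / 2) + 1) := fun i => by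
    have := abs_lt.1 ((abs_coord_le x i).trans_lt hx)
    constructor <;> linarith
  have hp : periodize Q (fun i => (x i : UnitAddCircle)) = Q x := by
    unfold periodize
    congr 1
    ext i
    exact equivIoc_coe (hxi i)
  rw [hp] at h
  convert! h using 3 with k
  exact (mFourier_coe k _).symm

/-- Fourier series of a smooth function on a ball, for an arbitrarily rotated and shifted lattice of
frequencies; the coefficients are the samples of a single rapidly decaying function. -/
lemma exists_fourier_expansion {φ : Euc n → ℂ} (hφ : ContDiff ℝ ∞ φ) {R : ℝ} (hR : 0 < R) :
    ∃ φhat : Euc n → ℂ, (∀ s : ℕ, ∃ C, ∀ ξ, (1 + ‖ξ‖) ^ s * ‖φhat ξ‖ ≤ C) ∧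
      ∀ (O : Euc n ≃ₗᵢ[ℝ] Euc n) (b x : Euc n), ‖x‖ < R →
        HasSum (fun k => φhat (O (latticeVec k) + b) *
          wave (osc ((Real.pi / (4 * R)) • (O (latticeVec k) + b))) x) (φ x) := by
  -- Scaling by 8R sends the ball of radius R into the ball of radius 1/8, where the cutoff is 1,
  -- and the support stays within radius 1/4, inside the unit cell. The unit lattice then scales to
  -- frequencies with step 2π/(8R) = π/(4R).
  let χ : ContDiffBump (0 : Euc n) := ⟨1 / 8, 1 / 4, by norm_num, by norm_num⟩
  let Q₀ : Euc n → ℂ := fun y => (χ y : ℂ) * φ ((8 * R) • y)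
  have hQ₀ : ContDiff ℝ ∞ Q₀ := by
    refine ContDiff.mul (Complex.ofRealCLM.contDiff.comp χ.contDiff) (hφ.comp ?_)
    exact contDiff_const_smul _
  have hQ₀c : HasCompactSupport Q₀ := by
    refine HasCompactSupport.mul_right ?_
    exact χ.hasCompactSupport.comp_left (g := ofReal) ofReal_zero
  have hQ₀s : ∀ y, 1 / 4 < ‖y‖ → Q₀ y = 0 := fun y hy => by
    simp only [Q₀]
    rw [χ.zero_of_le_dist (by simpa [χ] using hy.le)]
    simp
  let S := hQ₀c.toSchwartzMap hQ₀
  have hS : ((𝓕 S : SchwartzMap (Euc n) ℂ) : Euc n → ℂ) = 𝓕 Q₀ := rfl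
  have hdecay : ∀ s : ℕ, ∃ C, ∀ ξ, (1 + ‖ξ‖) ^ s * ‖𝓕 Q₀ ξ‖ ≤ C := fun s => ⟨_, fun ξ => by
    have := SchwartzMap.one_add_le_sup_seminorm_apply (𝕜 := ℝ) (m := (s, 0)) le_rfl le_rfl
      (𝓕 S : SchwartzMap (Euc n) ℂ) ξ
    rw [norm_iteratedFDeriv_zero, hS] at this
    exact this⟩
  refine ⟨𝓕 Q₀, hdecay, fun O b x hx => ?_⟩
  -- Modulating by the frequency b shifts the sampled lattice by b, and composing with `O` rotates
  -- it; the Fourier transform being sampled remains that of `Q₀`.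
  let Q₁ : Euc n → ℂ := fun y => wave (osc (-(2 * Real.pi) • b)) y * Q₀ y
  have hQ₁ : ∀ ξ, 𝓕 Q₁ ξ = 𝓕 Q₀ (ξ + b) := fun ξ => by
    rw [fourier_eq_wave, fourier_eq_wave, smul_add]
    simp only [Q₁, osc_add, wave_add, mul_assoc]
  have hcont : Continuous (Q₁ ∘ O) :=
    (((contDiff_wave _).continuous).mul hQ₀.continuous).comp O.continuous
  have hfou : ∀ k, 𝓕 (Q₁ ∘ O) (latticeVec k) = 𝓕 Q₀ (O (latticeVec k) + b) := fun k => by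
    rw [Real.fourier_comp_linearIsometry, hQ₁]
  obtain ⟨C, hC⟩ := hdecay (2 * n)
  have hsum : Summable fun k : Fin n → ℤ => 𝓕 (Q₁ ∘ O) (latticeVec k) := by
    refine Summable.of_norm_bounded
      ((summable_inv_one_add_norm_latticeVec (O.symm b)).mul_left C) fun k => ?_
    have hnorm : ‖latticeVec k + O.symm b‖ = ‖O (latticeVec k) + b‖ := by
      rw [← O.norm_map]; simp
    rw [hfou, hnorm, ← div_eq_mul_inv, le_div_iff₀ (by positivity), mul_comm]
    exact hC _
  have hR8 : (8 * R)⁻¹ * ‖x‖ < 1 / 8 := by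
    rw [inv_mul_lt_iff₀ (by positivity)]; linarith
  have hy : ‖O.symm ((8 * R)⁻¹ • x)‖ < 1 / 8 := by
    rw [LinearIsometryEquiv.norm_map, norm_smul, Real.norm_of_nonneg (by positivity)]
    exact hR8
  have hexp := hasSum_fourier_of_support hcont (fun y hy => by
    simp only [Function.comp, Q₁]
    rw [hQ₀s _ (by simpa using hy), mul_zero]) hsum (hy.trans (by norm_num))
  have hval : (Q₁ ∘ O) (O.symm ((8 * R)⁻¹ • x))
      = wave (osc (-(Real.pi / (4 * R)) • b)) x * φ x := by
    simp only [Function.comp, LinearIsometryEquiv.apply_symm_apply, Q₁, Q₀]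
    rw [χ.one_of_mem_closedBall, smul_smul, mul_inv_cancel₀ (by positivity), one_smul, wave_osc_eq,
      wave_osc_eq, ofReal_one, one_mul]
    · congr 4
      simp only [real_inner_smul_left, real_inner_smul_right]
      field_simp
      ring
    · rw [Metric.mem_closedBall, dist_zero_right, norm_smul, Real.norm_of_nonneg (by positivity)]
      exact hR8.le
  rw [hval] at hexp
  have := hexp.mul_left (wave (osc ((Real.pi / (4 * R)) • b)) x)
  rw [← mul_assoc, ← wave_add, ← osc_add, neg_smul, add_neg_cancel] at this
  have h0 : wave (osc (0 : Euc n)) x = 1 := by rw [wave_osc_eq]; simp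
  rw [h0, one_mul] at this
  convert! this using 2 with k
  rw [hfou, smul_add, osc_add, wave_add, ← mul_assoc, mul_comm (wave _ _) (_ * _), mul_assoc,
    mul_assoc]
  congr 2
  rw [wave_osc_eq, wave_osc_eq]
  congr 3
  rw [real_inner_smul_left, real_inner_smul_left, map_smul, real_inner_smul_right,
    ← O.inner_map_map (latticeVec k), O.apply_symm_apply]
  field_simp
  ring

end Fourier

end Conductivity

namespace Conductivity

open Complex MeasureTheory

variable {n : ℕ}

/-! ### Contraction in ℓ¹ -/

section FixedPoint

variable {ι : Type*}

/-- Uniformly bounded column sums are exactly what is needed to sum over the row index first, which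
is the Schur-type bound for operators on ℓ¹. -/
lemma summable_kernel {A : ι → ι → ℂ} {M : ℝ} (hA : ∀ j, Summable fun k => ‖A k j‖)
    (hA' : ∀ j, ∑' k, ‖A k j‖ ≤ M) {c : ι → ℂ} (hc : Summable fun j => ‖c j‖) :
    Summable fun p : ι × ι => ‖A p.1 p.2 * c p.2‖ := by
  have h : Summable fun p : ι × ι => ‖A p.2 p.1 * c p.1‖ := by
    rw [summable_prod_of_nonneg fun p => norm_nonneg _]
    simp only [norm_mul]
    refine ⟨fun j => (hA j).mul_right _, ?_⟩
    refine Summable.of_nonneg_of_le (fun j => tsum_nonneg fun k => by positivity) (fun j => ?_)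
      (hc.mul_left M)
    rw [tsum_mul_right]
    gcongr
    exact hA' j
  exact (Equiv.prodComm ι ι).summable_iff.1 h

lemma summable_norm_kernel_sum {A : ι → ι → ℂ} {M : ℝ} (hA : ∀ j, Summable fun k => ‖A k j‖)
    (hA' : ∀ j, ∑' k, ‖A k j‖ ≤ M) {c : ι → ℂ} (hc : Summable fun j => ‖c j‖) :
    Summable fun k => ‖∑' j, A k j * c j‖ := by
  have h := summable_kernel hA hA' hc
  exact Summable.of_nonneg_of_le (fun k => norm_nonneg _)
    (fun k => norm_tsum_le_tsum_norm (h.prod_factor k)) h.prod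

lemma tsum_norm_kernel_sum_le {A : ι → ι → ℂ} {M : ℝ} (hA : ∀ j, Summable fun k => ‖A k j‖)
    (hA' : ∀ j, ∑' k, ‖A k j‖ ≤ M) {c : ι → ℂ} (hc : Summable fun j => ‖c j‖) :
    ∑' k, ‖∑' j, A k j * c j‖ ≤ M * ∑' j, ‖c j‖ := by
  have h := summable_kernel hA hA' hc
  calc ∑' k, ‖∑' j, A k j * c j‖ ≤ ∑' k, ∑' j, ‖A k j * c j‖ :=
        (summable_norm_kernel_sum hA hA' hc).tsum_le_tsum
          (fun k => norm_tsum_le_tsum_norm (h.prod_factor k)) h.prod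
    _ = ∑' j, ∑' k, ‖A k j * c j‖ := (Summable.tsum_comm (f := fun k j => ‖A k j * c j‖) h).symm
    _ ≤ ∑' j, M * ‖c j‖ := by
        have h' : Summable fun j => ∑' k, ‖A k j * c j‖ :=
          Summable.prod (f := fun p : ι × ι => ‖A p.2 p.1 * c p.1‖) h.prod_symm
        refine h'.tsum_le_tsum (fun j => ?_) (hc.mul_left M)
        simp only [norm_mul]
        rw [tsum_mul_right]
        exact mul_le_mul_of_nonneg_right (hA' j) (norm_nonneg _)
    _ = M * ∑' j, ‖c j‖ := tsum_mul_left

/-- A linear equation `c = h + A c` in `ℓ¹` with a kernel of norm at most `1/2` has a solution. -/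
lemma exists_l1_fixedPoint {A : ι → ι → ℂ} (hA : ∀ j, Summable fun k => ‖A k j‖)
    (hA' : ∀ j, ∑' k, ‖A k j‖ ≤ 1 / 2) {h : ι → ℂ} (hh : Summable fun j => ‖h j‖) :
    ∃ c : ι → ℂ, (Summable fun j => ‖c j‖) ∧ ∀ k, c k = h k + ∑' j, A k j * c j := by
  have hlp : ∀ c : lp (fun _ : ι => ℂ) 1, Summable fun j => ‖c j‖ := fun c => by
    simpa using (memℓp_gen_iff (by simp)).1 (lp.memℓp c)
  have hmem : ∀ c : ι → ℂ, (Summable fun j => ‖c j‖) → Memℓp c 1 := fun c hc =>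
    memℓp_gen (by simpa using hc)
  let Φ : lp (fun _ : ι => ℂ) 1 → lp (fun _ : ι => ℂ) 1 := fun c =>
    ⟨fun k => h k + ∑' j, A k j * c j, hmem _
      (Summable.of_nonneg_of_le (fun k => norm_nonneg _) (fun k => norm_add_le _ _)
        (hh.add (summable_norm_kernel_sum hA hA' (hlp c))))⟩
  have hΦ : ContractingWith (1 / 2) Φ := by
    refine ⟨by rw [← NNReal.coe_lt_coe]; norm_num, LipschitzWith.of_dist_le_mul fun c d => ?_⟩
    rw [dist_eq_norm, dist_eq_norm, lp.norm_eq_tsum_rpow (by simp), lp.norm_eq_tsum_rpow (by simp)]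
    simp only [ENNReal.toReal_one, Real.rpow_one, div_one]
    have := tsum_norm_kernel_sum_le hA hA' (hlp (c - d))
    push_cast
    refine le_trans (le_of_eq (tsum_congr fun k => ?_)) this
    have hs : ∀ e : lp (fun _ : ι => ℂ) 1, Summable fun j => A k j * e j := fun e =>
      ((summable_kernel hA hA' (hlp e)).prod_factor k).of_norm
    simp only [lp.coeFn_sub, Pi.sub_apply, mul_sub]
    rw [(hs c).tsum_sub (hs d)]
    change ‖(h k + ∑' j, A k j * c j) - (h k + ∑' j, A k j * d j)‖ = _
    rw [add_sub_add_left_eq_sub]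
  obtain ⟨c, hc⟩ : ∃ c, Φ c = c := ⟨_, hΦ.fixedPoint_isFixedPt⟩
  refine ⟨fun k => c k, hlp c, fun k => ?_⟩
  conv_lhs => rw [← hc]

end FixedPoint

/-! ### Convolution equations in weighted ℓ¹ -/

section Convolution

variable {G : Type*} [AddCommGroup G]

lemma summable_shear {f g : G → ℝ} (hf : Summable f) (hg : Summable g) (hf0 : ∀ k, 0 ≤ f k)
    (hg0 : ∀ k, 0 ≤ g k) : Summable fun p : G × G => f (p.1 - p.2) * g p.2 := by
  let e : G × G ≃ G × G :=
    ⟨fun p => (p.1 - p.2, p.2), fun p => (p.1 + p.2, p.2), fun p => by simp, fun p => by simp⟩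
  exact e.summable_iff.2 (hf.mul_of_nonneg hg hf0 hg0)

lemma hasSum_shear {f g : G → ℂ} {x y : ℂ} (hf : HasSum f x) (hg : HasSum g y)
    (hf' : Summable fun k => ‖f k‖) (hg' : Summable fun k => ‖g k‖) :
    HasSum (fun k => ∑' j, f (k - j) * g j) (x * y) := by
  let e : G × G ≃ G × G :=
    ⟨fun p => (p.1 - p.2, p.2), fun p => (p.1 + p.2, p.2), fun p => by simp, fun p => by simp⟩
  have h1 : HasSum (fun p : G × G => f p.1 * g p.2) (x * y) :=
    hf.mul hg (summable_mul_of_summable_norm hf' hg')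
  have h2 : HasSum (fun p : G × G => f (p.1 - p.2) * g p.2) (x * y) := e.hasSum_iff.2 h1
  exact h2.prod_fiberwise fun k => (h2.summable.prod_factor k).hasSum

lemma tsum_shear {f g : G → ℝ} (hf : Summable f) (hg : Summable g) (hf0 : ∀ k, 0 ≤ f k)
    (hg0 : ∀ k, 0 ≤ g k) : ∑' k, ∑' j, f (k - j) * g j = (∑' k, f k) * ∑' j, g j := by
  let e : G × G ≃ G × G :=
    ⟨fun p => (p.1 - p.2, p.2), fun p => (p.1 + p.2, p.2), fun p => by simp, fun p => by simp⟩
  have h1 := hf.mul_of_nonneg hg hf0 hg0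
  have h2 : Summable fun p : G × G => f (p.1 - p.2) * g p.2 := e.summable_iff.2 h1
  rw [hf.tsum_mul_tsum hg h1, ← e.tsum_eq]
  exact h2.tsum_prod.symm

/-- Convolution is bounded on weighted `ℓ¹` spaces. -/
lemma weighted_convolution {Q c : G → ℂ} {v w : G → ℝ} (hv : ∀ k, 0 ≤ v k) (hw : ∀ k, 0 ≤ w k)
    (hvw : ∀ k j, w k ≤ v (k - j) * w j) (hQ : Summable fun k => v k * ‖Q k‖)
    (hc : Summable fun k => w k * ‖c k‖) :
    (Summable fun k => w k * ‖∑' j, Q (k - j) * c j‖) ∧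
    ∑' k, w k * ‖∑' j, Q (k - j) * c j‖ ≤ (∑' k, v k * ‖Q k‖) * ∑' k, w k * ‖c k‖ := by
  have hs := summable_shear hQ hc (fun k => mul_nonneg (hv k) (norm_nonneg _))
    (fun k => mul_nonneg (hw k) (norm_nonneg _))
  have hle : ∀ k, w k * ‖∑' j, Q (k - j) * c j‖ ≤
      ∑' j, v (k - j) * ‖Q (k - j)‖ * (w j * ‖c j‖) := by
    intro k
    rcases (hw k).eq_or_lt with h0 | h0
    · rw [← h0, zero_mul]
      exact tsum_nonneg fun j => by have := hv (k - j); have := hw j; positivity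
    have hk : ∀ j, w k * ‖Q (k - j) * c j‖ ≤ v (k - j) * ‖Q (k - j)‖ * (w j * ‖c j‖) := by
      intro j
      rw [norm_mul]
      calc w k * (‖Q (k - j)‖ * ‖c j‖) ≤ (v (k - j) * w j) * (‖Q (k - j)‖ * ‖c j‖) := by
            gcongr; exact hvw k j
        _ = _ := by ring
    have hsk : Summable fun j => w k * ‖Q (k - j) * c j‖ :=
      Summable.of_nonneg_of_le (fun j => by positivity) hk (hs.prod_factor k)
    have hsk' : Summable fun j => ‖Q (k - j) * c j‖ := by
      simpa [h0.ne'] using hsk.mul_left (w k)⁻¹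
    calc w k * ‖∑' j, Q (k - j) * c j‖ ≤ w k * ∑' j, ‖Q (k - j) * c j‖ := by
          gcongr; exact norm_tsum_le_tsum_norm hsk'
      _ = ∑' j, w k * ‖Q (k - j) * c j‖ := tsum_mul_left.symm
      _ ≤ _ := hsk.tsum_le_tsum hk (hs.prod_factor k)
  have hsum : Summable fun k => w k * ‖∑' j, Q (k - j) * c j‖ :=
    Summable.of_nonneg_of_le (fun k => mul_nonneg (hw k) (norm_nonneg _)) hle hs.prod
  refine ⟨hsum, (hsum.tsum_le_tsum hle hs.prod).trans_eq ?_⟩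
  exact tsum_shear hQ hc (fun k => mul_nonneg (hv k) (norm_nonneg _))
    (fun k => mul_nonneg (hw k) (norm_nonneg _))

/-- Solution of the Fourier side equation `c = m (g + Q * c)` with a smoothing multiplier `m`. -/
lemma exists_multiplier_solution {w v : G → ℝ} (hw : ∀ k, 1 ≤ w k) (hv : ∀ k, 1 ≤ v k)
    (hvw : ∀ k j, w k ≤ v (k - j) * w j) {m : G → ℂ} {μ D : ℝ} (hμ : ∀ k, ‖m k‖ ≤ μ)
    (hD : ∀ k, w k * ‖m k‖ ≤ D) {Q g : G → ℂ} (hQ : ∀ s : ℕ, Summable fun k => v k ^ s * ‖Q k‖)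
    (hg : ∀ s : ℕ, Summable fun k => w k ^ s * ‖g k‖)
    (hsmall : μ * ∑' k, v k ^ 2 * ‖Q k‖ ≤ 1 / 2) :
    ∃ c : G → ℂ, (∀ s : ℕ, Summable fun k => w k ^ s * ‖c k‖) ∧
      (∀ k, c k = m k * (g k + ∑' j, Q (k - j) * c j)) ∧
      ∑' k, w k ^ 2 * ‖c k‖ ≤ 2 * (μ * ∑' k, w k ^ 2 * ‖g k‖) := by
  have hμ0 : 0 ≤ μ := (norm_nonneg _).trans (hμ 0)
  have hQ0 : Summable fun k => ‖Q k‖ := by simpa using hQ 0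
  have hg0 : Summable fun k => ‖g k‖ := by simpa using hg 0
  have hQle : μ * ∑' k, ‖Q k‖ ≤ 1 / 2 := by
    refine le_trans ?_ hsmall
    refine mul_le_mul_of_nonneg_left (hQ0.tsum_le_tsum (fun k => ?_) (hQ 2)) hμ0
    exact le_mul_of_one_le_left (norm_nonneg _) (one_le_pow₀ (hv k))
  have hshift : ∀ j, Summable fun k => ‖Q (k - j)‖ := fun j =>
    (Equiv.subRight j).summable_iff.2 hQ0
  have hAs : ∀ j, Summable fun k => ‖m k * Q (k - j)‖ := fun j =>
    Summable.of_nonneg_of_le (fun k => norm_nonneg _)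
      (fun k => by rw [norm_mul]; gcongr; exact hμ k) ((hshift j).mul_left μ)
  obtain ⟨c, hc, hceq⟩ := exists_l1_fixedPoint (A := fun k j => m k * Q (k - j)) hAs
    (fun j => by
      refine le_trans ?_ hQle
      rw [← tsum_mul_left, ← (Equiv.subRight j).tsum_eq (fun k => μ * ‖Q k‖)]
      refine (hAs j).tsum_le_tsum (fun k => ?_) ((hshift j).mul_left μ)
      rw [norm_mul]; gcongr; exacts [hμ k, le_rfl])
    (h := fun k => m k * g k)
    (Summable.of_nonneg_of_le (fun k => norm_nonneg _)
      (fun k => by rw [norm_mul]; gcongr; exact hμ k) (hg0.mul_left μ))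
  have heq : ∀ k, c k = m k * (g k + ∑' j, Q (k - j) * c j) := fun k => by
    rw [mul_add, ← tsum_mul_left]
    simpa only [mul_assoc] using hceq k
  have hpow : ∀ s : ℕ, ∀ k j, w k ^ s ≤ v (k - j) ^ s * w j ^ s := fun s k j => by
    rw [← mul_pow]
    exact pow_le_pow_left₀ (zero_le_one.trans (hw k)) (hvw k j) s
  have hw0 : ∀ k, 0 ≤ w k := fun k => zero_le_one.trans (hw k)
  have hv0 : ∀ k, 0 ≤ v k := fun k => zero_le_one.trans (hv k)
  have hconv := fun (s : ℕ) (h : Summable fun k => w k ^ s * ‖c k‖) =>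
    weighted_convolution (fun k => pow_nonneg (hv0 k) s) (fun k => pow_nonneg (hw0 k) s)
      (hpow s) (hQ s) h
  have hbound : ∀ (s : ℕ) k, w k ^ s * ‖g k + ∑' j, Q (k - j) * c j‖ ≤
      w k ^ s * ‖g k‖ + w k ^ s * ‖∑' j, Q (k - j) * c j‖ := fun s k => by
    rw [← mul_add]
    exact mul_le_mul_of_nonneg_left (norm_add_le _ _) (pow_nonneg (hw0 k) s)
  -- Bootstrapping: convolution preserves each weighted space and the multiplier gains one weight
  -- through `D`, so the ℓ¹ solution decays faster than every power. The size of `D` plays no role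
  -- in the final estimate.
  have hall : ∀ s : ℕ, Summable fun k => w k ^ s * ‖c k‖ := by
    intro s
    induction s with
    | zero => simpa using hc
    | succ s ih =>
      refine Summable.of_nonneg_of_le (fun k => mul_nonneg (pow_nonneg (hw0 k) _) (norm_nonneg _))
        (fun k => ?_) (((hg s).add (hconv s ih).1).mul_left D)
      rw [heq k, norm_mul]
      calc w k ^ (s + 1) * (‖m k‖ * ‖g k + ∑' j, Q (k - j) * c j‖)
          = (w k * ‖m k‖) * (w k ^ s * ‖g k + ∑' j, Q (k - j) * c j‖) := by ring
        _ ≤ D * (w k ^ s * ‖g k + ∑' j, Q (k - j) * c j‖) := by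
          refine mul_le_mul_of_nonneg_right (hD k) ?_
          exact mul_nonneg (pow_nonneg (hw0 k) s) (norm_nonneg _)
        _ ≤ _ := by
          refine mul_le_mul_of_nonneg_left (hbound s k) ?_
          exact (mul_nonneg (hw0 k) (norm_nonneg _)).trans (hD k)
  refine ⟨c, hall, heq, ?_⟩
  have h2 := hconv 2 (hall 2)
  have h3 : ∑' k, w k ^ 2 * ‖c k‖ ≤ μ * (∑' k, w k ^ 2 * ‖g k‖ +
      (∑' k, v k ^ 2 * ‖Q k‖) * ∑' k, w k ^ 2 * ‖c k‖) := by
    calc ∑' k, w k ^ 2 * ‖c k‖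
        ≤ ∑' k, μ * (w k ^ 2 * ‖g k‖ + w k ^ 2 * ‖∑' j, Q (k - j) * c j‖) := by
          refine (hall 2).tsum_le_tsum (fun k => ?_) (((hg 2).add h2.1).mul_left μ)
          conv_lhs => rw [heq k, norm_mul, mul_left_comm]
          exact mul_le_mul (hμ k) (hbound 2 k)
            (mul_nonneg (pow_nonneg (hw0 k) 2) (norm_nonneg _)) hμ0
      _ = μ * (∑' k, w k ^ 2 * ‖g k‖ + ∑' k, w k ^ 2 * ‖∑' j, Q (k - j) * c j‖) := by
          rw [tsum_mul_left, (hg 2).tsum_add h2.1]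
      _ ≤ _ := by gcongr; exact h2.2
  have hc0 : 0 ≤ ∑' k, w k ^ 2 * ‖c k‖ := tsum_nonneg fun k =>
    mul_nonneg (pow_nonneg (hw0 k) 2) (norm_nonneg _)
  -- By `hsmall` the convolution term is at most half of the left side and is absorbed, which
  -- produces the factor 2.
  nlinarith [mul_le_mul_of_nonneg_right hsmall hc0]

end Convolution

end Conductivity

namespace Conductivity

open Complex MeasureTheory

variable {n : ℕ}

/-! ### Solving (Δ + 2ζ·∇ - q) r = g on a ball -/

section Solver

/-- The real part of a complex vector. -/
noncomputable def reVec (ζ : Fin n → ℂ) : Euc n := WithLp.toLp 2 fun i => (ζ i).re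

/-- The symbol of `Δ + 2 ζ · ∇` at the frequency `ℓ`. -/
noncomputable def symbol (ζ : Fin n → ℂ) (ℓ : Euc n) : ℂ :=
  ∑ i, (osc ℓ i * osc ℓ i + 2 * ζ i * osc ℓ i)

lemma symbol_eq (ζ : Fin n → ℂ) (ℓ : Euc n) :
    symbol ζ ℓ = -((‖ℓ‖ ^ 2 : ℝ) : ℂ) + 2 * I * ∑ i, ζ i * (ℓ i : ℂ) := by
  rw [EuclideanSpace.norm_sq_eq, symbol, Finset.sum_add_distrib, Finset.mul_sum]
  push_cast
  rw [← Finset.sum_neg_distrib]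
  congr 1 <;> refine Finset.sum_congr rfl fun i _ => ?_
  · simp only [osc, Real.norm_eq_abs, ← ofReal_pow, sq_abs]
    rw [mul_mul_mul_comm, I_mul_I]; push_cast; ring
  · simp only [osc]; ring

/-- The imaginary part of the symbol is linear in ℓ and sees only Re ζ. Hence frequencies kept away
from the hyperplane orthogonal to Re ζ give a symbol of size at least comparable to |Re ζ|. -/
lemma abs_inner_reVec_le_norm_symbol (ζ : Fin n → ℂ) (ℓ : Euc n) :
    2 * |inner ℝ (reVec ζ) ℓ| ≤ ‖symbol ζ ℓ‖ := by
  have h : (symbol ζ ℓ).im = 2 * inner ℝ (reVec ζ) ℓ := by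
    rw [symbol_eq]
    simp only [reVec, PiLp.inner_apply, RCLike.inner_apply, conj_trivial, add_im, neg_im,
      ofReal_im, mul_im, mul_re, re_ofNat, im_ofNat, I_re, I_im, re_sum, im_sum, ofReal_re]
    simp [mul_comm]
  calc 2 * |inner ℝ (reVec ζ) ℓ| = |(symbol ζ ℓ).im| := by rw [h, abs_mul]; simp
    _ ≤ _ := abs_im_le_norm _

lemma norm_sq_le_norm_symbol (ζ : Fin n → ℂ) (ℓ : Euc n) :
    ‖ℓ‖ ^ 2 ≤ ‖symbol ζ ℓ‖ + 2 * (∑ i, ‖ζ i‖) * ‖ℓ‖ := by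
  have h : ((‖ℓ‖ ^ 2 : ℝ) : ℂ) = -symbol ζ ℓ + 2 * I * ∑ i, ζ i * (ℓ i : ℂ) := by
    rw [symbol_eq]; ring
  have h1 : ‖∑ i, ζ i * (ℓ i : ℂ)‖ ≤ (∑ i, ‖ζ i‖) * ‖ℓ‖ := by
    rw [Finset.sum_mul]
    refine (norm_sum_le _ _).trans (Finset.sum_le_sum fun i _ => ?_)
    rw [norm_mul, norm_real]
    gcongr
    exact abs_coord_le ℓ i
  calc ‖ℓ‖ ^ 2 = ‖((‖ℓ‖ ^ 2 : ℝ) : ℂ)‖ := by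
        rw [norm_real, Real.norm_of_nonneg (by positivity)]
    _ ≤ ‖symbol ζ ℓ‖ + 2 * ‖∑ i, ζ i * (ℓ i : ℂ)‖ := by
        rw [h]; refine (norm_add_le _ _).trans ?_; simp
    _ ≤ _ := by rw [mul_assoc]; gcongr

/-- The symbol dominates the frequency if it is bounded below. -/
lemma exists_one_add_norm_le_symbol (ζ : Fin n → ℂ) {δ : ℝ} (hδ : 0 < δ) :
    ∃ D, ∀ ℓ : Euc n, δ ≤ ‖symbol ζ ℓ‖ → 1 + ‖ℓ‖ ≤ D * ‖symbol ζ ℓ‖ := by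
  set Z := ∑ i, ‖ζ i‖
  have hZ : 0 ≤ Z := Finset.sum_nonneg fun i _ => norm_nonneg _
  refine ⟨(2 + 4 * Z) / δ + 2, fun ℓ hℓ => ?_⟩
  have h := norm_sq_le_norm_symbol ζ ℓ
  set p := ‖symbol ζ ℓ‖
  have hp : 1 ≤ p / δ := by rwa [one_le_div hδ]
  have hD : ((2 + 4 * Z) / δ + 2) * p = (2 + 4 * Z) * (p / δ) + 2 * p := by ring
  rw [hD]
  have hp0 : 0 ≤ p := norm_nonneg _
  have h2 : (2 + 4 * Z) * 1 ≤ (2 + 4 * Z) * (p / δ) := by gcongr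
  -- For bounded frequencies the lower bound δ suffices; beyond 4Z the linear term is at most half
  -- of ‖ℓ‖², which is then controlled by the symbol.
  by_cases hc : ‖ℓ‖ ≤ 4 * Z
  · linarith
  · push Not at hc
    nlinarith [norm_nonneg ℓ, sq_nonneg (‖ℓ‖ - 1)]

/-- The reflection that exchanges two unit vectors suffices; orientation is irrelevant. -/
lemma exists_rotation (i₀ : Fin n) {v : Euc n} (hv : v ≠ 0) :
    ∃ O : Euc n ≃ₗᵢ[ℝ] Euc n, v = ‖v‖ • O (EuclideanSpace.single i₀ 1) := by
  have hn : ‖EuclideanSpace.single i₀ (1 : ℝ)‖ = ‖(‖v‖⁻¹ • v)‖ := by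
    rw [norm_smul]; simp [hv]
  refine ⟨Submodule.reflection (Submodule.span ℝ
    {EuclideanSpace.single i₀ (1 : ℝ) - (‖v‖⁻¹ • v)})ᗮ, ?_⟩
  rw [Submodule.reflection_sub hn, smul_smul, mul_inv_cancel₀ (by simpa using hv), one_smul]

/-- Sums of samples of a rapidly decaying function over a shifted lattice are bounded uniformly in
the rotation of the lattice. -/
lemma exists_sample_bound {φ : Euc n → ℂ} (hφ : ∀ s : ℕ, ∃ C, ∀ ξ, (1 + ‖ξ‖) ^ s * ‖φ ξ‖ ≤ C)
    (a : Euc n) (s : ℕ) : ∃ B, 0 ≤ B ∧ ∀ O : Euc n ≃ₗᵢ[ℝ] Euc n,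
      (Summable fun k => (1 + ‖latticeVec k + a‖) ^ s * ‖φ (O (latticeVec k) + O a)‖) ∧
      ∑' k, (1 + ‖latticeVec k + a‖) ^ s * ‖φ (O (latticeVec k) + O a)‖ ≤ B := by
  obtain ⟨C, hC⟩ := hφ (s + 2 * n)
  have hsum := (summable_inv_one_add_norm_latticeVec a).mul_left C
  have hle : ∀ (O : Euc n ≃ₗᵢ[ℝ] Euc n) k,
      (1 + ‖latticeVec k + a‖) ^ s * ‖φ (O (latticeVec k) + O a)‖ ≤
        C * ((1 + ‖latticeVec k + a‖) ^ (2 * n))⁻¹ := by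
    intro O k
    have := hC (O (latticeVec k) + O a)
    rw [← map_add, LinearIsometryEquiv.norm_map] at this
    rw [← div_eq_mul_inv, le_div_iff₀ (by positivity), ← map_add]
    rw [pow_add] at this
    linarith
  have hs : ∀ O : Euc n ≃ₗᵢ[ℝ] Euc n,
      Summable fun k => (1 + ‖latticeVec k + a‖) ^ s * ‖φ (O (latticeVec k) + O a)‖ := fun O =>
    Summable.of_nonneg_of_le (fun k => by positivity) (hle O) hsum
  exact ⟨_, (tsum_nonneg fun k => by positivity).trans
    ((hs (LinearIsometryEquiv.refl ℝ _)).tsum_le_tsum (hle _) hsum),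
    fun O => ⟨hs O, (hs O).tsum_le_tsum (hle O) hsum⟩⟩

/-- A half-integer is never closer to 0 than 1/2. This shift keeps the frequencies off the
characteristic hyperplane of the symbol. -/
lemma abs_inner_half_lattice (i₀ : Fin n) (k : Fin n → ℤ) :
    1 / 2 ≤ |inner ℝ (EuclideanSpace.single i₀ (1 : ℝ))
      (latticeVec k + EuclideanSpace.single i₀ (1 / 2 : ℝ))| := by
  rw [EuclideanSpace.inner_single_left]
  simp only [PiLp.add_apply, latticeVec_apply, PiLp.single_apply, if_true, map_one, one_mul]
  rcases le_or_gt 0 (k i₀) with h | h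
  · have : (0 : ℝ) ≤ k i₀ := by exact_mod_cast h
    rw [abs_of_nonneg (by linarith)]; linarith
  · have : (k i₀ : ℝ) ≤ -1 := by exact_mod_cast Int.le_sub_one_of_lt h
    rw [abs_of_neg (by linarith)]; linarith

/-- Solvability of `(Δ + 2 ζ · ∇ - q) r = g` on a ball with smooth `r` and estimates that decay as the
real part of `ζ` grows. -/
theorem exists_conjugated_solution (i₀ : Fin n) {q : Euc n → ℂ} (hq : ContDiff ℝ ∞ q)
    {R : ℝ} (hR : 0 < R) :
    ∃ N₀ : ℝ, 0 < N₀ ∧ ∀ g : Euc n → ℂ, ContDiff ℝ ∞ g → ∃ C, 0 ≤ C ∧ ∀ ζ : Fin n → ℂ, N₀ ≤ ‖reVec ζ‖ →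
      ∃ r : Euc n → ℂ, ContDiff ℝ ∞ r ∧
        (∀ x, ‖x‖ < R → ∑ i, (partialDeriv i (partialDeriv i r) x + 2 * ζ i * partialDeriv i r x)
          - q x * r x = g x) ∧
        (∀ x, ‖r x‖ ≤ C / ‖reVec ζ‖) ∧ (∀ i x, ‖partialDeriv i r x‖ ≤ C / ‖reVec ζ‖) ∧
        (∀ i j x, ‖partialDeriv i (partialDeriv j r) x‖ ≤ C / ‖reVec ζ‖) := by
  obtain ⟨qhat, hqd, hqs⟩ := exists_fourier_expansion hq hR
  set κ := Real.pi / (4 * R) with hκ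
  have hκ0 : 0 < κ := by positivity
  set a : Euc n := EuclideanSpace.single i₀ (1 / 2 : ℝ) with ha
  -- The potential is expanded on the unshifted lattice: convolution with it then maps the shifted
  -- lattice to itself.
  obtain ⟨Bq, hBq0, hBq⟩ := exists_sample_bound hqd 0 2
  -- Beyond this threshold the multiplier bound 1/(κN) times the weighted norm of the potential is
  -- at most 1/2. It depends on `q` but not on `g`, so `g` may later be chosen in terms of ζ.
  refine ⟨2 * (κ⁻¹ * Bq) + 1, by positivity, fun g hg => ?_⟩
  obtain ⟨ghat, hgd, hgs⟩ := exists_fourier_expansion hg hR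
  obtain ⟨Bg, hBg0, hBg⟩ := exists_sample_bound hgd a 2
  -- The factor (1 + κ)² pays for up to two derivatives, each costing at most (1 + κ)w; the rest is
  -- the weighted norm bound for the coefficients, up to the factor 1/N.
  refine ⟨(1 + κ) ^ 2 * (2 * (κ⁻¹ * Bg)), by positivity, fun ζ hζ => ?_⟩
  set N := ‖reVec ζ‖ with hN
  have hN0 : 0 < N := lt_of_lt_of_le (by positivity) hζ
  obtain ⟨O, hO⟩ := exists_rotation i₀ (v := reVec ζ) (norm_pos_iff.1 hN0)
  let ℓ : (Fin n → ℤ) → Euc n := fun k => κ • (O (latticeVec k) + O a)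
  have hℓn : ∀ k, ‖ℓ k‖ = κ * ‖latticeVec k + a‖ := fun k => by
    simp only [ℓ]
    rw [norm_smul, ← map_add, LinearIsometryEquiv.norm_map, Real.norm_of_nonneg hκ0.le]
  let w : (Fin n → ℤ) → ℝ := fun k => 1 + ‖latticeVec k + a‖
  have hw1 : ∀ k, 1 ≤ w k := fun k => by simp [w]
  have hℓw : ∀ k, 1 + ‖ℓ k‖ ≤ (1 + κ) * w k := fun k => by
    rw [hℓn]; simp only [w]; nlinarith [norm_nonneg (latticeVec k + a)]
  have hwℓ : ∀ k, w k ≤ (1 + κ⁻¹) * (1 + ‖ℓ k‖) := fun k => by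
    rw [hℓn]
    have : κ⁻¹ * (κ * ‖latticeVec k + a‖) = ‖latticeVec k + a‖ := by field_simp
    simp only [w]
    nlinarith [norm_nonneg (latticeVec k + a), inv_pos.2 hκ0,
      mul_nonneg hκ0.le (norm_nonneg (latticeVec k + a))]
  have hsym : ∀ k, κ * N ≤ ‖symbol ζ (ℓ k)‖ := fun k => by
    refine le_trans ?_ (abs_inner_reVec_le_norm_symbol ζ (ℓ k))
    rw [hO]
    simp only [ℓ]
    rw [← map_add, real_inner_smul_left, real_inner_smul_right, O.inner_map_map, abs_mul, abs_mul,
      abs_of_pos hκ0, abs_of_nonneg (norm_nonneg _)]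
    have := abs_inner_half_lattice i₀ k
    have h2 : N * κ * (1 / 2) ≤ N * κ * |inner ℝ (EuclideanSpace.single i₀ (1 : ℝ))
      (latticeVec k + a)| := by gcongr
    linarith
  have hsym0 : ∀ k, symbol ζ (ℓ k) ≠ 0 := fun k =>
    norm_pos_iff.1 (lt_of_lt_of_le (by positivity) (hsym k))
  -- This constant depends on ζ, but serves only to make the coefficients decay rapidly and does not
  -- enter the bounds.
  obtain ⟨D, hD⟩ := exists_one_add_norm_le_symbol ζ (δ := κ * N) (by positivity)
  obtain ⟨c, hc, hceq, hcb⟩ := exists_multiplier_solution (w := w)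
    (v := fun k => 1 + ‖latticeVec k‖) hw1 (fun k => by simp)
    (fun k j => by
      have : latticeVec k + a = latticeVec (k - j) + (latticeVec j + a) := by
        rw [← add_assoc, ← latticeVec_add, sub_add_cancel]
      have h := norm_add_le (latticeVec (k - j)) (latticeVec j + a)
      simp only [w]
      rw [this]
      nlinarith [mul_nonneg (norm_nonneg (latticeVec (k - j))) (norm_nonneg (latticeVec j + a))])
    (m := fun k => (symbol ζ (ℓ k))⁻¹) (μ := (κ * N)⁻¹) (D := (1 + κ⁻¹) * D)
    (fun k => by
      rw [norm_inv]
      exact inv_anti₀ (by positivity) (hsym k))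
    (fun k => by
      rw [norm_inv, ← div_eq_mul_inv, div_le_iff₀ (norm_pos_iff.2 (hsym0 k)), mul_assoc]
      refine (hwℓ k).trans ?_
      gcongr
      exact hD _ (hsym k))
    (Q := fun k => qhat (O (latticeVec k))) (g := fun k => ghat (O (latticeVec k) + O a))
    (fun s => by
      obtain ⟨B, _, hB⟩ := exists_sample_bound hqd 0 s
      simpa using (hB O).1)
    (fun s => by
      obtain ⟨B, _, hB⟩ := exists_sample_bound hgd a s
      exact (hB O).1)
    (by
      have h1 := (hBq O).2
      simp only [add_zero, map_zero] at h1
      rw [inv_mul_le_iff₀ (by positivity)]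
      refine h1.trans ?_
      have : 2 * (κ⁻¹ * Bq) ≤ N := by linarith
      calc Bq = κ * (2 * (κ⁻¹ * Bq)) * (1 / 2) := by field_simp
        _ ≤ _ := by gcongr)
  have hdec : RapidDecay ℓ c := fun s => by
    refine Summable.of_nonneg_of_le (fun k => by positivity) (fun k => ?_)
      ((hc s).mul_left ((1 + κ) ^ s))
    rw [← mul_assoc, ← mul_pow]
    gcongr
    exact hℓw k
  have hcsum : ∑' k, w k ^ 2 * ‖c k‖ ≤ 2 * (κ⁻¹ * Bg) / N := by
    refine hcb.trans ?_
    have := (hBg O).2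
    calc 2 * ((κ * N)⁻¹ * ∑' k, w k ^ 2 * ‖ghat (O (latticeVec k) + O a)‖)
        ≤ 2 * ((κ * N)⁻¹ * Bg) := by gcongr
      _ = _ := by rw [mul_inv]; ring
  have hbd : ∀ d : (Fin n → ℤ) → ℂ, (∀ k, ‖d k‖ ≤ (1 + κ) ^ 2 * (w k ^ 2 * ‖c k‖)) → ∀ x,
      ‖trigSeries ℓ d x‖ ≤ (1 + κ) ^ 2 * (2 * (κ⁻¹ * Bg)) / N := by
    intro d hd x
    have hds : Summable fun k => ‖d k‖ :=
      Summable.of_nonneg_of_le (fun k => norm_nonneg _) hd ((hc 2).mul_left _)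
    calc _ ≤ _ := norm_trigSeries_le hds x
      _ ≤ ∑' k, (1 + κ) ^ 2 * (w k ^ 2 * ‖c k‖) := hds.tsum_le_tsum hd ((hc 2).mul_left _)
      _ = (1 + κ) ^ 2 * ∑' k, w k ^ 2 * ‖c k‖ := tsum_mul_left
      _ ≤ (1 + κ) ^ 2 * (2 * (κ⁻¹ * Bg) / N) := by gcongr
      _ = _ := by ring
  have hosc : ∀ k i, ‖osc (ℓ k) i‖ ≤ (1 + κ) * w k := fun k i =>
    (norm_osc_le _ _).trans (hℓw k)
  have hone : ∀ k, 1 ≤ (1 + κ) * w k := fun k => by nlinarith [hw1 k]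
  refine ⟨trigSeries ℓ c, contDiff_trigSeries hdec, fun x hx => ?_, hbd c fun k => ?_,
    fun i => ?_, fun i j => ?_⟩
  · have hwave : ∀ k j, wave (osc (ℓ k)) x =
        wave (osc (κ • (O (latticeVec (k - j)) + 0))) x * wave (osc (ℓ j)) x := fun k j => by
      rw [← wave_add, ← osc_add, add_zero, ← smul_add, ← add_assoc, ← map_add, ← latticeVec_add,
        sub_add_cancel]
    have hcs := summable_trigSeries (ℓ := ℓ) hdec.summable_norm x
    have hqsum : Summable fun k => ‖qhat (O (latticeVec k))‖ := by
      obtain ⟨B, _, hB⟩ := exists_sample_bound hqd 0 0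
      simpa using (hB O).1
    -- The product of the two series is the series of convolved coefficients, valid on the ball
    -- where the expansion of `q` holds.
    have hprod := hasSum_shear (hqs O 0 x hx) hcs.hasSum
      (by simpa [norm_wave_osc] using hqsum) (by simpa [norm_wave_osc] using hdec.summable_norm)
    have hprod' : HasSum (fun k => (∑' j, qhat (O (latticeVec (k - j))) * c j) *
        wave (osc (ℓ k)) x) (q x * trigSeries ℓ c x) := by
      refine (congrArg (fun f => HasSum f (q x * trigSeries ℓ c x)) (funext fun k => ?_)).mp hprod
      rw [← tsum_mul_right]
      refine tsum_congr fun j => ?_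
      rw [hwave k j, add_zero]
      ring
    have hsum2 : HasSum (fun k => symbol ζ (ℓ k) * c k * wave (osc (ℓ k)) x)
        (g x + q x * trigSeries ℓ c x) := by
      have hgx := (hgs O (O a) x hx).add hprod'
      refine (congrArg (fun f => HasSum f (g x + q x * trigSeries ℓ c x))
        (funext fun k => ?_)).mp hgx
      rw [← add_mul]
      congr 1
      conv_rhs => rw [hceq k]
      rw [mul_inv_cancel_left₀ (hsym0 k)]
    have hlhs : ∑ i, (partialDeriv i (partialDeriv i (trigSeries ℓ c)) x
        + 2 * ζ i * partialDeriv i (trigSeries ℓ c) x)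
        = ∑' k, symbol ζ (ℓ k) * c k * wave (osc (ℓ k)) x := by
      have h1 : ∀ i, HasSum (fun k => (osc (ℓ k) i * osc (ℓ k) i + 2 * ζ i * osc (ℓ k) i) * c k *
          wave (osc (ℓ k)) x) (partialDeriv i (partialDeriv i (trigSeries ℓ c)) x
            + 2 * ζ i * partialDeriv i (trigSeries ℓ c) x) := fun i => by
        rw [partialDeriv_trigSeries hdec, partialDeriv_trigSeries (hdec.mul_osc i)]
        have hA := (summable_trigSeries (ℓ := ℓ) ((hdec.mul_osc i).mul_osc i).summable_norm x).hasSum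
        have hB := (summable_trigSeries (ℓ := ℓ) (hdec.mul_osc i).summable_norm x).hasSum
        refine (congrArg (fun f => HasSum f _) (funext fun k => ?_)).mp
          (hA.add (hB.mul_left (2 * ζ i)))
        ring
      rw [← (hasSum_sum fun i _ => h1 i).tsum_eq]
      refine tsum_congr fun k => ?_
      rw [symbol, Finset.sum_mul, Finset.sum_mul]
    rw [hlhs, hsum2.tsum_eq]
    ring
  · rw [← mul_assoc, ← mul_pow]
    exact le_mul_of_one_le_left (norm_nonneg _) (one_le_pow₀ (hone k))
  · rw [partialDeriv_trigSeries hdec]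
    refine hbd _ fun k => ?_
    rw [← mul_assoc, ← mul_pow, norm_mul]
    gcongr
    exact (hosc k i).trans (le_self_pow₀ (hone k) two_ne_zero)
  · rw [partialDeriv_trigSeries hdec, partialDeriv_trigSeries (hdec.mul_osc j)]
    refine hbd _ fun k => ?_
    rw [norm_mul, norm_mul,
      show (1 + κ) ^ 2 * (w k ^ 2 * ‖c k‖) = (1 + κ) * w k * ((1 + κ) * w k * ‖c k‖) by ring]
    gcongr
    exacts [hosc k i, hosc k j]

end Solver

end Conductivity

namespace Conductivity

open Complex MeasureTheory Filter Topology
open scoped FourierTransform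

variable {n : ℕ}

/-! ### Testing integrals against plane waves -/

section Integrals

variable {Ω : Set (Euc n)}

lemma integrableOn_of_continuousOn_closure (hb : Bornology.IsBounded Ω) {F : Euc n → ℂ}
    (hF : ContinuousOn F (closure Ω)) : IntegrableOn F Ω :=
  (hF.integrableOn_compact (hb.isCompact_closure)).mono_set subset_closure

lemma exists_bound_on_closure (hb : Bornology.IsBounded Ω) {F : Euc n → ℂ}
    (hF : ContinuousOn F (closure Ω)) : ∃ B, 0 ≤ B ∧ ∀ x ∈ closure Ω, ‖F x‖ ≤ B := by
  obtain ⟨B, hB⟩ := hb.isCompact_closure.exists_bound_of_continuousOn hF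
  exact ⟨max B 0, le_max_right _ _, fun x hx => (hB x hx).trans (le_max_left _ _)⟩

/-- Bounded convergence on a bounded open set. -/
lemma tendsto_setIntegral_of_bounded (ho : IsOpen Ω) (hb : Bornology.IsBounded Ω)
    {F : ℕ → Euc n → ℂ} {f : Euc n → ℂ} (hF : ∀ N, ContinuousOn (F N) Ω) {B : ℝ}
    (hB : ∀ᶠ N in atTop, ∀ x ∈ Ω, ‖F N x‖ ≤ B)
    (hlim : ∀ x ∈ Ω, Tendsto (fun N => F N x) atTop (𝓝 (f x))) :
    Tendsto (fun N => ∫ x in Ω, F N x) atTop (𝓝 (∫ x in Ω, f x)) := by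
  have hfin : volume Ω < ⊤ := hb.measure_lt_top
  have : IsFiniteMeasure (volume.restrict Ω) := ⟨by simpa using hfin⟩
  refine tendsto_integral_filter_of_dominated_convergence (fun _ => B)
    (Eventually.of_forall fun N => (hF N).aestronglyMeasurable ho.measurableSet) ?_
    (integrable_const B) ?_
  · filter_upwards [hB] with N hN
    exact (ae_restrict_iff' ho.measurableSet).2 (Eventually.of_forall hN)
  · exact (ae_restrict_iff' ho.measurableSet).2 (Eventually.of_forall hlim)

lemma tendsto_add_single (ξ : Euc n) (i₀ : Fin n) :
    Tendsto (fun k : ℕ => ξ + EuclideanSpace.single i₀ (1 / ((k : ℝ) + 1))) atTop (𝓝 ξ) := by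
  have h : Tendsto (fun t : ℝ => ξ + t • EuclideanSpace.single i₀ (1 : ℝ)) (𝓝 0) (𝓝 ξ) := by
    have : Continuous fun t : ℝ => ξ + t • EuclideanSpace.single i₀ (1 : ℝ) := by fun_prop
    simpa using this.tendsto 0
  refine (h.comp tendsto_one_div_add_atTop_nhds_zero_nat).congr fun k => ?_
  ext j
  simp [PiLp.single_apply]

/-- Injectivity of the Fourier transform, with frequencies off a hyperplane. -/
lemma eq_zero_of_integral_wave_eq_zero (ho : IsOpen Ω) (hb : Bornology.IsBounded Ω)
    {F : Euc n → ℂ} (hF : ContinuousOn F (closure Ω)) (i₀ : Fin n)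
    (h : ∀ θ : Euc n, θ i₀ ≠ 0 → ∫ x in Ω, wave (osc θ) x * F x = 0) : ∀ x ∈ Ω, F x = 0 := by
  set f := Ω.indicator F
  have hf : Integrable f := (integrableOn_of_continuousOn_closure hb hF).integrable_indicator
    ho.measurableSet
  have hint : ∀ ξ, 𝓕 f ξ = ∫ x in Ω, wave (osc (-(2 * Real.pi) • ξ)) x * F x := fun ξ => by
    rw [fourier_eq_wave, ← integral_indicator ho.measurableSet]
    congr 1
    ext x
    by_cases hx : x ∈ Ω <;> simp [f, hx]
  have h0 : ∀ ξ : Euc n, ξ i₀ ≠ 0 → 𝓕 f ξ = 0 := fun ξ hξ => by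
    rw [hint, h]
    simpa [Real.pi_ne_zero] using hξ
  have hcont : Continuous (𝓕 f) := VectorFourier.fourierIntegral_continuous
    Real.continuous_fourierChar (innerSL ℝ).continuous₂ hf
  have h1 : 𝓕 f = 0 := by
    ext ξ
    -- The transform of an integrable function is continuous, so its values on the excluded
    -- hyperplane are limits of the zeros found off it.
    by_cases hξ : ξ i₀ = 0
    · have ht := (hcont.tendsto ξ).comp (tendsto_add_single ξ i₀)
      refine tendsto_nhds_unique (ht.congr fun k => ?_) tendsto_const_nhds
      refine h0 _ ?_
      simp only [PiLp.add_apply, hξ, PiLp.single_apply, if_true]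
      positivity
    · exact h0 ξ hξ
  intro x hx
  have hc : ContinuousAt f x := by
    have : F =ᶠ[𝓝 x] f := by
      filter_upwards [ho.mem_nhds hx] with y hy
      simp [f, hy]
    exact ((hF.mono subset_closure).continuousAt (ho.mem_nhds hx)).congr this
  have := hf.fourierInv_fourier_eq (by rw [h1]; exact integrable_zero _ _ _) hc
  rw [h1, Real.fourierInv_eq] at this
  simpa [f, hx] using this.symm

/-- The Laplacian. -/
noncomputable def lap (u : Euc n → ℂ) (x : Euc n) : ℂ := ∑ i, partialDeriv i (partialDeriv i u) x

lemma contDiff_lap {u : Euc n → ℂ} (hu : ContDiff ℝ ∞ u) : ContDiff ℝ ∞ (lap u) :=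
  ContDiff.sum fun i _ => contDiff_partialDeriv (contDiff_partialDeriv hu i) i

/-- A second order differential expression that integrates to zero against all plane waves does so
against all smooth functions. -/
lemma integral_eq_zero_of_wave (ho : IsOpen Ω) (hb : Bornology.IsBounded Ω) (i₀ : Fin n)
    {c₀ d : Euc n → ℂ} {c : Fin n → Euc n → ℂ} (hc₀ : ContinuousOn c₀ (closure Ω))
    (hd : ContinuousOn d (closure Ω)) (hc : ∀ i, ContinuousOn (c i) (closure Ω))
    (h : ∀ θ : Euc n, θ i₀ ≠ 0 → ∫ x in Ω, (c₀ x * wave (osc θ) x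
      + ∑ i, c i x * partialDeriv i (wave (osc θ)) x + d x * lap (wave (osc θ)) x) = 0)
    {φ : Euc n → ℂ} (hφ : ContDiff ℝ ∞ φ) :
    ∫ x in Ω, (c₀ x * φ x + ∑ i, c i x * partialDeriv i φ x + d x * lap φ x) = 0 := by
  obtain ⟨R₀, hR₀⟩ := hb.subset_ball (0 : Euc n)
  set R := max R₀ 1
  have hR : 0 < R := lt_max_of_lt_right one_pos
  have hΩR : Ω ⊆ Metric.ball 0 R := hR₀.trans (Metric.ball_subset_ball (le_max_left _ _))
  obtain ⟨φhat, hdec, hsum⟩ := exists_fourier_expansion hφ hR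
  set κ := Real.pi / (4 * R)
  have hκ0 : 0 < κ := by positivity
  -- The half shift makes the i₀-th coordinate of every frequency nonzero, so only permitted plane
  -- waves occur in the expansion.
  set a : Euc n := EuclideanSpace.single i₀ (1 / 2 : ℝ)
  let ℓ : (Fin n → ℤ) → Euc n := fun k => κ • (latticeVec k + a)
  let C : (Fin n → ℤ) → ℂ := fun k => φhat (latticeVec k + a)
  have hrd : RapidDecay ℓ C := fun s => by
    obtain ⟨B, _, hB⟩ := exists_sample_bound hdec a s
    refine Summable.of_nonneg_of_le (fun k => by positivity) (fun k => ?_)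
      ((hB (LinearIsometryEquiv.refl ℝ _)).1.mul_left ((1 + κ) ^ s))
    rw [← mul_assoc, ← mul_pow]
    simp only [LinearIsometryEquiv.coe_refl, id, C, ℓ]
    gcongr
    rw [norm_smul, Real.norm_of_nonneg hκ0.le]
    nlinarith [norm_nonneg (latticeVec k + a)]
  have hℓ0 : ∀ k, ℓ k i₀ ≠ 0 := fun k => by
    have := abs_inner_half_lattice i₀ k
    rw [EuclideanSpace.inner_single_left] at this
    simp only [ℓ, PiLp.smul_apply, smul_eq_mul]
    refine mul_ne_zero hκ0.ne' fun h0 => ?_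
    rw [show (latticeVec k + EuclideanSpace.single i₀ (1 / 2 : ℝ)) i₀ = 0 from h0] at this
    norm_num at this
  have hφs : ∀ x ∈ Metric.ball (0 : Euc n) R, φ x = trigSeries ℓ C x := fun x hx => by
    have := hsum (LinearIsometryEquiv.refl ℝ _) a x (by simpa using hx)
    exact this.tsum_eq.symm
  have hev : ∀ x ∈ Ω, φ =ᶠ[𝓝 x] trigSeries ℓ C := fun x hx => by
    filter_upwards [Metric.isOpen_ball.mem_nhds (hΩR hx)] with y hy using hφs y hy
  have hp1 : ∀ i, ∀ x ∈ Ω, partialDeriv i φ x = trigSeries ℓ (fun k => osc (ℓ k) i * C k) x :=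
    fun i x hx => by rw [partialDeriv_congr (hev x hx), partialDeriv_trigSeries hrd]
  have hp2 : ∀ i, ∀ x ∈ Ω, partialDeriv i (partialDeriv i φ) x =
      trigSeries ℓ (fun k => osc (ℓ k) i * (osc (ℓ k) i * C k)) x := fun i x hx => by
    rw [← partialDeriv_trigSeries (hrd.mul_osc i)]
    refine partialDeriv_congr ?_ i
    filter_upwards [ho.mem_nhds hx] with y hy using hp1 i y hy
  let M : (Fin n → ℤ) → Euc n → ℂ := fun k x => C k * (c₀ x * wave (osc (ℓ k)) x
      + ∑ i, c i x * partialDeriv i (wave (osc (ℓ k))) x + d x * lap (wave (osc (ℓ k))) x)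
  have hM : ∀ k x, M k x = (c₀ x + ∑ i, c i x * osc (ℓ k) i + d x * ∑ i, osc (ℓ k) i ^ 2)
      * (C k * wave (osc (ℓ k)) x) := fun k x => by
    have hl : lap (wave (osc (ℓ k))) x = (∑ i, osc (ℓ k) i ^ 2) * wave (osc (ℓ k)) x := by
      rw [lap, Finset.sum_mul]
      refine Finset.sum_congr rfl fun i _ => ?_
      rw [partialDeriv_wave, partialDeriv_const_mul
        ((contDiff_wave _).differentiable (by simp) x), partialDeriv_wave]
      ring
    simp only [M, hl, partialDeriv_wave]
    rw [show ∑ i, c i x * (osc (ℓ k) i * wave (osc (ℓ k)) x)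
      = (∑ i, c i x * osc (ℓ k) i) * wave (osc (ℓ k)) x by
        rw [Finset.sum_mul]; exact Finset.sum_congr rfl fun i _ => by ring]
    ring
  have hMs : ∀ x ∈ Ω, HasSum (fun k => M k x)
      (c₀ x * φ x + ∑ i, c i x * partialDeriv i φ x + d x * lap φ x) := fun x hx => by
    have e0 := (summable_trigSeries (ℓ := ℓ) hrd.summable_norm x).hasSum
    have e1 := fun i => (summable_trigSeries (ℓ := ℓ) (hrd.mul_osc i).summable_norm x).hasSum
    have e2 := fun i =>
      (summable_trigSeries (ℓ := ℓ) ((hrd.mul_osc i).mul_osc i).summable_norm x).hasSum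
    have := ((e0.mul_left (c₀ x)).add (hasSum_sum fun i (_ : i ∈ Finset.univ) =>
      (e1 i).mul_left (c i x))).add ((hasSum_sum fun i (_ : i ∈ Finset.univ) => e2 i).mul_left (d x))
    rw [hφs x (hΩR hx), lap]
    simp only [hp1 _ x hx, hp2 _ x hx]
    refine (congrArg (fun f => HasSum f _) (funext fun k => ?_)).mp this
    rw [hM, add_mul, add_mul, Finset.sum_mul, mul_assoc (d x), Finset.sum_mul]
    congr 1
    · congr 1
      exact Finset.sum_congr rfl fun i _ => by ring
    · congr 1
      exact Finset.sum_congr rfl fun i _ => by ring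
  obtain ⟨B₀, hB₀0, hB₀⟩ := exists_bound_on_closure hb hc₀
  obtain ⟨Bd, hBd0, hBd⟩ := exists_bound_on_closure hb hd
  choose Bc hBc0 hBc using fun i => exists_bound_on_closure hb (hc i)
  have hMcont : ∀ k, ContinuousOn (M k) (closure Ω) := fun k => by
    have hw : ContDiff ℝ ∞ (wave (osc (ℓ k))) := contDiff_wave _
    refine continuousOn_const.mul (((hc₀.mul hw.continuous.continuousOn).add
      (continuousOn_finsetSum _ fun i _ => (hc i).mul
        (contDiff_partialDeriv hw i).continuous.continuousOn)).add
      (hd.mul (contDiff_lap hw).continuous.continuousOn))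
  -- At most two derivatives fall on the wave, so the second weighted ℓ¹ norm of the coefficients
  -- dominates and integral and sum may be interchanged.
  have hMb : ∀ k, ∀ x ∈ Ω, ‖M k x‖ ≤
      (B₀ + ∑ i, Bc i + Bd * n) * ((1 + ‖ℓ k‖) ^ 2 * ‖C k‖) := fun k x hx => by
    have hx' := subset_closure hx
    have h1 : (1 : ℝ) ≤ 1 + ‖ℓ k‖ := by simp
    rw [hM, norm_mul, norm_mul, norm_wave_osc, mul_one, ← mul_assoc]
    gcongr
    have hs1 : ‖∑ i, c i x * osc (ℓ k) i‖ ≤ (∑ i, Bc i) * (1 + ‖ℓ k‖) ^ 2 := by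
      rw [Finset.sum_mul]
      refine (norm_sum_le _ _).trans (Finset.sum_le_sum fun i _ => ?_)
      rw [norm_mul]
      have := hBc0 i
      gcongr
      exacts [hBc i x hx', (norm_osc_le _ _).trans (le_self_pow₀ h1 two_ne_zero)]
    have hs2 : ‖∑ i, osc (ℓ k) i ^ 2‖ ≤ n * (1 + ‖ℓ k‖) ^ 2 := by
      refine (norm_sum_le _ _).trans ?_
      calc ∑ i, ‖osc (ℓ k) i ^ 2‖ ≤ ∑ _i : Fin n, (1 + ‖ℓ k‖) ^ 2 := by
            refine Finset.sum_le_sum fun i _ => ?_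
            rw [norm_pow]
            gcongr
            exact norm_osc_le _ _
        _ = _ := by simp
    calc ‖c₀ x + ∑ i, c i x * osc (ℓ k) i + d x * ∑ i, osc (ℓ k) i ^ 2‖
        ≤ ‖c₀ x‖ + ‖∑ i, c i x * osc (ℓ k) i‖ + ‖d x‖ * ‖∑ i, osc (ℓ k) i ^ 2‖ := by
          rw [← norm_mul]; exact norm_add₃_le
      _ ≤ B₀ * (1 + ‖ℓ k‖) ^ 2 + (∑ i, Bc i) * (1 + ‖ℓ k‖) ^ 2
          + Bd * (n * (1 + ‖ℓ k‖) ^ 2) := by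
          gcongr
          · exact (hB₀ x hx').trans (le_mul_of_one_le_right hB₀0 (one_le_pow₀ h1))
          · exact hBd x hx'
      _ = _ := by ring
  have hfin : volume Ω < ⊤ := hb.measure_lt_top
  have key := hasSum_integral_of_summable_integral_norm (μ := volume.restrict Ω) (F := M)
    (fun k => integrableOn_of_continuousOn_closure hb (hMcont k)) (by
      refine Summable.of_nonneg_of_le (fun k => integral_nonneg fun x => norm_nonneg _)
        (fun k => ?_) (((hrd 2).mul_left (B₀ + ∑ i, Bc i + Bd * n)).mul_right (volume.real Ω))
      have := norm_setIntegral_le_of_norm_le_const (f := fun x => ‖M k x‖) hfin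
        (fun x hx => by simpa using hMb k x hx)
      rwa [Real.norm_of_nonneg (integral_nonneg fun x => norm_nonneg _)] at this)
  have hzero : ∀ k, ∫ x in Ω, M k x = 0 := fun k => by
    simp only [M]
    rw [integral_const_mul, h (ℓ k) (hℓ0 k), mul_zero]
  simp only [hzero] at key
  rw [setIntegral_congr_fun ho.measurableSet (g := fun x => ∑' k, M k x)
    fun x hx => (hMs x hx).tsum_eq.symm]
  exact key.unique hasSum_zero

end Integrals

end Conductivity

namespace Conductivity

open Complex MeasureTheory Filter Topology

variable {n : ℕ}

/-! ### Liouville transformation and complex geometric optics solutions -/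

section Optics

variable {Ω : Set (Euc n)}

lemma _root_.ContDiff.differentiableAt_infty {u : Euc n → ℂ} (hu : ContDiff ℝ ∞ u) {x : Euc n} :
    DifferentiableAt ℝ u x := hu.differentiable (by simp) x

/-- The conductivity has a smooth non-vanishing global square root. -/
lemma exists_sqrt_conductivity (hb : Bornology.IsBounded Ω) {γ₀ : Euc n → ℝ}
    (hγ : SmoothUpToBoundary Ω γ₀) (hpos : ∀ x ∈ closure Ω, 0 < γ₀ x) :
    ∃ ρ : Euc n → ℂ, ContDiff ℝ ∞ ρ ∧ (∀ x, ρ x ≠ 0) ∧ ∀ x ∈ Ω, (γ₀ x : ℂ) = ρ x * ρ x := by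
  obtain ⟨v, hv, hev⟩ := hγ
  obtain ⟨c, hc, hcv⟩ : ∃ c : ℝ, 0 < c ∧ ∀ x ∈ closure Ω, c ≤ v x := by
    rcases (closure Ω).eq_empty_or_nonempty with h | h
    · exact ⟨1, one_pos, by simp [h]⟩
    · obtain ⟨x, hx, hmin⟩ := hb.isCompact_closure.exists_isMinOn h hv.continuous.continuousOn
      exact ⟨v x, hev hx ▸ hpos x hx, fun y hy => hmin hy⟩
  -- The smooth extension of γ₀ may vanish or change sign away from the closure of Ω. This cutoff is
  -- 1 where v ≥ c and 0 where v ≤ c/2, so blending with the constant c leaves γ₀ unchanged on Ω and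
  -- keeps the result positive.
  let τ : Euc n → ℝ := fun x => Real.smoothTransition ((2 * v x - c) / c)
  let w : Euc n → ℝ := fun x => τ x * v x + (1 - τ x) * c
  have hτ : ContDiff ℝ ∞ τ :=
    Real.smoothTransition.contDiff.comp (((contDiff_const.mul hv).sub contDiff_const).div_const _)
  have hw : ContDiff ℝ ∞ w := (hτ.mul hv).add ((contDiff_const.sub hτ).mul contDiff_const)
  have hw0 : ∀ x, 0 < w x := fun x => by
    have h0 : 0 ≤ τ x := Real.smoothTransition.nonneg _
    have h1 : τ x ≤ 1 := Real.smoothTransition.le_one _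
    by_cases h : 2 * v x - c ≤ 0
    · have : τ x = 0 := Real.smoothTransition.zero_of_nonpos (div_nonpos_of_nonpos_of_nonneg h hc.le)
      simp [w, this, hc]
    · have hvx : c / 2 < v x := by linarith
      have hle : τ x * (c / 2) ≤ τ x * v x := by gcongr
      simp only [w]
      nlinarith
  have hwv : ∀ x ∈ Ω, w x = γ₀ x := fun x hx => by
    have : τ x = 1 := Real.smoothTransition.one_of_one_le (by
      rw [one_le_div hc]; linarith [hcv x (subset_closure hx)])
    simp [w, this, hev (subset_closure hx)]
  refine ⟨fun x => (Real.sqrt (w x) : ℂ), ?_, fun x => ?_, fun x hx => ?_⟩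
  · exact Complex.ofRealCLM.contDiff.comp (hw.sqrt fun x => (hw0 x).ne')
  · exact ofReal_ne_zero.2 (Real.sqrt_pos.2 (hw0 x)).ne'
  · rw [← ofReal_mul, Real.mul_self_sqrt (hw0 x).le, hwv x hx]

lemma contDiff_fun_inv {ρ : Euc n → ℂ} (hρ : ContDiff ℝ ∞ ρ) (hρ0 : ∀ x, ρ x ≠ 0) :
    ContDiff ℝ ∞ fun x => (ρ x)⁻¹ := hρ.inv hρ0

lemma partialDeriv_inv {ρ : Euc n → ℂ} (hρ : ContDiff ℝ ∞ ρ) (hρ0 : ∀ x, ρ x ≠ 0) (i : Fin n)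
    (x : Euc n) : ρ x * ρ x * partialDeriv i (fun y => (ρ y)⁻¹) x = -partialDeriv i ρ x := by
  have h := partialDeriv_mul (hρ.differentiableAt_infty (x := x))
    ((contDiff_fun_inv hρ hρ0).differentiableAt_infty (x := x)) i
  rw [show (fun y => ρ y * (ρ y)⁻¹) = fun _ => (1 : ℂ) from
    funext fun y => mul_inv_cancel₀ (hρ0 y), partialDeriv_const] at h
  have h2 : partialDeriv i ρ x * (ρ x)⁻¹ * ρ x = partialDeriv i ρ x :=
    inv_mul_cancel_right₀ (hρ0 x) _
  linear_combination -h2 - ρ x * h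

/-- Liouville's transformation of the divergence form operator. -/
lemma sum_partialDeriv_conductivity (ho : IsOpen Ω) {γ ρ v : Euc n → ℂ}
    (hρ : ContDiff ℝ ∞ ρ) (hρ0 : ∀ x, ρ x ≠ 0) (hγρ : ∀ x ∈ Ω, γ x = ρ x * ρ x)
    (hv : ContDiff ℝ ∞ v) {x : Euc n} (hx : x ∈ Ω) :
    ∑ i, partialDeriv i (fun y => γ y * partialDeriv i (fun z => (ρ z)⁻¹ * v z) y) x
      = ρ x * lap v x - v x * lap ρ x := by
  rw [lap, lap, Finset.mul_sum, Finset.mul_sum, ← Finset.sum_sub_distrib]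
  refine Finset.sum_congr rfl fun i _ => ?_
  have hvi := contDiff_partialDeriv hv i
  have hρi := contDiff_partialDeriv hρ i
  -- The flux is γ∇(ρ⁻¹v) = ρ∇v - v∇ρ, in whose divergence the products ∇ρ·∇v cancel.
  have hev : (fun y => γ y * partialDeriv i (fun z => (ρ z)⁻¹ * v z) y) =ᶠ[𝓝 x]
      fun y => ρ y * partialDeriv i v y - v y * partialDeriv i ρ y := by
    filter_upwards [ho.mem_nhds hx] with y hy
    rw [hγρ y hy, partialDeriv_mul ((contDiff_fun_inv hρ hρ0).differentiableAt_infty) hv.differentiableAt_infty]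
    linear_combination v y * partialDeriv_inv hρ hρ0 i y +
      ρ y * partialDeriv i v y * mul_inv_cancel₀ (hρ0 y)
  rw [partialDeriv_congr hev, partialDeriv_sub (hρ.mul hvi).differentiableAt_infty
    (hv.mul hρi).differentiableAt_infty, partialDeriv_mul hρ.differentiableAt_infty
    hvi.differentiableAt_infty, partialDeriv_mul hv.differentiableAt_infty
    hρi.differentiableAt_infty]
  ring

/-- Conjugation by e^{ζ·x} turns ∇ into ∇ + ζ; for null ζ the zeroth-order term drops out and the
operator of `exists_conjugated_solution` remains. -/
lemma lap_wave_mul {s : Euc n → ℂ} (hs : ContDiff ℝ ∞ s) (ζ : Fin n → ℂ) (x : Euc n) :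
    lap (fun y => wave ζ y * s y) x = wave ζ x *
      (∑ i, (partialDeriv i (partialDeriv i s) x + 2 * ζ i * partialDeriv i s x)
        + (∑ i, ζ i * ζ i) * s x) := by
  rw [lap, Finset.sum_mul, ← Finset.sum_add_distrib, Finset.mul_sum]
  refine Finset.sum_congr rfl fun i _ => ?_
  have hw := contDiff_wave ζ
  have hsi := contDiff_partialDeriv hs i
  have h1 : partialDeriv i (fun y => wave ζ y * s y)
      = fun y => wave ζ y * (ζ i * s y + partialDeriv i s y) := by
    ext y
    rw [partialDeriv_mul hw.differentiableAt_infty hs.differentiableAt_infty, partialDeriv_wave]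
    ring
  rw [h1, partialDeriv_mul hw.differentiableAt_infty
    ((contDiff_const.mul hs).add hsi).differentiableAt_infty, partialDeriv_wave,
    partialDeriv_add (contDiff_const.mul hs).differentiableAt_infty hsi.differentiableAt_infty,
    partialDeriv_const_mul hs.differentiableAt_infty]
  ring

/-- The complex geometric optics form `ρ⁻¹ exp (ζ · x) s`. -/
noncomputable def cgo (ρ : Euc n → ℂ) (ζ : Fin n → ℂ) (s : Euc n → ℂ) (x : Euc n) : ℂ :=
  (ρ x)⁻¹ * (wave ζ x * s x)

lemma contDiff_cgo {ρ s : Euc n → ℂ} (hρ : ContDiff ℝ ∞ ρ) (hρ0 : ∀ x, ρ x ≠ 0)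
    (hs : ContDiff ℝ ∞ s) (ζ : Fin n → ℂ) : ContDiff ℝ ∞ (cgo ρ ζ s) :=
  (contDiff_fun_inv hρ hρ0).mul ((contDiff_wave ζ).mul hs)

lemma partialDeriv_cgo {ρ s : Euc n → ℂ} (hρ : ContDiff ℝ ∞ ρ) (hρ0 : ∀ x, ρ x ≠ 0)
    (hs : ContDiff ℝ ∞ s) (ζ : Fin n → ℂ) (i : Fin n) (x : Euc n) :
    partialDeriv i (cgo ρ ζ s) x = wave ζ x * ((ζ i * (ρ x)⁻¹ +
      partialDeriv i (fun y => (ρ y)⁻¹) x) * s x + (ρ x)⁻¹ * partialDeriv i s x) := by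
  have hw := contDiff_wave ζ
  unfold cgo
  rw [partialDeriv_mul (contDiff_fun_inv hρ hρ0).differentiableAt_infty (hw.mul hs).differentiableAt_infty,
    partialDeriv_mul hw.differentiableAt_infty hs.differentiableAt_infty, partialDeriv_wave]
  ring

/-- Complex geometric optics solutions with amplitude `a`. -/
theorem exists_cgo_solution (i₀ : Fin n) (ho : IsOpen Ω) (hb : Bornology.IsBounded Ω)
    {γ₀ : Euc n → ℝ} {ρ a : Euc n → ℂ}
    (hρ : ContDiff ℝ ∞ ρ) (hρ0 : ∀ x, ρ x ≠ 0) (hγρ : ∀ x ∈ Ω, (γ₀ x : ℂ) = ρ x * ρ x)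
    (ha : ContDiff ℝ ∞ a) :
    ∃ C N₀ : ℝ, 0 < N₀ ∧ 0 ≤ C ∧ ∀ ζ : Fin n → ℂ, ∑ i, ζ i * ζ i = 0 →
      (∀ x, ∑ i, ζ i * partialDeriv i a x = 0) → N₀ ≤ ‖reVec ζ‖ →
      ∃ r : Euc n → ℂ, ContDiff ℝ ∞ r ∧ IsSolution Ω γ₀ (cgo ρ ζ fun x => a x + r x) ∧
        (∀ x, ‖r x‖ ≤ C / ‖reVec ζ‖) ∧ (∀ i x, ‖partialDeriv i r x‖ ≤ C / ‖reVec ζ‖) ∧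
        (∀ i j x, ‖partialDeriv i (partialDeriv j r) x‖ ≤ C / ‖reVec ζ‖) := by
  obtain ⟨R₀, hR₀⟩ := hb.subset_ball (0 : Euc n)
  have hR : 0 < max R₀ 1 := lt_max_of_lt_right one_pos
  have hΩR : Ω ⊆ Metric.ball 0 (max R₀ 1) :=
    hR₀.trans (Metric.ball_subset_ball (le_max_left _ _))
  let q : Euc n → ℂ := fun x => lap ρ x * (ρ x)⁻¹
  have hq : ContDiff ℝ ∞ q := (contDiff_lap hρ).mul (contDiff_fun_inv hρ hρ0)
  obtain ⟨N₀, hN₀, h⟩ := exists_conjugated_solution i₀ hq hR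
  -- The remainder must cancel (Δ - q)a; the transport equation ζ·∇a = 0 removes the only
  -- contribution of the amplitude that would grow with ζ.
  obtain ⟨C, hC, h⟩ := h (fun x => q x * a x - lap a x) ((hq.mul ha).sub (contDiff_lap ha))
  refine ⟨C, N₀, hN₀, hC, fun ζ hζ hζa hN => ?_⟩
  obtain ⟨r, hr, heq, hb0, hb1, hb2⟩ := h ζ hN
  refine ⟨r, hr, fun x hx => ?_, hb0, hb1, hb2⟩
  have hs : ContDiff ℝ ∞ fun x => a x + r x := ha.add hr
  have hx' := heq x (by simpa using hΩR hx)
  have := sum_partialDeriv_conductivity (γ := fun y => (γ₀ y : ℂ)) ho hρ hρ0 hγρ ((contDiff_wave ζ).mul hs) hx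
  unfold cgo
  rw [this, lap_wave_mul hs, hζ, zero_mul, add_zero]
  have h1 : ∀ i, partialDeriv i (fun y => a y + r y)
      = fun y => partialDeriv i a y + partialDeriv i r y := fun i => funext fun y =>
    partialDeriv_add ha.differentiableAt_infty hr.differentiableAt_infty i
  have h2 : ∑ i, (partialDeriv i (partialDeriv i fun x => a x + r x) x +
      2 * ζ i * partialDeriv i (fun x => a x + r x) x) = lap a x + 2 * ∑ i, ζ i * partialDeriv i a x
      + ∑ i, (partialDeriv i (partialDeriv i r) x + 2 * ζ i * partialDeriv i r x) := by
    rw [lap, Finset.mul_sum, ← Finset.sum_add_distrib, ← Finset.sum_add_distrib]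
    refine Finset.sum_congr rfl fun i _ => ?_
    rw [h1, partialDeriv_add (contDiff_partialDeriv ha i).differentiableAt_infty
      (contDiff_partialDeriv hr i).differentiableAt_infty]
    ring
  rw [h2, hζa x]
  have hqx : q x * ρ x = lap ρ x := inv_mul_cancel_right₀ (hρ0 x) _
  linear_combination (ρ x * wave ζ x) * hx' + wave ζ x * (a x + r x) * hqx

/-- Solvability of the inhomogeneous Schrödinger equation `Δ v - (Δ ρ / ρ) v = g` on `Ω`. -/
lemma exists_schroedinger_solution (i₀ : Fin n) (hb : Bornology.IsBounded Ω) {ρ : Euc n → ℂ}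
    (hρ : ContDiff ℝ ∞ ρ) (hρ0 : ∀ x, ρ x ≠ 0) {ν : Fin n → ℂ} (hν : ∑ i, ν i * ν i = 0)
    (hν0 : reVec ν ≠ 0) {g : Euc n → ℂ} (hg : ContDiff ℝ ∞ g) :
    ∃ v : Euc n → ℂ, ContDiff ℝ ∞ v ∧ ∀ x ∈ Ω, ρ x * lap v x - v x * lap ρ x = ρ x * g x := by
  obtain ⟨R₀, hR₀⟩ := hb.subset_ball (0 : Euc n)
  have hR : 0 < max R₀ 1 := lt_max_of_lt_right one_pos
  have hΩR : Ω ⊆ Metric.ball 0 (max R₀ 1) :=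
    hR₀.trans (Metric.ball_subset_ball (le_max_left _ _))
  let q : Euc n → ℂ := fun x => lap ρ x * (ρ x)⁻¹
  have hq : ContDiff ℝ ∞ q := (contDiff_lap hρ).mul (hρ.inv hρ0)
  obtain ⟨N₀, hN₀, h⟩ := exists_conjugated_solution i₀ hq hR
  -- A single large null vector is enough. It is fixed before the conjugated source e^{-ζ·x}g is
  -- formed, which is possible because N₀ does not depend on the source.
  obtain ⟨t, ht⟩ : ∃ t : ℝ, N₀ ≤ ‖t • reVec ν‖ := ⟨N₀ / ‖reVec ν‖, by
    rw [norm_smul, Real.norm_of_nonneg (by positivity),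
      div_mul_cancel₀ _ (norm_ne_zero_iff.2 hν0)]⟩
  let ζ : Fin n → ℂ := fun i => (t : ℂ) * ν i
  have hre : reVec ζ = t • reVec ν := by ext i; simp [reVec, ζ]
  have hζ : ∑ i, ζ i * ζ i = 0 := by
    rw [show ∑ i, ζ i * ζ i = (t : ℂ) ^ 2 * ∑ i, ν i * ν i by
      rw [Finset.mul_sum]; exact Finset.sum_congr rfl fun i _ => by ring, hν, mul_zero]
  obtain ⟨C, -, h⟩ := h (fun x => wave (-ζ) x * g x) ((contDiff_wave _).mul hg)
  obtain ⟨r, hr, heq, -⟩ := h ζ (hre ▸ ht)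
  refine ⟨fun x => wave ζ x * r x, (contDiff_wave ζ).mul hr, fun x hx => ?_⟩
  have hx' := heq x (by simpa using hΩR hx)
  have hw : wave ζ x * wave (-ζ) x = 1 := by rw [← wave_add, add_neg_cancel, wave_zero]
  have hqx : q x * ρ x = lap ρ x := inv_mul_cancel_right₀ (hρ0 x) _
  rw [lap_wave_mul hr, hζ, zero_mul, add_zero]
  linear_combination (ρ x * wave ζ x) * hx' + wave ζ x * r x * hqx + ρ x * g x * hw

/-- The real part of ζ·ζ = 0 says that Re ζ and Im ζ have equal length. -/
lemma sum_norm_sq_eq (ζ : Fin n → ℂ) (hζ : ∑ i, ζ i * ζ i = 0) :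
    ∑ i, ‖ζ i‖ ^ 2 = 2 * ‖reVec ζ‖ ^ 2 := by
  have h : (∑ i, ((ζ i).re ^ 2 - (ζ i).im ^ 2)) = 0 := by
    have := congrArg Complex.re hζ
    simpa [re_sum, mul_re, sq] using this
  rw [EuclideanSpace.norm_sq_eq]
  simp only [Complex.sq_norm, normSq_apply, reVec, Real.norm_eq_abs, sq_abs]
  rw [Finset.mul_sum, ← sub_eq_zero, ← Finset.sum_sub_distrib]
  rw [← neg_eq_zero, ← Finset.sum_neg_distrib, ← h]
  exact Finset.sum_congr rfl fun i _ => by ring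

end Optics

end Conductivity

namespace Conductivity

open Complex MeasureTheory Filter Topology

variable {n : ℕ}

/-! ### Calculus of bounded pointwise limits -/

section BoundedConvergence

/-- Bounded pointwise convergence on `Ω` of functions that are eventually continuous. -/
structure BddConv (Ω : Set (Euc n)) (F : ℕ → Euc n → ℂ) (f : Euc n → ℂ) : Prop where
  cont : ∀ᶠ N in atTop, ContinuousOn (F N) Ω
  bdd : ∃ B, 0 ≤ B ∧ ∀ᶠ N in atTop, ∀ x ∈ Ω, ‖F N x‖ ≤ B
  lim : ∀ x ∈ Ω, Tendsto (fun N => F N x) atTop (𝓝 (f x))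

variable {Ω : Set (Euc n)} {F G : ℕ → Euc n → ℂ} {f g : Euc n → ℂ}

namespace BddConv

lemma add (hF : BddConv Ω F f) (hG : BddConv Ω G g) :
    BddConv Ω (fun N x => F N x + G N x) (fun x => f x + g x) := by
  obtain ⟨B, hB0, hB⟩ := hF.bdd
  obtain ⟨D, hD0, hD⟩ := hG.bdd
  refine ⟨?_, ⟨B + D, by positivity, ?_⟩, fun x hx => (hF.lim x hx).add (hG.lim x hx)⟩
  · filter_upwards [hF.cont, hG.cont] with N h1 h2 using h1.add h2
  · filter_upwards [hB, hD] with N h1 h2 x hx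
    exact (norm_add_le _ _).trans (add_le_add (h1 x hx) (h2 x hx))

lemma mul (hF : BddConv Ω F f) (hG : BddConv Ω G g) :
    BddConv Ω (fun N x => F N x * G N x) (fun x => f x * g x) := by
  obtain ⟨B, hB0, hB⟩ := hF.bdd
  obtain ⟨D, hD0, hD⟩ := hG.bdd
  refine ⟨?_, ⟨B * D, by positivity, ?_⟩, fun x hx => (hF.lim x hx).mul (hG.lim x hx)⟩
  · filter_upwards [hF.cont, hG.cont] with N h1 h2 using h1.mul h2
  · filter_upwards [hB, hD] with N h1 h2 x hx
    rw [norm_mul]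
    exact mul_le_mul (h1 x hx) (h2 x hx) (norm_nonneg _) hB0

lemma scalar {l : ℕ → ℂ} {L : ℂ} (h : Tendsto l atTop (𝓝 L)) :
    BddConv Ω (fun N _ => l N) (fun _ => L) := by
  refine ⟨Eventually.of_forall fun N => continuousOn_const, ⟨‖L‖ + 1, by positivity, ?_⟩,
    fun x _ => h⟩
  filter_upwards [h.norm.eventually (gt_mem_nhds (lt_add_one ‖L‖))] with N hN x _ using hN.le

lemma const (hb : Bornology.IsBounded Ω) (hf : ContinuousOn f (closure Ω)) :
    BddConv Ω (fun _ => f) f := by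
  obtain ⟨B, hB0, hB⟩ := exists_bound_on_closure hb hf
  exact ⟨Eventually.of_forall fun _ => hf.mono subset_closure,
    ⟨B, hB0, Eventually.of_forall fun _ x hx => hB x (subset_closure hx)⟩,
    fun x _ => tendsto_const_nhds⟩

lemma const_smooth (hb : Bornology.IsBounded Ω) (hf : ContDiff ℝ ∞ f) :
    BddConv Ω (fun _ => f) f := const hb hf.continuous.continuousOn

lemma sum {ι : Type*} [Fintype ι] {F : ι → ℕ → Euc n → ℂ} {f : ι → Euc n → ℂ}
    (h : ∀ i, BddConv Ω (F i) (f i)) :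
    BddConv Ω (fun N x => ∑ i, F i N x) (fun x => ∑ i, f i x) := by
  choose B hB0 hB using fun i => (h i).bdd
  refine ⟨?_, ⟨∑ i, B i, Finset.sum_nonneg fun i _ => hB0 i, ?_⟩,
    fun x hx => tendsto_finsetSum _ fun i _ => (h i).lim x hx⟩
  · filter_upwards [eventually_all.2 fun i => (h i).cont] with N hN
    exact continuousOn_finsetSum _ fun i _ => hN i
  · filter_upwards [eventually_all.2 hB] with N hN x hx
    exact (norm_sum_le _ _).trans (Finset.sum_le_sum fun i _ => hN i x hx)

lemma congr (hF : BddConv Ω F f) (hFG : ∀ᶠ N in atTop, ∀ x ∈ Ω, F N x = G N x)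
    (hfg : ∀ x ∈ Ω, f x = g x) : BddConv Ω G g := by
  obtain ⟨B, hB0, hB⟩ := hF.bdd
  refine ⟨?_, ⟨B, hB0, ?_⟩, fun x hx => ?_⟩
  · filter_upwards [hF.cont, hFG] with N h1 h2 using h1.congr fun x hx => (h2 x hx).symm
  · filter_upwards [hB, hFG] with N h1 h2 x hx
    rw [← h2 x hx]; exact h1 x hx
  · rw [← hfg x hx]
    refine (hF.lim x hx).congr' ?_
    filter_upwards [hFG] with N h2 using h2 x hx

lemma zero_of_le {b : ℕ → ℝ} (hb : Tendsto b atTop (𝓝 0))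
    (hc : ∀ᶠ N in atTop, ContinuousOn (F N) Ω) (h : ∀ᶠ N in atTop, ∀ x, ‖F N x‖ ≤ b N) :
    BddConv Ω F (fun _ => 0) := by
  refine ⟨hc, ⟨1, zero_le_one, ?_⟩, fun x _ => ?_⟩
  · filter_upwards [h, hb.eventually (gt_mem_nhds one_pos)] with N h1 h2 x _
    exact (h1 x).trans h2.le
  · refine squeeze_zero_norm' ?_ hb
    filter_upwards [h] with N h1 using h1 x

lemma integral_eq_zero (ho : IsOpen Ω) (hb : Bornology.IsBounded Ω) (hF : BddConv Ω F f)
    (h : ∀ᶠ N in atTop, ∫ x in Ω, F N x = 0) : ∫ x in Ω, f x = 0 := by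
  obtain ⟨B, -, hB⟩ := hF.bdd
  obtain ⟨N₀, hN₀⟩ := eventually_atTop.1 hF.cont
  -- Continuity holds only from some index on, whence the shift of the sequence.
  have ht := tendsto_setIntegral_of_bounded ho hb (F := fun N => F (N + N₀)) (f := f)
    (fun N => hN₀ _ (Nat.le_add_left _ _)) ((tendsto_add_atTop_nat N₀).eventually hB)
    (fun x hx => (hF.lim x hx).comp (tendsto_add_atTop_nat N₀))
  refine tendsto_nhds_unique ht (tendsto_const_nhds.congr' ?_)
  filter_upwards [(tendsto_add_atTop_nat N₀).eventually h] with N hN using hN.symm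

end BddConv

end BoundedConvergence

/-! ### Sequences of solutions with growing phase -/

section Sequences

variable {Ω : Set (Euc n)}

/-- A sequence of complex geometric optics solutions whose remainders tend to zero in `C²`. -/
lemma exists_cgo_sequence (i₀ : Fin n) (ho : IsOpen Ω) (hb : Bornology.IsBounded Ω)
    {γ₀ : Euc n → ℝ} {ρ a : Euc n → ℂ}
    (hρ : ContDiff ℝ ∞ ρ) (hρ0 : ∀ x, ρ x ≠ 0) (hγρ : ∀ x ∈ Ω, (γ₀ x : ℂ) = ρ x * ρ x)
    (ha : ContDiff ℝ ∞ a) {ζ : ℕ → Fin n → ℂ} (hζ : ∀ N, ∑ i, ζ N i * ζ N i = 0)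
    (hζa : ∀ N x, ∑ i, ζ N i * partialDeriv i a x = 0)
    (hlim : Tendsto (fun N => ‖reVec (ζ N)‖) atTop atTop) :
    ∃ r : ℕ → Euc n → ℂ, (∀ N, ContDiff ℝ ∞ (r N)) ∧
      (∀ᶠ N in atTop, IsSolution Ω γ₀ (cgo ρ (ζ N) fun x => a x + r N x)) ∧
      BddConv Ω r (fun _ => 0) ∧
      (∀ i, BddConv Ω (fun N => partialDeriv i (r N)) (fun _ => 0)) ∧
      (∀ i j, BddConv Ω (fun N => partialDeriv i (partialDeriv j (r N))) (fun _ => 0)) := by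
  obtain ⟨C, N₀, -, -, h⟩ := exists_cgo_solution i₀ ho hb hρ hρ0 hγρ ha
  have h' : ∀ N, ∃ r : Euc n → ℂ, ContDiff ℝ ∞ r ∧ (N₀ ≤ ‖reVec (ζ N)‖ →
      IsSolution Ω γ₀ (cgo ρ (ζ N) fun x => a x + r x) ∧
        (∀ x, ‖r x‖ ≤ C / ‖reVec (ζ N)‖) ∧ (∀ i x, ‖partialDeriv i r x‖ ≤ C / ‖reVec (ζ N)‖) ∧
        (∀ i j x, ‖partialDeriv i (partialDeriv j r) x‖ ≤ C / ‖reVec (ζ N)‖)) := fun N => by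
    by_cases hN : N₀ ≤ ‖reVec (ζ N)‖
    · obtain ⟨r, hr, hrest⟩ := h (ζ N) (hζ N) (hζa N) hN
      exact ⟨r, hr, fun _ => hrest⟩
    -- For the phases that are still too small the remainder is set to 0; only large N matter.
    · exact ⟨fun _ => 0, contDiff_const, fun h => absurd h hN⟩
  choose r hr hrest using h'
  have hbig := hlim.eventually (eventually_ge_atTop N₀)
  have hz : Tendsto (fun N => C / ‖reVec (ζ N)‖) atTop (𝓝 0) := hlim.const_div_atTop C
  refine ⟨r, hr, ?_, ?_, fun i => ?_, fun i j => ?_⟩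
  · filter_upwards [hbig] with N hN using (hrest N hN).1
  · refine BddConv.zero_of_le hz (Eventually.of_forall fun N => (hr N).continuous.continuousOn) ?_
    filter_upwards [hbig] with N hN using (hrest N hN).2.1
  · refine BddConv.zero_of_le hz (Eventually.of_forall fun N =>
      (contDiff_partialDeriv (hr N) i).continuous.continuousOn) ?_
    filter_upwards [hbig] with N hN using (hrest N hN).2.2.1 i
  · refine BddConv.zero_of_le hz (Eventually.of_forall fun N => (contDiff_partialDeriv
      (contDiff_partialDeriv (hr N) j) i).continuous.continuousOn) ?_
    filter_upwards [hbig] with N hN using (hrest N hN).2.2.2 i j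

lemma reVec_natCast_mul (ν : Fin n → ℂ) (N : ℕ) :
    ‖reVec (fun i => (N : ℂ) * ν i)‖ = N * ‖reVec ν‖ := by
  have : reVec (fun i => (N : ℂ) * ν i) = (N : ℝ) • reVec ν := by
    ext i; simp [reVec]
  rw [this, norm_smul]; simp

lemma reVec_neg_natCast_mul (ν : Fin n → ℂ) (N : ℕ) :
    ‖reVec (fun i => -((N : ℂ) * ν i))‖ = N * ‖reVec ν‖ := by
  rw [← reVec_natCast_mul, ← norm_neg]
  congr 1
  ext i; simp [reVec]

lemma tendsto_natCast_mul_reVec {ν : Fin n → ℂ} (hν : reVec ν ≠ 0) :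
    Tendsto (fun N : ℕ => (N : ℝ) * ‖reVec ν‖) atTop atTop :=
  tendsto_natCast_atTop_atTop.atTop_mul_const (norm_pos_iff.2 hν)

lemma tendsto_inv_natCast_complex : Tendsto (fun N : ℕ => ((N : ℂ))⁻¹) atTop (𝓝 0) :=
  tendsto_inv_atTop_nhds_zero_nat

/-- The leading order contribution of two complex geometric optics solutions with opposite phases to
a bilinear integral identity. -/
theorem integral_leading_symbol_eq_zero (i₀ : Fin n) (ho : IsOpen Ω) (hb : Bornology.IsBounded Ω)
    {γ₀ : Euc n → ℝ} {ρ a : Euc n → ℂ}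
    (hρ : ContDiff ℝ ∞ ρ) (hρ0 : ∀ x, ρ x ≠ 0) (hγρ : ∀ x ∈ Ω, (γ₀ x : ℂ) = ρ x * ρ x)
    (ha : ContDiff ℝ ∞ a) {ν : Fin n → ℂ} (hν : ∑ i, ν i * ν i = 0) (hν0 : reVec ν ≠ 0)
    (hνa : ∀ x, ∑ i, ν i * partialDeriv i a x = 0)
    {C : Fin (n + 1) → Fin n → Euc n → ℂ} (hC : ∀ i j, ContinuousOn (C i j) (closure Ω))
    (h : ∀ u w : Euc n → ℂ, ContDiff ℝ ∞ u → ContDiff ℝ ∞ w → IsSolution Ω γ₀ u →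
      IsSolution Ω γ₀ w → ∫ x in Ω, ∑ i, ∑ j, C i j x * jet u x i * partialDeriv j w x = 0) :
    ∫ x in Ω, a x * ((ρ x)⁻¹ * (ρ x)⁻¹ * ∑ i : Fin n, ∑ j, C i.succ j x * ν i * ν j) = 0 := by
  obtain ⟨r, hr, hsol, hr0, hr1, -⟩ := exists_cgo_sequence i₀ ho hb hρ hρ0 hγρ ha
    (ζ := fun N i => (N : ℂ) * ν i)
    (fun N => by
      rw [show ∑ i, (N : ℂ) * ν i * ((N : ℂ) * ν i) = (N : ℂ) ^ 2 * ∑ i, ν i * ν i by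
        rw [Finset.mul_sum]; exact Finset.sum_congr rfl fun i _ => by ring, hν, mul_zero])
    (fun N x => by simp only [mul_assoc]; rw [← Finset.mul_sum, hνa, mul_zero])
    ((tendsto_natCast_mul_reVec hν0).congr fun N => (reVec_natCast_mul ν N).symm)
  obtain ⟨r', hr', hsol', hr0', hr1', -⟩ := exists_cgo_sequence i₀ ho hb hρ hρ0 hγρ
    (contDiff_const (c := (1 : ℂ))) (ζ := fun N i => -((N : ℂ) * ν i))
    (fun N => by
      rw [show ∑ i, -((N : ℂ) * ν i) * -((N : ℂ) * ν i) = (N : ℂ) ^ 2 * ∑ i, ν i * ν i by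
        rw [Finset.mul_sum]; exact Finset.sum_congr rfl fun i _ => by ring, hν, mul_zero])
    (fun N x => by simp [partialDeriv_const])
    ((tendsto_natCast_mul_reVec hν0).congr fun N => (reVec_neg_natCast_mul ν N).symm)
  have hσ := contDiff_fun_inv hρ hρ0
  have hN := BddConv.scalar (Ω := Ω) tendsto_inv_natCast_complex
  have hs : BddConv Ω (fun N x => a x + r N x) (fun x => a x + 0) :=
    (BddConv.const_smooth hb ha).add hr0
  have hs' : BddConv Ω (fun N x => (1 : ℂ) + r' N x) (fun x => 1 + 0) :=
    (BddConv.const_smooth hb contDiff_const).add hr0'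
  have hσc := BddConv.const_smooth hb hσ
  -- With the exponential and one factor N removed, the gradient of u tends to ν ρ⁻¹ a and that of
  -- w, in `hZ`, to -ν ρ⁻¹. The value of u, in `hY0`, is of lower order and tends to 0, so only
  -- gradient components of the jet survive.
  have hY : ∀ i : Fin n, BddConv Ω (fun N x => (ν i * (ρ x)⁻¹ + (N : ℂ)⁻¹ *
      partialDeriv i (fun y => (ρ y)⁻¹) x) * (a x + r N x) + (N : ℂ)⁻¹ * ((ρ x)⁻¹ *
        (partialDeriv i a x + partialDeriv i (r N) x)))
      (fun x => (ν i * (ρ x)⁻¹ + 0 * partialDeriv i (fun y => (ρ y)⁻¹) x) * (a x + 0)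
        + 0 * ((ρ x)⁻¹ * (partialDeriv i a x + 0))) := fun i =>
    ((((BddConv.scalar tendsto_const_nhds).mul hσc).add
      (hN.mul (BddConv.const_smooth hb (contDiff_partialDeriv hσ i)))).mul hs).add
      (hN.mul (hσc.mul ((BddConv.const_smooth hb (contDiff_partialDeriv ha i)).add (hr1 i))))
  have hZ : ∀ j : Fin n, BddConv Ω (fun N x => (-ν j * (ρ x)⁻¹ + (N : ℂ)⁻¹ *
      partialDeriv j (fun y => (ρ y)⁻¹) x) * (1 + r' N x) + (N : ℂ)⁻¹ * ((ρ x)⁻¹ *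
        partialDeriv j (r' N) x))
      (fun x => (-ν j * (ρ x)⁻¹ + 0 * partialDeriv j (fun y => (ρ y)⁻¹) x) * (1 + 0)
        + 0 * ((ρ x)⁻¹ * 0)) := fun j =>
    ((((BddConv.scalar tendsto_const_nhds).mul hσc).add
      (hN.mul (BddConv.const_smooth hb (contDiff_partialDeriv hσ j)))).mul hs').add
      (hN.mul (hσc.mul (hr1' j)))
  have hY0 : BddConv Ω (fun N x => (N : ℂ)⁻¹ * ((ρ x)⁻¹ * (a x + r N x)))
      (fun x => 0 * ((ρ x)⁻¹ * (a x + 0))) := hN.mul (hσc.mul hs)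
  have hCc := fun i j => BddConv.const hb (hC i j)
  have htot := (BddConv.sum fun j => ((hCc 0 j).mul hY0).mul (hZ j)).add
    (BddConv.sum fun i : Fin n => BddConv.sum fun j => ((hCc i.succ j).mul (hY i)).mul (hZ j))
  have hres := htot.integral_eq_zero ho hb (by
    filter_upwards [hsol, hsol', eventually_ge_atTop 1] with N h1 h2 h3
    have hN0 : (N : ℂ) ≠ 0 := by exact_mod_cast (by omega : N ≠ 0)
    have hsm : ContDiff ℝ ∞ fun x => a x + r N x := ha.add (hr N)
    have hsm' : ContDiff ℝ ∞ fun x => (1 : ℂ) + r' N x := contDiff_const.add (hr' N)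
    have key := h _ _ (contDiff_cgo hρ hρ0 hsm _) (contDiff_cgo hρ hρ0 hsm' _) h1 h2
    have key2 : ∫ x in Ω, (N : ℂ)⁻¹ * (N : ℂ)⁻¹ * ∑ i, ∑ j, C i j x *
        jet (cgo ρ (fun i => (N : ℂ) * ν i) fun x => a x + r N x) x i *
        partialDeriv j (cgo ρ (fun i => -((N : ℂ) * ν i)) fun x => 1 + r' N x) x = 0 := by
      rw [integral_const_mul, key, mul_zero]
    rw [← key2]
    congr 1
    ext x
    have hw : wave (fun i => (N : ℂ) * ν i) x * wave (fun i => -((N : ℂ) * ν i)) x = 1 := by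
      rw [← wave_add, ← wave_zero x]
      congr 1
      ext i; simp
    have hinv : (N : ℂ)⁻¹ * N = 1 := inv_mul_cancel₀ hN0
    have hd : ∀ i, partialDeriv i (fun x => a x + r N x) x
        = partialDeriv i a x + partialDeriv i (r N) x := fun i =>
      partialDeriv_add ha.differentiableAt_infty (hr N).differentiableAt_infty i
    have hd' : ∀ i, partialDeriv i (fun x => 1 + r' N x) x = partialDeriv i (r' N) x := fun i => by
      rw [partialDeriv_add (contDiff_const (c := (1 : ℂ))).differentiableAt_infty
        (hr' N).differentiableAt_infty, partialDeriv_const, zero_add]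
    rw [Fin.sum_univ_succ, mul_add ((N : ℂ)⁻¹ * (N : ℂ)⁻¹)]
    simp only [Finset.mul_sum]
    congr 1
    · refine Finset.sum_congr rfl fun j _ => ?_
      simp only [jet, Fin.cons_zero]
      rw [partialDeriv_cgo hρ hρ0 hsm', hd', cgo]
      set W := wave (fun i => (N : ℂ) * ν i) x
      set W' := wave (fun i => -((N : ℂ) * ν i)) x
      rw [show (N : ℂ)⁻¹ * (N : ℂ)⁻¹ * (C 0 j x * ((ρ x)⁻¹ * (W * (a x + r N x))) *
        (W' * ((-((N : ℂ) * ν j) * (ρ x)⁻¹ + partialDeriv j (fun y => (ρ y)⁻¹) x) * (1 + r' N x) +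
          (ρ x)⁻¹ * partialDeriv j (r' N) x))) = (W * W') * (C 0 j x * ((N : ℂ)⁻¹ * ((ρ x)⁻¹ *
          (a x + r N x))) * ((-((N : ℂ)⁻¹ * N * ν j) * (ρ x)⁻¹ + (N : ℂ)⁻¹ *
            partialDeriv j (fun y => (ρ y)⁻¹) x) * (1 + r' N x) +
          (N : ℂ)⁻¹ * ((ρ x)⁻¹ * partialDeriv j (r' N) x))) by ring, hw, hinv, one_mul, one_mul]
    · refine Finset.sum_congr rfl fun i _ => Finset.sum_congr rfl fun j _ => ?_
      simp only [jet, Fin.cons_succ]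
      rw [partialDeriv_cgo hρ hρ0 hsm', hd', partialDeriv_cgo hρ hρ0 hsm, hd]
      set W := wave (fun i => (N : ℂ) * ν i) x
      set W' := wave (fun i => -((N : ℂ) * ν i)) x
      rw [show (N : ℂ)⁻¹ * (N : ℂ)⁻¹ * (C i.succ j x * (W * (((N : ℂ) * ν i * (ρ x)⁻¹ +
          partialDeriv i (fun y => (ρ y)⁻¹) x) * (a x + r N x) +
          (ρ x)⁻¹ * (partialDeriv i a x + partialDeriv i (r N) x))) *
        (W' * ((-((N : ℂ) * ν j) * (ρ x)⁻¹ + partialDeriv j (fun y => (ρ y)⁻¹) x) * (1 + r' N x) +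
          (ρ x)⁻¹ * partialDeriv j (r' N) x))) = (W * W') * (C i.succ j x *
          (((N : ℂ)⁻¹ * N * ν i * (ρ x)⁻¹ + (N : ℂ)⁻¹ * partialDeriv i (fun y => (ρ y)⁻¹) x) *
          (a x + r N x) + (N : ℂ)⁻¹ * ((ρ x)⁻¹ * (partialDeriv i a x + partialDeriv i (r N) x))) *
          ((-((N : ℂ)⁻¹ * N * ν j) * (ρ x)⁻¹ + (N : ℂ)⁻¹ *
            partialDeriv j (fun y => (ρ y)⁻¹) x) * (1 + r' N x) +
          (N : ℂ)⁻¹ * ((ρ x)⁻¹ * partialDeriv j (r' N) x))) by ring, hw, hinv, one_mul, one_mul,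
          one_mul])
  -- The sign comes from the opposite phase -ν of the second solution.
  rw [← neg_eq_zero, ← integral_neg, ← hres]
  congr 1
  ext x
  simp only [zero_mul, mul_zero, add_zero, Finset.sum_const_zero, zero_add, mul_one, Finset.mul_sum]
  rw [← Finset.sum_neg_distrib]
  refine Finset.sum_congr rfl fun i _ => ?_
  rw [← Finset.sum_neg_distrib]
  exact Finset.sum_congr rfl fun j _ => by ring

end Sequences

end Conductivity

namespace Conductivity

open Complex MeasureTheory Filter Topology

variable {n : ℕ}

/-! ### Complex null vectors -/

section NullVectors

/-- The vector with entries `α`, `β`, `δ` at the positions `i`, `j`, `k` and zeros elsewhere. -/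
def vec3 (i j k : Fin n) (α β δ : ℂ) : Fin n → ℂ := fun l =>
  if l = i then α else if l = j then β else if l = k then δ else 0

variable {i j k : Fin n}

lemma sum_vec3_mul (hij : i ≠ j) (hik : i ≠ k) (hjk : j ≠ k) (α β δ : ℂ) (f : Fin n → ℂ) :
    ∑ l, vec3 i j k α β δ l * f l = α * f i + β * f j + δ * f k := by
  have h : ∀ l, vec3 i j k α β δ l * f l = (if l = i then α * f i else 0) +
      (if l = j then β * f j else 0) + (if l = k then δ * f k else 0) := fun l => by
    unfold vec3
    by_cases h1 : l = i
    · subst h1; simp [hij, hik]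
    · by_cases h2 : l = j
      · subst h2; simp [h1, hjk]
      · by_cases h3 : l = k
        · subst h3; simp [h1, h2]
        · simp [h1, h2, h3]
  simp only [h, Finset.sum_add_distrib, Finset.sum_ite_eq', Finset.mem_univ, if_true]

lemma sum_vec3_sq (hij : i ≠ j) (hik : i ≠ k) (hjk : j ≠ k) (α β δ : ℂ) :
    ∑ l, vec3 i j k α β δ l * vec3 i j k α β δ l = α * α + β * β + δ * δ := by
  rw [sum_vec3_mul hij hik hjk]
  simp [vec3, hij.symm, hik.symm, hjk.symm]

/-- Real and imaginary parts of a null vector are equally long, so Re ζ controls every entry. One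
nonzero entry thus shows Re ζ ≠ 0, and one growing entry shows that |Re ζ| grows. -/
lemma norm_le_norm_reVec {ζ : Fin n → ℂ} (hζ : ∑ l, ζ l * ζ l = 0) (l : Fin n) :
    ‖ζ l‖ ≤ 2 * ‖reVec ζ‖ := by
  have h := sum_norm_sq_eq ζ hζ
  have h1 : ‖ζ l‖ ^ 2 ≤ ∑ l, ‖ζ l‖ ^ 2 :=
    Finset.single_le_sum (f := fun l => ‖ζ l‖ ^ 2) (fun _ _ => by positivity) (Finset.mem_univ l)
  refine abs_le_of_sq_le_sq' ?_ (by positivity) |>.2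
  nlinarith [sq_nonneg ‖reVec ζ‖]

lemma reVec_ne_zero {ζ : Fin n → ℂ} (hζ : ∑ l, ζ l * ζ l = 0) {l : Fin n} (hl : ζ l ≠ 0) :
    reVec ζ ≠ 0 := fun h => by
  have := norm_le_norm_reVec hζ l
  rw [h, norm_zero, mul_zero] at this
  exact hl (norm_le_zero_iff.1 this)

/-- In dimension at least three, every real vector is orthogonal to a null vector. -/
lemma exists_null_orthogonal (hij : i ≠ j) (hik : i ≠ k) (hjk : j ≠ k) (θ : Euc n) :
    ∃ ν : Fin n → ℂ, ∑ l, ν l * ν l = 0 ∧ ∑ l, ν l * (θ l : ℂ) = 0 ∧ reVec ν ≠ 0 := by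
  by_cases h : θ i ^ 2 + θ j ^ 2 = 0
  · have hi : θ i = 0 := by nlinarith [sq_nonneg (θ i), sq_nonneg (θ j)]
    have hj : θ j = 0 := by nlinarith [sq_nonneg (θ i), sq_nonneg (θ j)]
    have h0 : ∑ l, vec3 i j k 1 I 0 l * vec3 i j k 1 I 0 l = 0 := by
      rw [sum_vec3_sq hij hik hjk]; simp
    refine ⟨vec3 i j k 1 I 0, h0, ?_, reVec_ne_zero h0 (l := i) (by simp [vec3])⟩
    rw [sum_vec3_mul hij hik hjk]
    simp [hi, hj]
  · set R := Real.sqrt (θ i ^ 2 + θ j ^ 2 + θ k ^ 2)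
    have hR : (R : ℂ) * R = (θ i : ℂ) ^ 2 + (θ j : ℂ) ^ 2 + (θ k : ℂ) ^ 2 := by
      rw [← ofReal_mul, Real.mul_self_sqrt (by positivity)]
      push_cast; ring
    -- Real part and imaginary part R(-θ_j, θ_i, 0) are orthogonal to each other and to θ within the
    -- three coordinates, and both have length R√(θ_i² + θ_j²). The formula degenerates when θ_i =
    -- θ_j = 0, where (1, i, 0) serves instead.
    set ν := vec3 i j k ((θ i : ℂ) * θ k - I * R * θ j) ((θ j : ℂ) * θ k + I * R * θ i)
      (-((θ i : ℂ) ^ 2 + (θ j : ℂ) ^ 2))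
    have h0 : ∑ l, ν l * ν l = 0 := by
      rw [sum_vec3_sq hij hik hjk]
      linear_combination (R ^ 2 * (θ j ^ 2 + θ i ^ 2) : ℂ) * I_mul_I
        - ((θ i : ℂ) ^ 2 + (θ j : ℂ) ^ 2) * hR
    refine ⟨ν, h0, ?_, reVec_ne_zero h0 (l := k) ?_⟩
    · rw [sum_vec3_mul hij hik hjk]
      ring
    · simp only [ν, vec3, hik.symm, hjk.symm, if_false, if_true]
      have h' : ((θ i ^ 2 + θ j ^ 2 : ℝ) : ℂ) ≠ 0 := ofReal_ne_zero.2 h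
      push_cast at h'
      exact neg_ne_zero.2 h'

end NullVectors

/-! ### Rank zero: the linearized Calderón problem -/

section RankZero

variable {Ω : Set (Euc n)}

/-- In ∇·(P∇(uw)) the terms u∇·(P∇w) and w∇·(P∇u) vanish and the cross term appears twice. The
gradient product thereby depends on uw alone, where opposite exponential phases cancel. -/
lemma two_mul_gradDot (ho : IsOpen Ω) {γ₀ : Euc n → ℝ} {P u w : Euc n → ℂ} (hP : ContDiff ℝ ∞ P)
    (hγP : ∀ x ∈ Ω, (γ₀ x : ℂ) = P x) (hu : ContDiff ℝ ∞ u) (hw : ContDiff ℝ ∞ w)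
    (hus : IsSolution Ω γ₀ u) (hws : IsSolution Ω γ₀ w) {x : Euc n} (hx : x ∈ Ω) :
    2 * P x * gradDot u w x
      = ∑ i, partialDeriv i (fun y => P y * partialDeriv i (fun z => u z * w z) y) x := by
  have hconv : ∀ v : Euc n → ℂ, IsSolution Ω γ₀ v →
      ∑ i, partialDeriv i (fun y => P y * partialDeriv i v y) x = 0 := fun v hv => by
    rw [← hv x hx]
    refine Finset.sum_congr rfl fun i _ => partialDeriv_congr ?_ i
    filter_upwards [ho.mem_nhds hx] with y hy
    rw [hγP y hy]
  have hi : ∀ i, partialDeriv i (fun y => P y * partialDeriv i (fun z => u z * w z) y) x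
      = 2 * P x * (partialDeriv i u x * partialDeriv i w x)
        + u x * partialDeriv i (fun y => P y * partialDeriv i w y) x
        + w x * partialDeriv i (fun y => P y * partialDeriv i u y) x := fun i => by
    have hui := hP.mul (contDiff_partialDeriv hu i)
    have hwi := hP.mul (contDiff_partialDeriv hw i)
    have e : (fun y => P y * partialDeriv i (fun z => u z * w z) y)
        = fun y => u y * (P y * partialDeriv i w y) + w y * (P y * partialDeriv i u y) := by
      ext y
      rw [partialDeriv_mul hu.differentiableAt_infty hw.differentiableAt_infty]
      ring
    rw [e, partialDeriv_add (hu.mul hwi).differentiableAt_infty (hw.mul hui).differentiableAt_infty,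
      partialDeriv_mul hu.differentiableAt_infty hwi.differentiableAt_infty,
      partialDeriv_mul hw.differentiableAt_infty hui.differentiableAt_infty]
    ring
  rw [Finset.sum_congr rfl fun i _ => hi i, Finset.sum_add_distrib, Finset.sum_add_distrib,
    ← Finset.mul_sum, ← Finset.mul_sum, ← Finset.mul_sum, hconv u hus, hconv w hws, gradDot]
  ring

/-- Expansion of `∇ · (P ∇ (P⁻¹ h))`. -/
lemma sum_partialDeriv_inv_mul {P h : Euc n → ℂ} (hP : ContDiff ℝ ∞ P) (hP0 : ∀ x, P x ≠ 0)
    (hh : ContDiff ℝ ∞ h) (x : Euc n) :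
    ∑ i, partialDeriv i (fun y => P y * partialDeriv i (fun z => (P z)⁻¹ * h z) y) x
      = (∑ i, partialDeriv i (fun y => P y * partialDeriv i (fun z => (P z)⁻¹) y) x) * h x
        + ∑ i, P x * partialDeriv i (fun z => (P z)⁻¹) x * partialDeriv i h x + lap h x := by
  rw [lap, Finset.sum_mul, ← Finset.sum_add_distrib, ← Finset.sum_add_distrib]
  refine Finset.sum_congr rfl fun i _ => ?_
  have hI := contDiff_fun_inv hP hP0
  have hIi := hP.mul (contDiff_partialDeriv hI i)
  have hhi := contDiff_partialDeriv hh i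
  have e : (fun y => P y * partialDeriv i (fun z => (P z)⁻¹ * h z) y)
      = fun y => P y * partialDeriv i (fun z => (P z)⁻¹) y * h y + partialDeriv i h y := by
    ext y
    rw [partialDeriv_mul hI.differentiableAt_infty hh.differentiableAt_infty]
    linear_combination partialDeriv i h y * mul_inv_cancel₀ (hP0 y)
  rw [e, partialDeriv_add (hIi.mul hh).differentiableAt_infty hhi.differentiableAt_infty,
    partialDeriv_mul hIi.differentiableAt_infty hh.differentiableAt_infty]

/-- Injectivity of the linearized Calderón map at a smooth conductivity. -/
theorem eq_zero_of_integral_gradDot {i j k : Fin n} (hij : i ≠ j) (hik : i ≠ k) (hjk : j ≠ k)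
    (ho : IsOpen Ω) (hb : Bornology.IsBounded Ω) {γ₀ : Euc n → ℝ} {ρ : Euc n → ℂ}
    (hρ : ContDiff ℝ ∞ ρ) (hρ0 : ∀ x, ρ x ≠ 0) (hγρ : ∀ x ∈ Ω, (γ₀ x : ℂ) = ρ x * ρ x)
    {f : Euc n → ℂ} (hf : ContinuousOn f (closure Ω))
    (h : ∀ u w : Euc n → ℂ, ContDiff ℝ ∞ u → ContDiff ℝ ∞ w → IsSolution Ω γ₀ u →
      IsSolution Ω γ₀ w → ∫ x in Ω, f x * gradDot u w x = 0) : ∀ x ∈ Ω, f x = 0 := by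
  set P : Euc n → ℂ := fun x => ρ x * ρ x with hPdef
  have hP : ContDiff ℝ ∞ P := hρ.mul hρ
  have hP0 : ∀ x, P x ≠ 0 := fun x => mul_ne_zero (hρ0 x) (hρ0 x)
  have hI := contDiff_fun_inv hP hP0
  set A : Fin n → Euc n → ℂ := fun i x => P x * partialDeriv i (fun z => (P z)⁻¹) x with hA
  have hAs : ∀ i, ContDiff ℝ ∞ (A i) := fun i => hP.mul (contDiff_partialDeriv hI i)
  set A₀ : Euc n → ℂ := fun x => ∑ i, partialDeriv i (A i) x with hA₀
  have hA₀s : ContDiff ℝ ∞ A₀ := ContDiff.sum fun i _ => contDiff_partialDeriv (hAs i) i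
  set F : Euc n → ℂ := fun x => f x * (P x)⁻¹ with hF
  have hFc : ContinuousOn F (closure Ω) := hf.mul hI.continuous.continuousOn
  -- For ν orthogonal to θ the amplitude e^{iθ·x} satisfies the transport equation for every phase
  -- Nν, so any plane wave arises as a limit of ρ² u w. Second-order convergence is needed since the
  -- identity contains the Laplacian.
  have hwave : ∀ θ : Euc n, ∫ x in Ω, (F x * A₀ x * wave (osc θ) x
      + ∑ i, F x * A i x * partialDeriv i (wave (osc θ)) x + F x * lap (wave (osc θ)) x) = 0 := by
    intro θ
    obtain ⟨ν, hν, hνθ, hν0⟩ := exists_null_orthogonal hij hik hjk θ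
    set a := wave (osc θ)
    have ha : ContDiff ℝ ∞ a := contDiff_wave _
    obtain ⟨r, hr, hsol, hr0, hr1, hr2⟩ := exists_cgo_sequence i ho hb hρ hρ0 hγρ ha
      (ζ := fun N i => (N : ℂ) * ν i)
      (fun N => by
        rw [show ∑ i, (N : ℂ) * ν i * ((N : ℂ) * ν i) = (N : ℂ) ^ 2 * ∑ i, ν i * ν i by
          rw [Finset.mul_sum]; exact Finset.sum_congr rfl fun i _ => by ring, hν, mul_zero])
      (fun N x => by
        simp only [a, partialDeriv_wave]
        rw [show ∑ i, (N : ℂ) * ν i * (osc θ i * wave (osc θ) x)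
          = (N : ℂ) * I * wave (osc θ) x * ∑ i, ν i * (θ i : ℂ) by
            rw [Finset.mul_sum]; exact Finset.sum_congr rfl fun i _ => by rw [osc]; ring, hνθ,
          mul_zero])
      ((tendsto_natCast_mul_reVec hν0).congr fun N => (reVec_natCast_mul ν N).symm)
    obtain ⟨r', hr', hsol', hr0', hr1', hr2'⟩ := exists_cgo_sequence i ho hb hρ hρ0 hγρ
      (contDiff_const (c := (1 : ℂ))) (ζ := fun N i => -((N : ℂ) * ν i))
      (fun N => by
        rw [show ∑ i, -((N : ℂ) * ν i) * -((N : ℂ) * ν i) = (N : ℂ) ^ 2 * ∑ i, ν i * ν i by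
          rw [Finset.mul_sum]; exact Finset.sum_congr rfl fun i _ => by ring, hν, mul_zero])
      (fun N x => by simp [partialDeriv_const])
      ((tendsto_natCast_mul_reVec hν0).congr fun N => (reVec_neg_natCast_mul ν N).symm)
    set g : ℕ → Euc n → ℂ := fun N x => (a x + r N x) * (1 + r' N x) with hg
    have hs1 : ∀ N, ContDiff ℝ ∞ fun x => a x + r N x := fun N => ha.add (hr N)
    have hs2 : ∀ N, ContDiff ℝ ∞ fun x => (1 : ℂ) + r' N x := fun N => contDiff_const.add (hr' N)
    have hgs : ∀ N, ContDiff ℝ ∞ (g N) := fun N => (hs1 N).mul (hs2 N)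
    have hd : ∀ N i, partialDeriv i (fun x => a x + r N x)
        = fun x => partialDeriv i a x + partialDeriv i (r N) x := fun N i => funext fun x =>
      partialDeriv_add ha.differentiableAt_infty (hr N).differentiableAt_infty i
    have hd' : ∀ N i, partialDeriv i (fun x => 1 + r' N x) = partialDeriv i (r' N) := fun N i =>
      funext fun x => by
        rw [partialDeriv_add (contDiff_const (c := (1 : ℂ))).differentiableAt_infty
          (hr' N).differentiableAt_infty, partialDeriv_const, zero_add]
    have hg1 : ∀ N i, partialDeriv i (g N) = fun x =>
        (partialDeriv i a x + partialDeriv i (r N) x) * (1 + r' N x)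
          + (a x + r N x) * partialDeriv i (r' N) x := fun N i => funext fun x => by
      rw [hg]
      simp only
      rw [partialDeriv_mul (hs1 N).differentiableAt_infty (hs2 N).differentiableAt_infty, hd, hd']
    have hg2 : ∀ N i x, partialDeriv i (partialDeriv i (g N)) x =
        (partialDeriv i (partialDeriv i a) x + partialDeriv i (partialDeriv i (r N)) x)
            * (1 + r' N x)
          + (partialDeriv i a x + partialDeriv i (r N) x) * partialDeriv i (r' N) x
          + ((partialDeriv i a x + partialDeriv i (r N) x) * partialDeriv i (r' N) x
            + (a x + r N x) * partialDeriv i (partialDeriv i (r' N)) x) := fun N i x => by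
      have h1 := (contDiff_partialDeriv ha i)
      have h2 := (contDiff_partialDeriv (hr N) i)
      have h3 := (contDiff_partialDeriv (hr' N) i)
      rw [hg1, partialDeriv_add ((h1.add h2).mul (hs2 N)).differentiableAt_infty
        ((hs1 N).mul h3).differentiableAt_infty,
        partialDeriv_mul (h1.add h2).differentiableAt_infty (hs2 N).differentiableAt_infty,
        partialDeriv_mul (hs1 N).differentiableAt_infty h3.differentiableAt_infty,
        partialDeriv_add h1.differentiableAt_infty h2.differentiableAt_infty, hd, hd']
    have ca := BddConv.const_smooth hb ha
    have c1 : BddConv Ω (fun N x => (1 : ℂ) + r' N x) (fun x => 1 + 0) :=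
      (BddConv.const_smooth hb contDiff_const).add hr0'
    have cs := ca.add hr0
    have cd := fun i => (BddConv.const_smooth hb (contDiff_partialDeriv ha i)).add (hr1 i)
    have cdd := fun i => (BddConv.const_smooth hb
      (contDiff_partialDeriv (contDiff_partialDeriv ha i) i)).add (hr2 i i)
    have cg : BddConv Ω g a := (cs.mul c1).congr (Eventually.of_forall fun N x _ => rfl)
      (fun x _ => by simp)
    have cg1 : ∀ i, BddConv Ω (fun N => partialDeriv i (g N)) (partialDeriv i a) := fun i =>
      (((cd i).mul c1).add (cs.mul (hr1' i))).congr
        (Eventually.of_forall fun N x _ => by rw [hg1]) (fun x _ => by simp)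
    have cg2 : BddConv Ω (fun N => lap (g N)) (lap a) :=
      (BddConv.sum fun i => (((cdd i).mul c1).add ((cd i).mul (hr1' i))).add
        (((cd i).mul (hr1' i)).add (cs.mul (hr2' i i)))).congr
        (Eventually.of_forall fun N x _ => by simp only [lap, hg2])
        (fun x _ => by simp [lap])
    have cF := BddConv.const hb hFc
    refine BddConv.integral_eq_zero ho hb (((cF.mul (BddConv.const_smooth hb hA₀s)).mul cg).add
      (BddConv.sum fun i => (cF.mul (BddConv.const_smooth hb (hAs i))).mul (cg1 i)) |>.add
      (cF.mul cg2)) ?_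
    filter_upwards [hsol, hsol'] with N h1 h2
    have hu := contDiff_cgo hρ hρ0 (hs1 N) (fun i => (N : ℂ) * ν i)
    have hw := contDiff_cgo hρ hρ0 (hs2 N) (fun i => -((N : ℂ) * ν i))
    have key := h _ _ hu hw h1 h2
    have key2 := congrArg (fun z => 2 * z) key
    simp only [mul_zero] at key2
    rw [← key2, ← integral_const_mul]
    refine setIntegral_congr_fun ho.measurableSet fun x hx => ?_
    have e1 := two_mul_gradDot ho hP (fun x hx => hγρ x hx) hu hw h1 h2 hx
    have e2 : (fun z => cgo ρ (fun i => (N : ℂ) * ν i) (fun x => a x + r N x) z *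
        cgo ρ (fun i => -((N : ℂ) * ν i)) (fun x => 1 + r' N x) z) = fun z => (P z)⁻¹ * g N z := by
      ext z
      have hw : wave (fun i => (N : ℂ) * ν i) z * wave (fun i => -((N : ℂ) * ν i)) z = 1 := by
        rw [← wave_add, ← wave_zero z]
        congr 1
        ext i; simp
      simp only [cgo, hPdef, hg, mul_inv]
      linear_combination ((ρ z)⁻¹ * (ρ z)⁻¹ * (a z + r N z) * (1 + r' N z)) * hw
    rw [e2, sum_partialDeriv_inv_mul hP hP0 (hgs N)] at e1
    have e3 : gradDot (cgo ρ (fun i => (N : ℂ) * ν i) (fun x => a x + r N x))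
        (cgo ρ (fun i => -((N : ℂ) * ν i)) (fun x => 1 + r' N x)) x * 2 = (P x)⁻¹ *
        (A₀ x * g N x + ∑ i, A i x * partialDeriv i (g N) x + lap (g N) x) := by
      rw [hA₀, hA]
      rw [← e1]
      rw [mul_comm (2 : ℂ) (P x), mul_assoc, inv_mul_cancel_left₀ (hP0 x), mul_comm]
    have e4 : ∑ i, F x * A i x * partialDeriv i (g N) x
        = F x * ∑ i, A i x * partialDeriv i (g N) x := by
      rw [Finset.mul_sum]
      exact Finset.sum_congr rfl fun i _ => mul_assoc _ _ _
    simp only [e4]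
    have e5 : F x = f x * (P x)⁻¹ := rfl
    rw [e5]
    linear_combination (-(f x)) * e3
  have hall : ∀ φ : Euc n → ℂ, ContDiff ℝ ∞ φ → ∫ x in Ω, F x * (∑ i, partialDeriv i
      (fun y => P y * partialDeriv i (fun z => (P z)⁻¹ * φ z) y) x) = 0 := fun φ hφ => by
    rw [← integral_eq_zero_of_wave ho hb i (hFc.mul hA₀s.continuous.continuousOn) hFc
      (fun i => hFc.mul (hAs i).continuous.continuousOn) (fun θ _ => hwave θ) hφ]
    congr 1
    ext x
    rw [sum_partialDeriv_inv_mul hP hP0 hφ, mul_add, mul_add, Finset.mul_sum, ← mul_assoc]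
    congr 2
    exact Finset.sum_congr rfl fun i _ => (mul_assoc _ _ _).symm
  obtain ⟨ν, hν, -, hν0⟩ := exists_null_orthogonal hij hik hjk (0 : Euc n)
  -- With φ = ρv the operator becomes ρΔv - vΔρ, and v is chosen to make this equal to ρg for a
  -- prescribed g. No boundary data enter.
  have hgg : ∀ g : Euc n → ℂ, ContDiff ℝ ∞ g → ∫ x in Ω, g x * (F x * ρ x) = 0 := by
    intro g hg
    obtain ⟨v, hv, hveq⟩ := exists_schroedinger_solution (Ω := Ω) i hb hρ hρ0 hν hν0 hg
    rw [← hall (fun x => ρ x * v x) (hρ.mul hv)]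
    refine setIntegral_congr_fun ho.measurableSet fun x hx => ?_
    have e : (fun z => (P z)⁻¹ * (ρ z * v z)) = fun z => (ρ z)⁻¹ * v z := by
      ext z
      rw [hPdef]
      field_simp [hρ0 z]
    simp only [e]
    rw [sum_partialDeriv_conductivity (γ := P) ho hρ hρ0 (fun _ _ => rfl) hv hx, hveq x hx]
    ring
  have hz := eq_zero_of_integral_wave_eq_zero ho hb (hFc.mul hρ.continuous.continuousOn) i
    (fun θ _ => hgg _ (contDiff_wave _))
  intro x hx
  have := hz x hx
  simpa [hF, hP0 x, hρ0 x] using this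

end RankZero

end Conductivity

namespace Conductivity

open Complex MeasureTheory Filter Topology

variable {n : ℕ}

/-! ### A first-order identity with restricted amplitudes -/

section FirstOrder

variable {Ω : Set (Euc n)}

/-- Passing to the limit in a first order identity tested on `wave (osc θ - ζ N)` times a complex
geometric optics solution with phase `ζ N`. -/
lemma integral_first_order_limit (i₀ : Fin n) (ho : IsOpen Ω) (hb : Bornology.IsBounded Ω)
    {γ₀ : Euc n → ℝ} {ρ : Euc n → ℂ}
    (hρ : ContDiff ℝ ∞ ρ) (hρ0 : ∀ x, ρ x ≠ 0) (hγρ : ∀ x ∈ Ω, (γ₀ x : ℂ) = ρ x * ρ x)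
    {G : Fin n → Euc n → ℂ} (hG : ∀ i, ContinuousOn (G i) (closure Ω))
    {ζ : ℕ → Fin n → ℂ} (hζ : ∀ N, ∑ i, ζ N i * ζ N i = 0)
    (hlim : Tendsto (fun N => ‖reVec (ζ N)‖) atTop atTop) (θ : Euc n)
    (h : ∀ N, ∀ u : Euc n → ℂ, ContDiff ℝ ∞ u → IsSolution Ω γ₀ u →
      ∫ x in Ω, wave (fun i => osc θ i - ζ N i) x * ∑ i, G i x * partialDeriv i u x = 0)
    {l : ℕ → ℂ} {L : ℂ} (hl : Tendsto l atTop (𝓝 L)) {e : Euc n → ℂ}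
    (he : BddConv Ω (fun N x => l N * ∑ i, ζ N i * G i x) e) :
    ∫ x in Ω, wave (osc θ) x * ((ρ x)⁻¹ * e x
      + L * ∑ i, G i x * partialDeriv i (fun y => (ρ y)⁻¹) x) = 0 := by
  obtain ⟨r, hr, hsol, hr0, hr1, -⟩ := exists_cgo_sequence i₀ ho hb hρ hρ0 hγρ
    (contDiff_const (c := (1 : ℂ))) hζ (fun N x => by simp [partialDeriv_const]) hlim
  have hσ := contDiff_fun_inv hρ hρ0
  have hs : BddConv Ω (fun N x => (1 : ℂ) + r N x) (fun x => 1 + 0) :=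
    (BddConv.const_smooth hb contDiff_const).add hr0
  have hσc := BddConv.const_smooth hb hσ
  have hlc := BddConv.scalar (Ω := Ω) hl
  have hGc := fun i => BddConv.const hb (hG i)
  have htot := (BddConv.const_smooth hb (contDiff_wave (osc θ))).mul
    ((((hσc.mul he).add (hlc.mul (BddConv.sum fun i => (hGc i).mul
      (BddConv.const_smooth hb (contDiff_partialDeriv hσ i))))).mul hs).add
      (hlc.mul (hσc.mul (BddConv.sum fun i => (hGc i).mul (hr1 i)))))
  have hres := htot.integral_eq_zero ho hb (by
    filter_upwards [hsol] with N h1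
    have hsm : ContDiff ℝ ∞ fun x => (1 : ℂ) + r N x := contDiff_const.add (hr N)
    have key := h N _ (contDiff_cgo hρ hρ0 hsm _) h1
    have key2 := congrArg (fun z => l N * z) key
    simp only [mul_zero] at key2
    rw [← key2, ← integral_const_mul]
    congr 1
    ext x
    have hd : ∀ i, partialDeriv i (fun x => 1 + r N x) x = partialDeriv i (r N) x := fun i => by
      rw [partialDeriv_add (contDiff_const (c := (1 : ℂ))).differentiableAt_infty
        (hr N).differentiableAt_infty, partialDeriv_const, zero_add]
    have hw : wave (fun i => osc θ i - ζ N i) x * wave (ζ N) x = wave (osc θ) x := by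
      rw [← wave_add]
      congr 1
      ext i; simp
    simp only [partialDeriv_cgo hρ hρ0 hsm, hd]
    have hsum : ∑ i, G i x * (wave (ζ N) x * ((ζ N i * (ρ x)⁻¹ +
        partialDeriv i (fun y => (ρ y)⁻¹) x) * (1 + r N x) + (ρ x)⁻¹ * partialDeriv i (r N) x))
        = wave (ζ N) x * (((ρ x)⁻¹ * ∑ i, ζ N i * G i x + ∑ i, G i x *
          partialDeriv i (fun y => (ρ y)⁻¹) x) * (1 + r N x) +
          (ρ x)⁻¹ * ∑ i, G i x * partialDeriv i (r N) x) := by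
      rw [Finset.mul_sum, Finset.mul_sum, ← Finset.sum_add_distrib, Finset.sum_mul,
        ← Finset.sum_add_distrib, Finset.mul_sum]
      exact Finset.sum_congr rfl fun i _ => by ring
    rw [hsum, ← hw]
    ring)
  rw [← hres]
  congr 1
  ext x
  simp

/-- A vector field that is orthogonal to all products of a gradient of a solution with a function
annihilated by `∂_a + i ∂_b` vanishes. -/
theorem eq_zero_of_integral_first_order {a b : Fin n} (hab : a ≠ b) (hn : 3 ≤ n)
    (ho : IsOpen Ω) (hb : Bornology.IsBounded Ω) {γ₀ : Euc n → ℝ} {ρ : Euc n → ℂ}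
    (hρ : ContDiff ℝ ∞ ρ) (hρ0 : ∀ x, ρ x ≠ 0) (hγρ : ∀ x ∈ Ω, (γ₀ x : ℂ) = ρ x * ρ x)
    {G : Fin n → Euc n → ℂ} (hG : ∀ i, ContinuousOn (G i) (closure Ω))
    (h : ∀ A u : Euc n → ℂ, ContDiff ℝ ∞ A →
      (∀ x, partialDeriv a A x + I * partialDeriv b A x = 0) → ContDiff ℝ ∞ u → IsSolution Ω γ₀ u →
      ∫ x in Ω, A x * ∑ i, G i x * partialDeriv i u x = 0) :
    ∀ i, ∀ x ∈ Ω, G i x = 0 := by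
  have hσ := contDiff_fun_inv hρ hρ0
  -- Chosen so that 2t = i(θ_a + iθ_b), the factor by which ∂_a + i∂_b acts on e^{iθ·x}. It is
  -- nonzero off the hyperplane θ_a = 0.
  set t : Euc n → ℂ := fun θ => I / 2 * ((θ a : ℂ) + I * θ b) with ht
  have ht0 : ∀ θ : Euc n, θ a ≠ 0 → t θ ≠ 0 := fun θ hθ h0 => by
    have h1 : ((θ a : ℂ) + I * θ b) = 0 := by
      rcases mul_eq_zero.1 h0 with h2 | h2
      · simp at h2
      · exact h2
    exact hθ (by simpa using congrArg re h1)
  -- Two conditions fix ζ. The equality ζ_a + iζ_b = 2t makes A = e^{(iθ-ζ)·x} admissible, and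
  -- nullity follows from (t-s)² - (s+t)² + 4N² = 0 for s = N²/t. The product A e^{ζ·x} is the
  -- bounded wave e^{iθ·x}, while ζ·G has parts of orders N², N and 1.
  set ζ : Fin n → Euc n → ℕ → Fin n → ℂ := fun c θ N =>
    vec3 a b c (t θ - (N : ℂ) ^ 2 / t θ) (-I * ((N : ℂ) ^ 2 / t θ + t θ)) (2 * N) with hζdef
  have hcore : ∀ c, c ≠ a → c ≠ b → ∀ θ : Euc n, θ a ≠ 0 → ∀ {l : ℕ → ℂ} {L : ℂ},
      Tendsto l atTop (𝓝 L) → ∀ {e : Euc n → ℂ},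
      BddConv Ω (fun N x => l N * (-((N : ℂ) ^ 2 / t θ) * (G a x + I * G b x)
        + t θ * (G a x - I * G b x) + 2 * N * G c x)) e →
      ∫ x in Ω, wave (osc θ) x * ((ρ x)⁻¹ * e x
        + L * ∑ i, G i x * partialDeriv i (fun y => (ρ y)⁻¹) x) = 0 := by
    intro c hca hcb θ hθ l L hl e he
    have htθ := ht0 θ hθ
    have hnull : ∀ N, ∑ i, ζ c θ N i * ζ c θ N i = 0 := fun N => by
      simp only [hζdef]
      rw [sum_vec3_sq hab hca.symm hcb.symm]
      have h1 : (N : ℂ) ^ 2 / t θ * t θ = (N : ℂ) ^ 2 := div_mul_cancel₀ _ htθ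
      linear_combination ((N : ℂ) ^ 2 / t θ + t θ) ^ 2 * I_mul_I - 4 * h1
    have hzc : ∀ N, ζ c θ N c = 2 * N := fun N => by simp [hζdef, vec3, hca, hcb]
    have hza : ∀ N, ζ c θ N a = t θ - (N : ℂ) ^ 2 / t θ := fun N => by simp [hζdef, vec3]
    have hzb : ∀ N, ζ c θ N b = -I * ((N : ℂ) ^ 2 / t θ + t θ) := fun N => by
      simp [hζdef, vec3, hab.symm]
    refine integral_first_order_limit a ho hb hρ hρ0 hγρ hG hnull ?_ θ ?_ hl ?_
    · refine tendsto_atTop_mono (fun N => ?_) tendsto_natCast_atTop_atTop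
      have := norm_le_norm_reVec (hnull N) c
      rw [hzc, norm_mul] at this
      simp at this
      exact this
    · intro N u hu hus
      refine h _ u (contDiff_wave _) (fun x => ?_) hu hus
      simp only [partialDeriv_wave, hza, hzb, osc, ht]
      linear_combination (((N : ℂ) ^ 2 / t θ + t θ) * wave (fun i => I * (θ i : ℂ) - ζ c θ N i) x)
        * I_mul_I
    · refine he.congr (Eventually.of_forall fun N x _ => ?_) fun _ _ => rfl
      simp only [hζdef]
      rw [sum_vec3_mul hab hca.symm hcb.symm]
      ring
  have hNi := tendsto_inv_natCast_complex
  have cG := fun i => BddConv.const hb (hG i)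
  have cK : ∀ z : ℂ, BddConv Ω (fun _ _ => z) (fun _ => z) := fun z =>
    BddConv.scalar tendsto_const_nhds
  obtain ⟨c₀, hc₀a, hc₀b⟩ : ∃ c : Fin n, c ≠ a ∧ c ≠ b := by
    obtain ⟨c, -, hc⟩ := Finset.exists_mem_notMem_of_card_lt_card
      (s := {a, b}) (t := (Finset.univ : Finset (Fin n))) (by
        rw [Finset.card_univ, Fintype.card_fin]
        exact lt_of_le_of_lt Finset.card_le_two hn)
    simp at hc
    exact ⟨c, hc.1, hc.2⟩
  have hN0 : ∀ᶠ N : ℕ in atTop, (N : ℂ) ≠ 0 := by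
    filter_upwards [eventually_ge_atTop 1] with N hN
    exact_mod_cast (by omega : N ≠ 0)
  have hρc : ContinuousOn (fun x => (ρ x)⁻¹) (closure Ω) := hσ.continuous.continuousOn
  -- Order N²: rescaling by N⁻² isolates this combination.
  have hab0 : ∀ x ∈ Ω, G a x + I * G b x = 0 := by
    have := eq_zero_of_integral_wave_eq_zero ho hb
      (hρc.mul ((hG a).add (continuousOn_const.mul (hG b)))) (F := fun x => (ρ x)⁻¹ *
        (G a x + I * G b x)) a fun θ hθ => by
      have hl : Tendsto (fun N : ℕ => (N : ℂ)⁻¹ * (N : ℂ)⁻¹) atTop (𝓝 (0 * 0)) := hNi.mul hNi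
      have key := hcore c₀ hc₀a hc₀b θ hθ hl (e := fun x => -(t θ)⁻¹ * (G a x + I * G b x)) ?_
      · have e : ∀ x, wave (osc θ) x * ((ρ x)⁻¹ * (-(t θ)⁻¹ * (G a x + I * G b x)) + 0 * 0 *
            ∑ i, G i x * partialDeriv i (fun y => (ρ y)⁻¹) x)
            = -(t θ)⁻¹ * (wave (osc θ) x * ((ρ x)⁻¹ * (G a x + I * G b x))) := fun x => by ring
        simp only [e] at key
        rw [integral_const_mul] at key
        exact (mul_eq_zero.1 key).resolve_left (neg_ne_zero.2 (inv_ne_zero (ht0 θ hθ)))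
      · refine (((cK (-(t θ)⁻¹)).mul ((cG a).add ((cK I).mul (cG b)))).add
          ((((BddConv.scalar hNi).mul (BddConv.scalar hNi)).mul ((cK (t θ)).mul
            ((cG a).add ((cK (-I)).mul (cG b))))).add
            ((cK 2).mul ((BddConv.scalar hNi).mul (cG c₀))))).congr ?_ fun x _ => by simp
        have htθ := ht0 θ hθ
        filter_upwards [hN0] with N hN x _
        field_simp
        ring
    intro x hx
    exact (mul_eq_zero.1 (this x hx)).resolve_left (inv_ne_zero (hρ0 x))
  -- Order N: the quadratic term is now gone, so rescaling by N⁻¹ isolates G_c.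
  have hc0 : ∀ c, c ≠ a → c ≠ b → ∀ x ∈ Ω, G c x = 0 := by
    intro c hca hcb
    have := eq_zero_of_integral_wave_eq_zero ho hb
      (hρc.mul (hG c)) (F := fun x => (ρ x)⁻¹ * G c x) a fun θ hθ => by
      have key := hcore c hca hcb θ hθ hNi (e := fun x => 2 * G c x) ?_
      · have e : ∀ x, wave (osc θ) x * ((ρ x)⁻¹ * (2 * G c x) + 0 *
            ∑ i, G i x * partialDeriv i (fun y => (ρ y)⁻¹) x)
            = 2 * (wave (osc θ) x * ((ρ x)⁻¹ * G c x)) := fun x => by ring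
        simp only [e] at key
        rw [integral_const_mul] at key
        exact (mul_eq_zero.1 key).resolve_left two_ne_zero
      · refine (((cK 2).mul (cG c)).add ((BddConv.scalar hNi).mul ((cK (t θ)).mul
            ((cG a).add ((cK (-I)).mul (cG b)))))).congr ?_ fun x _ => by simp
        have htθ := ht0 θ hθ
        filter_upwards [hN0] with N hN x hx
        rw [hab0 x hx]
        field_simp
        ring
    intro x hx
    exact (mul_eq_zero.1 (this x hx)).resolve_left (inv_ne_zero (hρ0 x))
  have hGb : ∀ x ∈ Ω, G b x = I * G a x := fun x hx => by
    linear_combination (-I) * hab0 x hx + G b x * I_mul_I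
  have hsum2 : ∀ f : Fin n → ℂ, (∀ i, i ≠ a → i ≠ b → f i = 0) → ∑ i, f i = f a + f b :=
    fun f hf => by
      rw [← Finset.sum_pair hab]
      refine (Finset.sum_subset (Finset.subset_univ _) fun i _ hi => ?_).symm
      simp at hi
      exact hf i hi.1 hi.2
  set c₁ : Fin n → Euc n → ℂ := fun i x => vec3 a b c₀ 1 I 0 i * ((ρ x)⁻¹ * G a x) with hc₁
  have hc₁s : ∀ (x : Euc n) (f : Fin n → ℂ), ∑ i, c₁ i x * f i
      = (ρ x)⁻¹ * G a x * (f a + I * f b) := fun x f => by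
    have : ∀ i, c₁ i x * f i = vec3 a b c₀ 1 I 0 i * ((ρ x)⁻¹ * G a x * f i) := fun i => by
      simp only [hc₁]; ring
    rw [Finset.sum_congr rfl fun i _ => this i, sum_vec3_mul hab hc₀a.symm hc₀b.symm]
    ring
  have hDσ := (contDiff_partialDeriv hσ a).add
    ((contDiff_const (c := I)).mul (contDiff_partialDeriv hσ b))
  -- Order 1: what remains is ∫ G_a (∂_a + i∂_b)(ρ⁻¹φ) = 0 for plane waves φ, since 2t φ = (∂_a +
  -- i∂_b)φ, and it extends to all smooth φ.
  have hφ := fun φ (hφ : ContDiff ℝ ∞ φ) => integral_eq_zero_of_wave ho hb a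
    (c₀ := fun x => G a x * (partialDeriv a (fun y => (ρ y)⁻¹) x
      + I * partialDeriv b (fun y => (ρ y)⁻¹) x)) (d := fun _ => 0) (c := c₁)
    ((hG a).mul hDσ.continuous.continuousOn) continuousOn_const
    (fun i => continuousOn_const.mul (hρc.mul (hG a)))
    (fun θ hθ => by
      refine Eq.trans ?_ (hcore c₀ hc₀a hc₀b θ hθ (l := fun _ => 1) tendsto_const_nhds
        (e := fun x => 2 * t θ * G a x) (((cK (2 * t θ)).mul (cG a)).congr
          (Eventually.of_forall fun N x hx => by
            rw [hab0 x hx, hc0 c₀ hc₀a hc₀b x hx, hGb x hx]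
            linear_combination (t θ * G a x) * I_mul_I) fun _ _ => rfl))
      refine setIntegral_congr_fun ho.measurableSet fun x hx => ?_
      simp only [hc₁s, partialDeriv_wave]
      rw [hsum2 (fun i => G i x * partialDeriv i (fun y => (ρ y)⁻¹) x)
        fun i h1 h2 => by rw [hc0 i h1 h2 x hx, zero_mul], hGb x hx]
      simp only [osc, ht]
      ring) hφ
  have hGa : ∀ x ∈ Ω, G a x = 0 := by
    refine eq_zero_of_integral_wave_eq_zero ho hb (hG a) a fun θ hθ => ?_
    -- This φ cancels the weight ρ⁻¹, leaving 2t times the Fourier integral of G_a.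
    have key := hφ (fun x => ρ x * wave (osc θ) x) (hρ.mul (contDiff_wave _))
    have hD : ∀ i x, partialDeriv i (fun x => ρ x * wave (osc θ) x) x
        = partialDeriv i ρ x * wave (osc θ) x + ρ x * (osc θ i * wave (osc θ) x) := fun i x => by
      rw [partialDeriv_mul hρ.differentiableAt_infty (contDiff_wave _).differentiableAt_infty,
        partialDeriv_wave]
    have e : ∀ x, G a x * (partialDeriv a (fun y => (ρ y)⁻¹) x
        + I * partialDeriv b (fun y => (ρ y)⁻¹) x) * (ρ x * wave (osc θ) x)
        + ∑ i, c₁ i x * partialDeriv i (fun x => ρ x * wave (osc θ) x) x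
        + 0 * lap (fun x => ρ x * wave (osc θ) x) x
        = 2 * t θ * (wave (osc θ) x * G a x) := fun x => by
      have e1 : ∀ i, partialDeriv i ρ x = -(ρ x * ρ x * partialDeriv i (fun y => (ρ y)⁻¹) x) :=
        fun i => by rw [partialDeriv_inv hρ hρ0, neg_neg]
      have e2 : (ρ x)⁻¹ * ρ x = 1 := inv_mul_cancel₀ (hρ0 x)
      rw [hc₁s, hD, hD, e1, e1]
      simp only [osc, ht]
      linear_combination (G a x * wave (osc θ) x * (-(ρ x) *
        (partialDeriv a (fun y => (ρ y)⁻¹) x + I * partialDeriv b (fun y => (ρ y)⁻¹) x)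
        + I * (θ a + I * θ b))) * e2
    simp only [e] at key
    rw [integral_const_mul] at key
    exact (mul_eq_zero.1 key).resolve_left (mul_ne_zero two_ne_zero (ht0 θ hθ))
  intro i x hx
  by_cases h1 : i = a
  · rw [h1, hGa x hx]
  by_cases h2 : i = b
  · rw [h2, hGb x hx, hGa x hx, mul_zero]
  exact hc0 i h1 h2 x hx

end FirstOrder

end Conductivity

namespace Conductivity

open Complex MeasureTheory Filter Topology

variable {n : ℕ}

/-! ### Pointwise values of gradients of solutions -/

section Gradients

variable {Ω : Set (Euc n)}

/-- The null vector `e_a + i e_b`. -/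
noncomputable def nullVec (a b : Fin n) : Fin n → ℂ := Pi.single a 1 + I • Pi.single b 1

lemma sum_nullVec_mul (a b : Fin n) (f : Fin n → ℂ) : ∑ i, nullVec a b i * f i = f a + I * f b := by
  simp [nullVec, add_mul, Finset.sum_add_distrib, Pi.single_apply]

lemma sum_nullVec_sq {a b : Fin n} (hab : a ≠ b) : ∑ i, nullVec a b i * nullVec a b i = 0 := by
  rw [sum_nullVec_mul]
  simp [nullVec, hab, hab.symm]

lemma reVec_nullVec_ne_zero {a b : Fin n} (hab : a ≠ b) : reVec (nullVec a b) ≠ 0 :=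
  reVec_ne_zero (sum_nullVec_sq hab) (l := a) (by simp [nullVec, hab])

lemma single_eq_nullVec (a b : Fin n) :
    (Pi.single a 1 : Fin n → ℂ) = (1 / 2 : ℂ) • (nullVec a b - I • nullVec b a) := by
  rw [nullVec, nullVec, smul_add, smul_smul, I_mul_I]
  module

lemma isSolution_const (γ₀ : Euc n → ℝ) (c : ℂ) : IsSolution Ω γ₀ fun _ => c := fun x _ =>
  Finset.sum_eq_zero fun i _ => by
    rw [show (fun y => (γ₀ y : ℂ) * partialDeriv i (fun _ : Euc n => c) y) = fun _ => 0 from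
      funext fun y => by rw [partialDeriv_const, mul_zero], partialDeriv_const]

/-- The coefficient enters only through its germs at points of the open set Ω, so the globally
smooth P may replace γ₀. -/
lemma isSolution_iff (ho : IsOpen Ω) {γ₀ : Euc n → ℝ} {P : Euc n → ℂ}
    (hγP : ∀ x ∈ Ω, (γ₀ x : ℂ) = P x) (u : Euc n → ℂ) :
    IsSolution Ω γ₀ u ↔
      ∀ x ∈ Ω, ∑ i, partialDeriv i (fun y => P y * partialDeriv i u y) x = 0 := by
  refine forall₂_congr fun x hx => ?_
  rw [Finset.sum_congr rfl fun i _ => partialDeriv_congr ?_ i]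
  filter_upwards [ho.mem_nhds hx] with y hy
  rw [hγP y hy]

lemma isSolution_add_const_mul (ho : IsOpen Ω) {γ₀ : Euc n → ℝ} {P u w : Euc n → ℂ}
    (hP : ContDiff ℝ ∞ P) (hγP : ∀ x ∈ Ω, (γ₀ x : ℂ) = P x) (hu : ContDiff ℝ ∞ u)
    (hw : ContDiff ℝ ∞ w) (hus : IsSolution Ω γ₀ u) (hws : IsSolution Ω γ₀ w) (c : ℂ) :
    IsSolution Ω γ₀ fun x => u x + c * w x := by
  rw [isSolution_iff ho hγP] at *
  intro x hx
  have hi : ∀ i, partialDeriv i (fun y => P y * partialDeriv i (fun z => u z + c * w z) y) x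
      = partialDeriv i (fun y => P y * partialDeriv i u y) x
        + c * partialDeriv i (fun y => P y * partialDeriv i w y) x := fun i => by
    have h1 := hP.mul (contDiff_partialDeriv hu i)
    have h2 := hP.mul (contDiff_partialDeriv hw i)
    rw [← partialDeriv_const_mul h2.differentiableAt_infty,
      ← partialDeriv_add h1.differentiableAt_infty
        ((contDiff_const (c := c)).mul h2).differentiableAt_infty]
    congr 1
    ext y
    rw [partialDeriv_add hu.differentiableAt_infty
      ((contDiff_const (c := c)).mul hw).differentiableAt_infty,
      partialDeriv_const_mul hw.differentiableAt_infty]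
    ring
  rw [Finset.sum_congr rfl fun i _ => hi i, Finset.sum_add_distrib, ← Finset.mul_sum, hus x hx,
    hws x hx, mul_zero, add_zero]

/-- Gradients of solutions attain every value at every point. -/
theorem exists_solution_gradient (hn : 3 ≤ n) (ho : IsOpen Ω) (hb : Bornology.IsBounded Ω)
    {γ₀ : Euc n → ℝ} {ρ : Euc n → ℂ} (hρ : ContDiff ℝ ∞ ρ) (hρ0 : ∀ x, ρ x ≠ 0)
    (hγρ : ∀ x ∈ Ω, (γ₀ x : ℂ) = ρ x * ρ x) {x : Euc n} (hx : x ∈ Ω) (p : Fin n → ℂ) :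
    ∃ u : Euc n → ℂ, ContDiff ℝ ∞ u ∧ IsSolution Ω γ₀ u ∧ ∀ i, partialDeriv i u x = p i := by
  have hlin : ∀ (u w : Euc n → ℂ) (c : ℂ), ContDiff ℝ ∞ u → ContDiff ℝ ∞ w → ∀ i,
      partialDeriv i (fun y => u y + c * w y) x
        = partialDeriv i u x + c * partialDeriv i w x := fun u w c hu hw i => by
    rw [partialDeriv_add hu.differentiableAt_infty
      ((contDiff_const (c := c)).mul hw).differentiableAt_infty,
      partialDeriv_const_mul hw.differentiableAt_infty]
  let S : Submodule ℂ (Fin n → ℂ) :=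
    { carrier := {p | ∃ u : Euc n → ℂ, ContDiff ℝ ∞ u ∧ IsSolution Ω γ₀ u ∧
        ∀ i, partialDeriv i u x = p i}
      add_mem' := by
        rintro p q ⟨u, hu, hus, hup⟩ ⟨w, hw, hws, hwq⟩
        refine ⟨fun y => u y + 1 * w y, hu.add (contDiff_const.mul hw),
          isSolution_add_const_mul ho (hρ.mul hρ) hγρ hu hw hus hws 1, fun i => ?_⟩
        rw [hlin u w 1 hu hw, hup, hwq, one_mul, Pi.add_apply]
      zero_mem' := ⟨fun _ => 0, contDiff_const, isSolution_const _ _,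
        fun i => by rw [partialDeriv_const]; rfl⟩
      smul_mem' := by
        rintro c p ⟨u, hu, hus, hup⟩
        refine ⟨fun y => (0 : ℂ) + c * u y, contDiff_const.add (contDiff_const.mul hu),
          isSolution_add_const_mul ho (hρ.mul hρ) hγρ contDiff_const hu (isSolution_const _ _)
            hus c, fun i => ?_⟩
        rw [hlin _ u c contDiff_const hu, hup, partialDeriv_const, zero_add, Pi.smul_apply,
          smul_eq_mul] }
  -- Attainable gradients form a finite-dimensional, hence closed, subspace, so it is enough to
  -- approximate. Normalized gradients of optics solutions tend to ρ⁻¹ν, and the null vectors e_a +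
  -- i e_b span.
  have hclosed : IsClosed (S : Set (Fin n → ℂ)) := S.closed_of_finiteDimensional
  have hnull : ∀ a b : Fin n, a ≠ b → nullVec a b ∈ S := by
    intro a b hab
    have hνν := sum_nullVec_sq hab
    have hν0 := reVec_nullVec_ne_zero hab
    set ν := nullVec a b
    obtain ⟨r, hr, hsol, hr0, hr1, -⟩ := exists_cgo_sequence a ho hb hρ hρ0 hγρ
      (contDiff_const (c := (1 : ℂ))) (ζ := fun N i => (N : ℂ) * ν i)
      (fun N => by
        rw [show ∑ i, (N : ℂ) * ν i * ((N : ℂ) * ν i) = (N : ℂ) ^ 2 * ∑ i, ν i * ν i by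
          rw [Finset.mul_sum]; exact Finset.sum_congr rfl fun i _ => by ring, hνν, mul_zero])
      (fun N x => by simp [partialDeriv_const])
      ((tendsto_natCast_mul_reVec hν0).congr fun N => (reVec_natCast_mul ν N).symm)
    set q : ℕ → Fin n → ℂ := fun N i => (ν i * (ρ x)⁻¹ + (N : ℂ)⁻¹ *
      partialDeriv i (fun y => (ρ y)⁻¹) x) * (1 + r N x) + (N : ℂ)⁻¹ * ((ρ x)⁻¹ *
        partialDeriv i (r N) x) with hq
    have hlim : Tendsto q atTop (𝓝 ((ρ x)⁻¹ • ν)) := by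
      refine tendsto_pi_nhds.2 fun i => ?_
      have h1 := hr0.lim x hx
      have h2 := (hr1 i).lim x hx
      have h3 := tendsto_inv_natCast_complex
      have := (((tendsto_const_nhds (x := ν i * (ρ x)⁻¹)).add
        (h3.mul_const (partialDeriv i (fun y => (ρ y)⁻¹) x))).mul (h1.const_add 1)).add
        (h3.mul (h2.const_mul (ρ x)⁻¹))
      refine this.trans (le_of_eq ?_)
      simp [mul_comm]
    have hmem : (ρ x)⁻¹ • ν ∈ S := by
      refine hclosed.mem_of_tendsto hlim ?_
      filter_upwards [hsol, eventually_ge_atTop 1] with N h1 h3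
      have hN0 : (N : ℂ) ≠ 0 := by exact_mod_cast (by omega : N ≠ 0)
      have hsm : ContDiff ℝ ∞ fun x => (1 : ℂ) + r N x := contDiff_const.add (hr N)
      have hmem : (fun i => partialDeriv i (cgo ρ (fun i => (N : ℂ) * ν i)
          fun x => 1 + r N x) x) ∈ S := ⟨_, contDiff_cgo hρ hρ0 hsm _, h1, fun _ => rfl⟩
      have := S.smul_mem ((N : ℂ)⁻¹ * (wave (fun i => (N : ℂ) * ν i) x)⁻¹) hmem
      refine (congrArg (· ∈ S) (funext fun i => ?_)).mp this
      have hw := wave_ne_zero (fun i => (N : ℂ) * ν i) x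
      have hd : partialDeriv i (fun x => 1 + r N x) x = partialDeriv i (r N) x := by
        rw [partialDeriv_add (contDiff_const (c := (1 : ℂ))).differentiableAt_infty
          (hr N).differentiableAt_infty, partialDeriv_const, zero_add]
      rw [Pi.smul_apply, smul_eq_mul, partialDeriv_cgo hρ hρ0 hsm, hd, mul_assoc,
        inv_mul_cancel_left₀ hw]
      linear_combination (ν i * (ρ x)⁻¹ * (1 + r N x)) * inv_mul_cancel₀ hN0
    have := S.smul_mem (ρ x) hmem
    rwa [smul_smul, mul_inv_cancel₀ (hρ0 x), one_smul] at this
  have hsingle : ∀ a : Fin n, Pi.single a (1 : ℂ) ∈ S := fun a => by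
    obtain ⟨b, hab⟩ : ∃ b, a ≠ b := by
      have : Nontrivial (Fin n) := Fin.nontrivial_iff_two_le.2 (by omega)
      exact (exists_ne a).imp fun _ h => h.symm
    rw [single_eq_nullVec a b]
    exact S.smul_mem _ (S.sub_mem (hnull a b hab) (S.smul_mem I (hnull b a hab.symm)))
  have hp : p ∈ S := by
    rw [pi_eq_sum_univ' p]
    exact S.sum_mem fun i _ => S.smul_mem _ (by
      simpa [Pi.single_apply, eq_comm, Pi.single] using hsingle i)
  exact hp

end Gradients

end Conductivity

namespace Conductivity

open Complex MeasureTheory Filter Topology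

variable {n m : ℕ}

/-! ### Symmetric tensors, contraction and polarization -/

section Tensors

/-- The multilinear form with coefficients `T`. -/
noncomputable def form (T : (Fin m → Fin (n + 1)) → ℂ) :
    MultilinearMap ℂ (fun _ : Fin m => Fin (n + 1) → ℂ) ℂ :=
  ∑ j, T j • (MultilinearMap.mkPiAlgebra ℂ (Fin m) ℂ).compLinearMap fun k => LinearMap.proj (j k)

lemma form_apply (T : (Fin m → Fin (n + 1)) → ℂ) (J : Fin m → Fin (n + 1) → ℂ) :
    form T J = ∑ j, T j * ∏ k, J k (j k) := by
  simp [form]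

lemma form_single (T : (Fin m → Fin (n + 1)) → ℂ) (j : Fin m → Fin (n + 1)) :
    form T (fun k => Pi.single (j k) 1) = T j := by
  rw [form_apply, Finset.sum_eq_single j]
  · simp
  · intro j' _ hj
    obtain ⟨k, hk⟩ := Function.ne_iff.1 hj
    rw [Finset.prod_eq_zero (Finset.mem_univ k) (by simp [hk]), mul_zero]
  · simp

lemma form_comp_perm {T : (Fin m → Fin (n + 1)) → ℂ} (hT : IsSymmTensor T)
    (J : Fin m → Fin (n + 1) → ℂ) (τ : Equiv.Perm (Fin m)) :
    form T (fun k => J (τ k)) = form T J := by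
  rw [form_apply, form_apply]
  refine (Fintype.sum_equiv (τ.symm.arrowCongr (Equiv.refl _)) _ _ fun j => ?_).symm
  have e : (τ.symm.arrowCongr (Equiv.refl _)) j = j ∘ τ := rfl
  rw [e, hT τ j, ← Equiv.prod_comp τ]
  rfl

/-- A symmetric tensor is determined by its values on the diagonal. -/
lemma eq_zero_of_form_diagonal {T : (Fin m → Fin (n + 1)) → ℂ} (hT : IsSymmTensor T)
    (h : ∀ q : Fin (n + 1) → ℂ, form T (fun _ => q) = 0) (j : Fin m → Fin (n + 1)) : T j = 0 := by
  let f : ContinuousMultilinearMap ℂ (fun _ : Fin m => Fin (n + 1) → ℂ) ℂ :=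
    { form T with
      cont := by
        change Continuous fun J => form T J
        simp only [form_apply]
        fun_prop }
  -- Polarization: the m-th derivative of q ↦ T(q, …, q) is the sum over permutations, here m! times
  -- the component of T.
  have h1 := f.iteratedFDeriv_comp_diagonal 0 fun k => Pi.single (j k) 1
  have h2 : (fun q => f fun _ => q) = fun _ => 0 := funext h
  have h3 : ∀ σ : Equiv.Perm (Fin m), f (fun k => Pi.single (j (σ k)) 1) = T j := fun σ =>
    (form_single T (j ∘ σ)).trans (hT σ j)
  rw [h2, Finset.sum_congr rfl fun σ _ => h3 σ] at h1
  simp only [iteratedFDeriv_fun_zero] at h1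
  simpa [Fintype.card_perm, Nat.factorial_ne_zero] using h1.symm

/-- Contraction of the first index of `T` with the vector `q`. -/
def contract (T : (Fin (m + 1) → Fin (n + 1)) → ℂ) (q : Fin (n + 1) → ℂ) :
    (Fin m → Fin (n + 1)) → ℂ := fun j => ∑ i, q i * T (Fin.cons i j)

lemma form_cons (T : (Fin (m + 1) → Fin (n + 1)) → ℂ) (q : Fin (n + 1) → ℂ)
    (J : Fin m → Fin (n + 1) → ℂ) : form T (Fin.cons q J) = form (contract T q) J := by
  rw [form_apply, form_apply, ← (Fin.consEquiv fun _ => Fin (n + 1)).sum_comp,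
    Fintype.sum_prod_type_right]
  refine Finset.sum_congr rfl fun j _ => ?_
  rw [contract, Finset.sum_mul]
  refine Finset.sum_congr rfl fun i _ => ?_
  simp [Fin.consEquiv, Fin.prod_univ_succ]
  ring

lemma contract_single (T : (Fin (m + 1) → Fin (n + 1)) → ℂ) (i : Fin (n + 1))
    (j : Fin m → Fin (n + 1)) : contract T (Pi.single i 1) j = T (Fin.cons i j) := by
  simp [contract, Pi.single_apply]

lemma IsSymmTensor.contract {T : (Fin (m + 1) → Fin (n + 1)) → ℂ} (hT : IsSymmTensor T)
    (q : Fin (n + 1) → ℂ) : IsSymmTensor (contract T q) := fun σ j =>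
  Finset.sum_congr rfl fun i _ => by
    -- This permutation fixes the contracted index 0 and acts by σ on the others.
    rw [← hT (Equiv.Perm.decomposeFin.symm (0, σ)) (Fin.cons i j)]
    congr 2
    ext k
    refine Fin.cases ?_ (fun k => ?_) k <;> simp

/-- The functional `J ↦ ∑_l (c · ∇ part of J_l) T(J_0, …, omit J_l, …)`. -/
noncomputable def gradForm (T : (Fin m → Fin (n + 1)) → ℂ) (c : Fin n → ℂ) :
    MultilinearMap ℂ (fun _ : Fin (m + 1) => Fin (n + 1) → ℂ) ℂ :=
  ∑ l, LinearMap.uncurryMid l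
    ((∑ i, c i • LinearMap.proj (R := ℂ) (φ := fun _ : Fin (n + 1) => ℂ) i.succ).smulRight (form T))

lemma gradForm_apply (T : (Fin m → Fin (n + 1)) → ℂ) (c : Fin n → ℂ)
    (J : Fin (m + 1) → Fin (n + 1) → ℂ) :
    gradForm T c J = ∑ l, (∑ i, c i * J l i.succ) * form T fun k => J (l.succAbove k) := by
  simp [gradForm]
  rfl

/-- The head vector is either in the gradient slot or among the arguments of T, where it is the
first and can be contracted. Both uses rely on one factor dying: the gradient part of e_0 is 0, and
ν·ν = 0 for a null vector. -/
lemma gradForm_cons (T : (Fin (m + 1) → Fin (n + 1)) → ℂ) (c : Fin n → ℂ) (q : Fin (n + 1) → ℂ)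
    (J : Fin (m + 1) → Fin (n + 1) → ℂ) :
    gradForm T c (Fin.cons q J)
      = (∑ i, c i * q i.succ) * form T J + gradForm (contract T q) c J := by
  rw [gradForm_apply, gradForm_apply, Fin.sum_univ_succ]
  congr 1
  refine Finset.sum_congr rfl fun l _ => ?_
  rw [← form_cons]
  congr 2
  ext k
  refine Fin.cases ?_ (fun k => ?_) k <;> simp

lemma gradForm_eq_sum_left (T : (Fin m → Fin (n + 1)) → ℂ) (c : Fin n → ℂ)
    (J : Fin (m + 1) → Fin (n + 1) → ℂ) :
    gradForm T c J = ∑ j, c j * gradForm T (Pi.single j 1) J := by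
  simp only [gradForm_apply, Finset.mul_sum]
  rw [Finset.sum_comm]
  refine Finset.sum_congr rfl fun l _ => ?_
  rw [Finset.sum_mul]
  refine Finset.sum_congr rfl fun j _ => ?_
  simp [Pi.single_apply, mul_assoc]

lemma gradForm_eq_sum_head (T : (Fin m → Fin (n + 1)) → ℂ) (c : Fin n → ℂ) (q : Fin (n + 1) → ℂ)
    (J : Fin m → Fin (n + 1) → ℂ) :
    gradForm T c (Fin.cons q J) = ∑ i, q i * gradForm T c (Fin.cons (Pi.single i 1) J) := by
  have h : ∀ q, gradForm T c (Fin.cons q J) = (gradForm T c).curryLeft q J := fun _ => rfl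
  simp only [h]
  conv_lhs => rw [pi_eq_sum_univ' q]
  simp [map_sum]

lemma continuousOn_gradForm {X : Type*} [TopologicalSpace X] {s : Set X}
    {T : X → (Fin m → Fin (n + 1)) → ℂ} (hT : ∀ j, ContinuousOn (fun x => T x j) s) (c : Fin n → ℂ)
    {J : X → Fin (m + 1) → Fin (n + 1) → ℂ} (hJ : ∀ l i, ContinuousOn (fun x => J x l i) s) :
    ContinuousOn (fun x => gradForm (T x) c (J x)) s := by
  simp only [gradForm_apply, form_apply]
  exact continuousOn_finsetSum _ fun l _ => (continuousOn_finsetSum _ fun i _ =>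
    continuousOn_const.mul (hJ _ _)).mul (continuousOn_finsetSum _ fun j _ =>
      (hT j).mul (continuousOn_finsetProd _ fun k _ => hJ _ _))

lemma continuousOn_contract {X : Type*} [TopologicalSpace X] {s : Set X}
    {T : X → (Fin (m + 1) → Fin (n + 1)) → ℂ} (hT : ∀ j, ContinuousOn (fun x => T x j) s)
    (q : Fin (n + 1) → ℂ) (j : Fin m → Fin (n + 1)) :
    ContinuousOn (fun x => contract (T x) q j) s :=
  continuousOn_finsetSum _ fun _ _ => continuousOn_const.mul (hT _)

lemma continuous_jet {u : Euc n → ℂ} (hu : ContDiff ℝ ∞ u) (i : Fin (n + 1)) :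
    Continuous fun x => jet u x i := by
  refine Fin.cases ?_ (fun i => ?_) i
  · simpa [jet] using hu.continuous
  · simpa [jet] using (contDiff_partialDeriv hu i).continuous

/-- Jets of solutions attain every value at every point. -/
lemma exists_solution_jet {Ω : Set (Euc n)} (hn : 3 ≤ n) (ho : IsOpen Ω)
    (hb : Bornology.IsBounded Ω) {γ₀ : Euc n → ℝ} {ρ : Euc n → ℂ} (hρ : ContDiff ℝ ∞ ρ)
    (hρ0 : ∀ x, ρ x ≠ 0) (hγρ : ∀ x ∈ Ω, (γ₀ x : ℂ) = ρ x * ρ x) {x : Euc n} (hx : x ∈ Ω)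
    (q : Fin (n + 1) → ℂ) :
    ∃ u : Euc n → ℂ, ContDiff ℝ ∞ u ∧ IsSolution Ω γ₀ u ∧ jet u x = q := by
  obtain ⟨u, hu, hus, hup⟩ := exists_solution_gradient hn ho hb hρ hρ0 hγρ hx fun i => q i.succ
  refine ⟨fun y => u y + (q 0 - u x) * 1, hu.add contDiff_const,
    isSolution_add_const_mul ho (hρ.mul hρ) hγρ hu contDiff_const hus (isSolution_const _ _) _,
    funext fun i => ?_⟩
  refine Fin.cases ?_ (fun i => ?_) i
  · simp [jet]
  · simp only [jet, Fin.cons_succ]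
    rw [partialDeriv_add hu.differentiableAt_infty contDiff_const.differentiableAt_infty,
      partialDeriv_const, hup, add_zero]

end Tensors

end Conductivity

namespace Conductivity

open Complex MeasureTheory Filter Topology

variable {n m : ℕ}

/-! ### Induction on the rank -/

section Uniqueness

variable {Ω : Set (Euc n)}

lemma gradForm_contract_single_zero {T : (Fin (m + 1) → Fin (n + 1)) → ℂ} (hT : IsSymmTensor T)
    (hzero : ∀ j, T (Fin.cons 0 j) = 0) (q : Fin (n + 1) → ℂ) (c : Fin n → ℂ)
    (J : Fin m → Fin (n + 1) → ℂ) :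
    gradForm (contract T q) c (Fin.cons (Pi.single 0 1) J) = 0 := by
  cases m with
  | zero => simp [gradForm_apply]
  | succ m =>
    have h0 : contract (contract T q) (Pi.single 0 1) = 0 := by
      ext j
      rw [contract_single, contract]
      refine Finset.sum_eq_zero fun i _ => ?_
      -- Symmetry moves the index 0 past the already contracted index to the front, where the
      -- components are known to vanish.
      have e : (Fin.cons i (Fin.cons 0 j) : Fin (m + 2) → Fin (n + 1)) ∘ Equiv.swap 0 1
          = Fin.cons 0 (Fin.cons i j) := by
        ext k
        refine Fin.cases ?_ (fun k => Fin.cases ?_ (fun k => ?_) k) k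
        · rw [Function.comp_apply, Equiv.swap_apply_left, ← Fin.succ_zero_eq_one, Fin.cons_succ,
            Fin.cons_zero, Fin.cons_zero]
        · rw [Function.comp_apply, Fin.succ_zero_eq_one, Equiv.swap_apply_right,
            ← Fin.succ_zero_eq_one, Fin.cons_succ, Fin.cons_zero, Fin.cons_zero]
        · rw [Function.comp_apply, Equiv.swap_apply_of_ne_of_ne (Fin.succ_ne_zero _)
            (by rw [← Fin.succ_zero_eq_one]; exact fun h => Fin.succ_ne_zero _ (Fin.succ_inj.1 h))]
          simp
      rw [← hT (Equiv.swap 0 1), e, hzero, mul_zero]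
    rw [gradForm_cons, h0]
    simp [gradForm_apply, form_apply]

/-- Contracting the leading order identity: if the components of `T` with first index `0` vanish,
so does the contraction with the null vector `e_a + i e_b`. -/
lemma contract_nullVec_eq_zero (hn : 3 ≤ n) (ho : IsOpen Ω) (hb : Bornology.IsBounded Ω)
    {γ₀ : Euc n → ℝ} {ρ : Euc n → ℂ} (hρ : ContDiff ℝ ∞ ρ) (hρ0 : ∀ x, ρ x ≠ 0)
    (hγρ : ∀ x ∈ Ω, (γ₀ x : ℂ) = ρ x * ρ x) {T : Euc n → (Fin (m + 1) → Fin (n + 1)) → ℂ}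
    (hT : ∀ j, ContinuousOn (fun x => T x j) (closure Ω))
    (hsymm : ∀ x ∈ Ω, IsSymmTensor (T x))
    (hzero : ∀ x ∈ Ω, ∀ j, T x (Fin.cons 0 j) = 0)
    (h : ∀ (v : Fin (m + 2) → Euc n → ℂ) (w : Euc n → ℂ), (∀ l, ContDiff ℝ ∞ (v l)) →
      ContDiff ℝ ∞ w → (∀ l, IsSolution Ω γ₀ (v l)) → IsSolution Ω γ₀ w →
      ∫ x in Ω, gradForm (T x) (fun i => partialDeriv i w x) (fun l => jet (v l) x) = 0)
    {a b : Fin n} (hab : a ≠ b) {x : Euc n} (hx : x ∈ Ω) (j : Fin m → Fin (n + 1)) :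
    contract (T x) (Fin.cons 0 (nullVec a b)) j = 0 := by
  set ν := nullVec a b with hνdef
  set q₀ : Fin (n + 1) → ℂ := Fin.cons 0 ν
  have hσ := contDiff_fun_inv hρ hρ0
  have hTν := continuousOn_contract hT q₀
  have hlead : ∀ (A : Euc n → ℂ) (v : Fin (m + 1) → Euc n → ℂ), ContDiff ℝ ∞ A →
      (∀ x, partialDeriv a A x + I * partialDeriv b A x = 0) → (∀ l, ContDiff ℝ ∞ (v l)) →
      (∀ l, IsSolution Ω γ₀ (v l)) → ∫ x in Ω, A x * ((ρ x)⁻¹ * (ρ x)⁻¹ *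
        gradForm (contract (T x) q₀) ν fun l => jet (v l) x) = 0 := by
    intro A v hA hAν hv hvs
    have hcontC : ∀ i j, ContinuousOn (fun x => gradForm (T x) (Pi.single j 1)
        (Fin.cons (Pi.single i 1) fun l => jet (v l) x)) (closure Ω) := fun i j =>
      continuousOn_gradForm hT _ fun l i' => by
        refine Fin.cases ?_ (fun l => ?_) l
        · simp only [Fin.cons_zero]; exact continuousOn_const
        · simp only [Fin.cons_succ]; exact (continuous_jet (hv l) i').continuousOn
    have key := integral_leading_symbol_eq_zero a ho hb hρ hρ0 hγρ hA (sum_nullVec_sq hab)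
      (reVec_nullVec_ne_zero hab) (fun x => by rw [sum_nullVec_mul, hAν]) hcontC
      (fun u w hu hw hus hws => by
        rw [← h (Fin.cons u v) w (Fin.cases hu hv) hw (Fin.cases hus hvs) hws]
        congr 1
        ext x
        have e : (fun l => jet ((Fin.cons u v : Fin (m + 2) → Euc n → ℂ) l) x)
            = Fin.cons (jet u x) fun l => jet (v l) x := by
          ext l
          refine Fin.cases ?_ (fun l => ?_) l <;> simp
        rw [e, gradForm_eq_sum_left, Finset.sum_comm]
        refine Finset.sum_congr rfl fun j _ => ?_
        rw [gradForm_eq_sum_head, Finset.mul_sum]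
        exact Finset.sum_congr rfl fun i _ => by ring)
    rw [← key]
    congr 1
    ext x
    congr 2
    have e := gradForm_cons (T x) ν q₀ fun l => jet (v l) x
    -- The term pairing the two optics gradients with each other carries ν·ν and disappears; only
    -- the contraction of T with ν is left.
    rw [show ∑ i, ν i * q₀ i.succ = 0 from sum_nullVec_sq hab, zero_mul, zero_add] at e
    rw [← e, gradForm_eq_sum_head, Fin.sum_univ_succ]
    simp only [q₀, Fin.cons_zero, zero_mul, zero_add, Fin.cons_succ]
    refine Finset.sum_congr rfl fun i _ => ?_
    rw [gradForm_eq_sum_left, Finset.mul_sum]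
    exact Finset.sum_congr rfl fun j _ => by rw [← hνdef]; ring
  have hz : ∀ y ∈ Ω, ∀ J : Fin m → Fin (n + 1) → ℂ,
      gradForm (contract (T y) q₀) ν (Fin.cons (Pi.single 0 1) J) = 0 := by
    exact fun y hy => gradForm_contract_single_zero (hsymm y hy) (hzero y hy) q₀ ν
  -- By `hz` the zeroth jet component of one remaining solution does not contribute. The identity is
  -- therefore first order in that solution, with the other jets absorbed into the vector field.
  have hall : ∀ v : Fin m → Euc n → ℂ, (∀ l, ContDiff ℝ ∞ (v l)) → (∀ l, IsSolution Ω γ₀ (v l)) →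
      ∀ i : Fin n, ∀ y ∈ Ω, (ρ y)⁻¹ * (ρ y)⁻¹ * gradForm (contract (T y) q₀) ν
        (Fin.cons (Pi.single i.succ 1) fun l => jet (v l) y) = 0 := by
    intro v hv hvs
    refine eq_zero_of_integral_first_order hab hn ho hb hρ hρ0 hγρ (fun i => ?_) ?_
    · refine (hσ.mul hσ).continuous.continuousOn.mul (continuousOn_gradForm hTν _ fun l i' => ?_)
      refine Fin.cases ?_ (fun l => ?_) l
      · simp only [Fin.cons_zero]; exact continuousOn_const
      · simp only [Fin.cons_succ]; exact (continuous_jet (hv l) i').continuousOn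
    · intro A u hA hAν hu hus
      rw [← hlead A (Fin.cons u v) hA hAν (Fin.cases hu hv) (Fin.cases hus hvs)]
      refine setIntegral_congr_fun ho.measurableSet fun y hy => ?_
      have e : (fun l => jet ((Fin.cons u v : Fin (m + 1) → Euc n → ℂ) l) y)
          = Fin.cons (jet u y) fun l => jet (v l) y := by
        ext l
        refine Fin.cases ?_ (fun l => ?_) l <;> simp
      rw [e, gradForm_eq_sum_head, Fin.sum_univ_succ, hz y hy, mul_zero, zero_add]
      refine congrArg (A y * ·) ?_
      rw [Finset.mul_sum]
      refine Finset.sum_congr rfl fun i _ => ?_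
      simp only [jet, Fin.cons_succ]
      ring
  -- With all jets equal to q the m + 1 summands of `gradForm` coincide, and the factor m + 1 can be
  -- cancelled.
  have hdiag : ∀ q : Fin (n + 1) → ℂ, (∑ i, ν i * q i.succ) * form (contract (T x) q₀)
      (fun _ => q) = 0 := by
    intro q
    obtain ⟨u, hu, hus, hq⟩ := exists_solution_jet hn ho hb hρ hρ0 hγρ hx q
    have h0 : gradForm (contract (T x) q₀) ν (Fin.cons q fun _ => q) = 0 := by
      rw [gradForm_eq_sum_head, Fin.sum_univ_succ, hz x hx, mul_zero, zero_add]
      refine Finset.sum_eq_zero fun i _ => ?_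
      have := hall (fun _ => u) (fun _ => hu) (fun _ => hus) i x hx
      rw [mul_eq_zero] at this
      have := this.resolve_left (mul_ne_zero (inv_ne_zero (hρ0 x)) (inv_ne_zero (hρ0 x)))
      simp only [hq] at this
      rw [this, mul_zero]
    rw [show (Fin.cons q fun _ => q : Fin (m + 1) → Fin (n + 1) → ℂ) = fun _ => q by
      ext l
      refine Fin.cases ?_ (fun l => ?_) l <;> simp, gradForm_apply, Finset.sum_const,
      Finset.card_univ, Fintype.card_fin, nsmul_eq_mul] at h0
    exact (mul_eq_zero.1 h0).resolve_left (by exact_mod_cast Nat.succ_ne_zero m)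
  refine eq_zero_of_form_diagonal ((hsymm x hx).contract q₀) (fun q => ?_) j
  -- On the hyperplane where the scalar factor vanishes, q is perturbed along e_a, which changes the
  -- factor by exactly 1/k; continuity concludes.
  by_cases hq : ∑ i, ν i * q i.succ = 0
  · have hlim : Tendsto (fun k : ℕ => form (contract (T x) q₀)
        (fun _ => q + ((k : ℂ))⁻¹ • Pi.single a.succ 1)) atTop
        (𝓝 (form (contract (T x) q₀) fun _ => q)) := by
      have hc : Continuous fun s : ℂ => form (contract (T x) q₀)
          (fun _ => q + s • Pi.single a.succ 1) := by
        simp only [form_apply, Pi.add_apply, Pi.smul_apply]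
        fun_prop
      have := (hc.tendsto 0).comp tendsto_inv_natCast_complex
      simpa [Function.comp_def] using this
    refine tendsto_nhds_unique hlim (tendsto_const_nhds.congr' ?_)
    filter_upwards [eventually_ge_atTop 1] with k hk
    have hk0 : (k : ℂ) ≠ 0 := by exact_mod_cast (by omega : k ≠ 0)
    refine ((mul_eq_zero.1 (hdiag _)).resolve_left ?_).symm
    have : ∑ i, ν i * (q + ((k : ℂ))⁻¹ • Pi.single a.succ 1 : Fin (n + 1) → ℂ) i.succ
        = (k : ℂ)⁻¹ := by
      simp only [Pi.add_apply, mul_add, Finset.sum_add_distrib, hq, zero_add]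
      rw [sum_nullVec_mul]
      simp [hab.symm]
    rw [this]
    exact inv_ne_zero hk0
  · exact (mul_eq_zero.1 (hdiag q)).resolve_left hq

/-- A symmetric tensor field whose `gradForm` of jets of solutions integrates to zero vanishes. -/
theorem eq_zero_of_integral_gradForm (hn : 3 ≤ n) (ho : IsOpen Ω) (hb : Bornology.IsBounded Ω)
    {γ₀ : Euc n → ℝ} {ρ : Euc n → ℂ} (hρ : ContDiff ℝ ∞ ρ) (hρ0 : ∀ x, ρ x ≠ 0)
    (hγρ : ∀ x ∈ Ω, (γ₀ x : ℂ) = ρ x * ρ x) {T : Euc n → (Fin m → Fin (n + 1)) → ℂ}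
    (hT : ∀ j, ContinuousOn (fun x => T x j) (closure Ω))
    (hsymm : ∀ x ∈ Ω, IsSymmTensor (T x))
    (h : ∀ (v : Fin (m + 1) → Euc n → ℂ) (w : Euc n → ℂ), (∀ l, ContDiff ℝ ∞ (v l)) →
      ContDiff ℝ ∞ w → (∀ l, IsSolution Ω γ₀ (v l)) → IsSolution Ω γ₀ w →
      ∫ x in Ω, gradForm (T x) (fun i => partialDeriv i w x) (fun l => jet (v l) x) = 0) :
    ∀ x ∈ Ω, ∀ j, T x j = 0 := by
  induction m with
  | zero =>
    intro x hx j
    rw [Subsingleton.elim j Fin.elim0]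
    have h01 : (⟨0, by omega⟩ : Fin n) ≠ ⟨1, by omega⟩ := by simp
    have h02 : (⟨0, by omega⟩ : Fin n) ≠ ⟨2, by omega⟩ := by simp
    have h12 : (⟨1, by omega⟩ : Fin n) ≠ ⟨2, by omega⟩ := by simp
    refine eq_zero_of_integral_gradDot h01 h02 h12 ho hb hρ hρ0 hγρ (hT Fin.elim0) ?_ x hx
    intro u w hu hw hus hws
    rw [← h (fun _ => u) w (fun _ => hu) hw (fun _ => hus) hws]
    congr 1
    ext y
    rw [gradForm_apply]
    rw [Fin.sum_univ_succ, Fin.sum_univ_zero, add_zero, form_apply,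
      Fintype.sum_subsingleton _ Fin.elim0, Fin.prod_univ_zero, mul_one, mul_comm]
    refine congrArg (· * T y Fin.elim0) (Finset.sum_congr rfl fun i _ => ?_)
    rw [mul_comm, jet, Fin.cons_succ]
  | succ m ih =>
    have hzero : ∀ x ∈ Ω, ∀ j, T x (Fin.cons 0 j) = 0 := by
      -- Insert the constant solution 1: its jet is e_0 and its gradient is 0, so the rank drops by
      -- one.
      have := ih (T := fun x => contract (T x) (Pi.single 0 1)) (continuousOn_contract hT _)
        (fun x hx => (hsymm x hx).contract _) ?_
      · intro x hx j
        rw [← contract_single (T x)]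
        exact this x hx j
      · intro v w hv hw hvs hws
        rw [← h (Fin.cons (fun _ => 1) v) w (Fin.cases contDiff_const hv) hw
          (Fin.cases (isSolution_const _ _) hvs) hws]
        congr 1
        ext x
        have e : (fun l => jet ((Fin.cons (fun _ => 1) v : Fin (m + 2) → Euc n → ℂ) l) x)
            = Fin.cons (Pi.single 0 1) fun l => jet (v l) x := by
          ext l i
          refine Fin.cases ?_ (fun l => ?_) l
          · refine Fin.cases ?_ (fun i => ?_) i <;> simp [jet, partialDeriv_const]
          · simp
        rw [e, gradForm_cons]
        simp
    intro x hx j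
    have hnull : ∀ {a b : Fin n}, a ≠ b → ∀ j,
        T x (Fin.cons a.succ j) + I * T x (Fin.cons b.succ j) = 0 := fun {a b} hab j => by
      rw [← contract_nullVec_eq_zero hn ho hb hρ hρ0 hγρ hT hsymm hzero h hab hx j, contract,
        Fin.sum_univ_succ]
      simp only [Fin.cons_zero, zero_mul, zero_add, Fin.cons_succ]
      rw [sum_nullVec_mul a b fun i => T x (Fin.cons i.succ j)]
    rw [← Fin.cons_self_tail j]
    generalize Fin.tail j = j'
    refine Fin.cases (hzero x hx j') (fun a => ?_) (j 0)
    obtain ⟨b, hab⟩ : ∃ b, a ≠ b := by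
      have : Nontrivial (Fin n) := Fin.nontrivial_iff_two_le.2 (by omega)
      exact (exists_ne a).imp fun _ h => h.symm
    -- e_a = ½((e_a + i e_b) - i(e_b + i e_a)).
    linear_combination (1 / 2) * hnull hab j' - I / 2 * hnull hab.symm j'
      + (1 / 2) * T x (Fin.cons a.succ j') * I_mul_I

end Uniqueness

/-! ### Collapsing the sum over permutations -/

section Symmetrization

lemma sum_perm_apply_last {M : Type*} [AddCommMonoid M] (g : Fin (m + 1) → M) :
    ∑ σ : Equiv.Perm (Fin (m + 1)), g (σ (Fin.last m)) = m.factorial • ∑ l, g l := by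
  -- Precomposing with this swap replaces σ(last) by σ(0), the value that `decomposeFin` separates
  -- from the remaining m! choices.
  rw [← Equiv.sum_comp (Equiv.mulRight (Equiv.swap 0 (Fin.last m)))]
  simp only [Equiv.coe_mulRight, Equiv.Perm.mul_apply, Equiv.swap_apply_right]
  rw [← Equiv.sum_comp Equiv.Perm.decomposeFin.symm, Fintype.sum_prod_type_right]
  simp [Fintype.card_perm]

/-- Two enumerations of the indices other than σ(last) differ by a permutation of m slots, which
symmetry ignores. -/
lemma form_comp_castSucc {T : (Fin m → Fin (n + 1)) → ℂ} (hT : IsSymmTensor T)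
    (J : Fin (m + 1) → Fin (n + 1) → ℂ) (σ : Equiv.Perm (Fin (m + 1))) :
    form T (fun k => J (σ k.castSucc)) = form T fun k => J ((σ (Fin.last m)).succAbove k) := by
  have hex : ∀ k : Fin m, ∃ k', (σ (Fin.last m)).succAbove k' = σ k.castSucc := fun k =>
    Fin.exists_succAbove_eq fun h => (Fin.castSucc_lt_last k).ne (σ.injective h)
  choose τ hτ using hex
  have hinj : Function.Injective τ := fun k k' h => by
    have := hτ k
    rw [h, hτ k'] at this
    exact Fin.castSucc_injective _ (σ.injective this.symm)
  rw [← form_comp_perm hT (fun k => J ((σ (Fin.last m)).succAbove k))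
    (Equiv.ofBijective τ (Finite.injective_iff_bijective.1 hinj))]
  simp only [Equiv.ofBijective_apply, hτ]

end Symmetrization

end Conductivity

open Conductivity MeasureTheory in
theorem proposition1p2 (n : ℕ) (hn : 3 ≤ n) (m : ℕ) (hm : 1 ≤ m)
    (Ω : Set (EuclideanSpace ℝ (Fin n)))
    (hΩ_open : IsOpen Ω) (hΩ_bdd : Bornology.IsBounded Ω)
    (hΩ_smooth : Conductivity.HasSmoothBoundary Ω)
    (γ₀ : EuclideanSpace ℝ (Fin n) → ℝ)
    (hγ₀ : Conductivity.SmoothUpToBoundary Ω γ₀) (hγ₀_pos : ∀ x ∈ closure Ω, 0 < γ₀ x)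
    (T : EuclideanSpace ℝ (Fin n) → (Fin m → Fin (n + 1)) → ℂ)
    (hT_cont : ContinuousOn T (closure Ω))
    (hT_symm : ∀ x ∈ closure Ω, Conductivity.IsSymmTensor (T x))
    (hT : ∀ u : Fin (m + 2) → EuclideanSpace ℝ (Fin n) → ℂ,
      (∀ l, Conductivity.SmoothUpToBoundary Ω (u l)) →
      (∀ l, Conductivity.IsSolution Ω γ₀ (u l)) →
      ∑ σ : Equiv.Perm (Fin (m + 1)), ∑ j : Fin m → Fin (n + 1),
        ∫ x in Ω, T x j *
          (∏ k : Fin m, Conductivity.jet (u (σ k.castSucc).castSucc) x (j k)) *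
          Conductivity.gradDot (u (σ (Fin.last m)).castSucc) (u (Fin.last (m + 1))) x = 0) :
    ∀ x ∈ Ω, ∀ j : Fin m → Fin (n + 1), T x j = 0 := by
  obtain ⟨ρ, hρ, hρ0, hγρ⟩ := exists_sqrt_conductivity hΩ_bdd hγ₀ hγ₀_pos
  have hTc : ∀ j, ContinuousOn (fun x => T x j) (closure Ω) := continuousOn_pi.1 hT_cont
  refine eq_zero_of_integral_gradForm hn hΩ_open hΩ_bdd hρ hρ0 hγρ hTc
    (fun x hx => hT_symm x (subset_closure hx)) fun v w hv hw hvs hws => ?_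
  have hu : ∀ l, ContDiff ℝ ∞ ((Fin.snoc v w : Fin (m + 2) → Euc n → ℂ) l) :=
    Fin.lastCases (by simpa using hw) fun l => by simpa using hv l
  have hus : ∀ l, IsSolution Ω γ₀ ((Fin.snoc v w : Fin (m + 2) → Euc n → ℂ) l) :=
    Fin.lastCases (by simpa using hws) fun l => by simpa using hvs l
  have key := hT (Fin.snoc v w) (fun l => ⟨_, hu l, fun _ _ => rfl⟩) hus
  simp only [Fin.snoc_castSucc, Fin.snoc_last] at key
  have hgrad : ∀ l, Continuous (gradDot (v l) w) := fun l =>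
    continuous_finsetSum _ fun i _ => (contDiff_partialDeriv (hv l) i).continuous.mul
      (contDiff_partialDeriv hw i).continuous
  have hterm : ∀ (κ : Fin m → Fin (m + 1)) (l : Fin (m + 1)) (j : Fin m → Fin (n + 1)),
      IntegrableOn (fun x => T x j * (∏ k, jet (v (κ k)) x (j k)) * gradDot (v l) w x) Ω :=
    fun κ l j => integrableOn_of_continuousOn_closure hΩ_bdd
      (((hTc j).mul (continuous_finsetProd _ fun k _ =>
        continuous_jet (hv _) _).continuousOn).mul (hgrad l).continuousOn)
  have hsum : ∀ (κ : Fin m → Fin (m + 1)) (l : Fin (m + 1)),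
      ∑ j : Fin m → Fin (n + 1), ∫ x in Ω, T x j * (∏ k, jet (v (κ k)) x (j k)) * gradDot (v l) w x
        = ∫ x in Ω, gradDot (v l) w x * form (T x) fun k => jet (v (κ k)) x := fun κ l => by
    rw [← integral_finsetSum _ fun j _ => hterm κ l j]
    congr 1
    ext x
    rw [form_apply, ← Finset.sum_mul, mul_comm]
  have hperm : ∀ σ : Equiv.Perm (Fin (m + 1)), ∑ j : Fin m → Fin (n + 1),
      ∫ x in Ω, T x j * (∏ k : Fin m, jet (v (σ k.castSucc)) x (j k)) *
        gradDot (v (σ (Fin.last m))) w x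
      = (fun l => ∫ x in Ω, gradDot (v l) w x * form (T x) fun k => jet (v (l.succAbove k)) x)
          (σ (Fin.last m)) := fun σ => by
    rw [hsum (fun k => σ k.castSucc)]
    refine setIntegral_congr_fun hΩ_open.measurableSet fun x hx => ?_
    rw [form_comp_castSucc (hT_symm x (subset_closure hx)) (fun l => jet (v l) x)]
  rw [Finset.sum_congr rfl fun σ _ => hperm σ, sum_perm_apply_last (fun l =>
    ∫ x in Ω, gradDot (v l) w x * form (T x) fun k => jet (v (l.succAbove k)) x),
    nsmul_eq_mul] at key
  -- Each index occupies the last slot for m! permutations, and this common factor is nonzero.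
  have key := (mul_eq_zero.1 key).resolve_left (by exact_mod_cast m.factorial_ne_zero)
  rw [← key, ← integral_finsetSum]
  · congr 1
    ext x
    rw [gradForm_apply]
    refine Finset.sum_congr rfl fun l _ => ?_
    congr 1
    simp only [jet, Fin.cons_succ, gradDot]
    exact Finset.sum_congr rfl fun i _ => mul_comm _ _
  · intro l _
    refine ((integrable_finsetSum Finset.univ fun j _ =>
      hterm (fun k => l.succAbove k) l j).congr (Filter.Eventually.of_forall fun x => ?_))
    simp only
    rw [form_apply, ← Finset.sum_mul, mul_comm]
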